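/- Let $n\ge 1$, let $e_1,\dots,e_n$ be the standard orthonormal basis of $\mathbb C^n$, $\alpha_i=e_i-e_{i+1}$, $\Gamma=\{\alpha_1,\dots,\alpha_{n-1}\}$, and let $(T,\Gamma_1,\Gamma_2)$ be a Belavin–Drinfeld triple of type $A_{n-1}$: $\Gamma_1,\Gamma_2\subset\Gamma$ and $T:\Gamma_1\to\Gamma_2$ is a bijection which preserves the inner product and is nilpotent (for each $\alpha\in\Gamma_1$ some $T^k\alpha\notin\Gamma_1$). Let $s=\sum_{i,j} s_{ij}\,e_{ii}\otimes e_{jj}$ with $s_{ij}=-s_{ji}\in\mathbb C$ satisfy $[(\alpha-T\alpha)\otimes 1]\,s=\tfrac12[(\alpha+T\alpha)\otimes 1]\sum_i e_{ii}\otimes e_{ii}$ for all $\alpha\in\Gamma_1$, where $(\sum\lambda_ie_i)(e_{jj})=\lambda_j$. *Combinatorial data.* For a positive root $\alpha=e_i-e_j$ ($i<j$) put $|\alpha|=j-i$, $e_\alpha=e_{ij}$, $e_{-\alpha}=e_{ji}$. Extend $T$ additively to the positive roots in the span of $\Gamma_1$, and write $\alpha\prec\beta$ if $\beta=T^k\alpha$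 for some $k\ge1$; this $k$ is the order $\mathrm{Ord}(\beta,-\alpha)$ of the pair. For $\alpha=e_i-e_j\prec\beta=T^k\alpha=e_l-e_m$ put $C_{\alpha,\beta}=0$ if $T^k\alpha_i=\alpha_l$ and $T^k\alpha_{j-1}=\alpha_{m-1}$ ($T^k$ preserves orientation on $\alpha$), and $C_{\alpha,\beta}=1$ otherwise. The right-passing order of $\alpha=e_i-e_j$ is the $p\geq 1$ with $T^p\alpha=e_j-e_{2j-i}$, and the left-passing order is the $p\ge1$ with $T^p\alpha=e_{2i-j}-e_i$ (it is $\infty$ if there is none). For $\alpha\prec\beta$ of order $k$ and $p$ the right-passing order of $\alpha$, let $P^r(\beta,-\alpha)=\frac12$ if $k=p$; let $P^r(\beta,-\alpha)=1$ if $k>p$ and either $|\alpha|>1$ and $C_{\alpha,\beta}=C_{\alpha,T^p\alpha}$, or $|\alpha|=1$ and $T^{k-p}$ preserves orientation on the root $\alpha+T^p\alpha$; and let $P^r(\beta,-\alpha)=0$ otherwise. Define $P^l$ in the same way with the left-passing order, and $P^a=P^r-P^l$. *The GGS matrix.* Let $$a=\sum_{\alpha\prec\beta}(-1)^{C_{\alpha,\beta}(|\alpha|-1)}(e_{-\alpha}\otimes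 e_\beta-e_\beta\otimes e_{-\alpha}),\qquad r_{st}=\tfrac12\sum_i e_{ii}\otimes e_{ii}+\sum_{\alpha>0}e_{-\alpha}\otimes e_\alpha,\qquad r=s+a+r_{st},$$ and let $q=e^\hbar$. Among the functions of $\hbar\in\mathbb C$ with values in $Mat_n(\mathbb C)\otimes Mat_n(\mathbb C)$ all of whose coefficients have the form $x\,q^y(q-q^{-1})^z$ with $x,y\in\mathbb C$, $z\in\{0,1\}$, there is exactly one which is $\equiv 1+2\hbar r+2\hbar^2r^2\pmod{\hbar^3}$. It is called $R_{\mathrm{GGS}}$. *The ESS matrix.* For $k\ge1$ let $$J_k=1+\sum_{\beta=T^k\alpha}(-q)^{-C_{\alpha,\beta}(|\alpha|-1)}q^{P^a(\beta,-\alpha)}(q-q^{-1})\,e_\beta\otimes e_{-\alpha},\qquad J=J_1J_2\cdots J_m,$$ where $m$ is the largest order of a pair $\alpha\prec\beta$ ($J=1$ if there is none), let $R_{st}=q\sum_i e_{ii}\otimes e_{ii}+\sum_{i\ne j}e_{ii}\otimes e_{jj}+(q-q^{-1})\sum_{i>j}e_{ij}\otimes e_{ji}$, let $J^{21}$ be $J$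 with its tensor factors interchanged, and let $R_J=q^s\,J^{-1}R_{st}J^{21}\,q^s$. **Theorem.** For every such triple and every such $s$, $R_J=R_{\mathrm{GGS}}$. -/

import Mathlib

open scoped Kronecker

namespace GGS

/-- The simple root `α_k = e_k - e_{k+1}` of `sl(ℓ+1)`, for `k = 0, …, ℓ-1`, in coordinates. -/
def simpleRoot {ℓ : ℕ} (k : Fin ℓ) : Fin (ℓ + 1) → ℤ :=
  Pi.single k.castSucc 1 - Pi.single k.succ 1

/-- A Belavin–Drinfeld triple of type `A_ℓ` (so `n = ℓ + 1`).  Subsets of the set of simple roots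
are sets of indices; only the values of `T` on `Γ₁` matter. -/
structure BDTriple (ℓ : ℕ) where
  /-- The domain of `T`. -/
  Γ₁ : Finset (Fin ℓ)
  /-- The image of `T`. -/
  Γ₂ : Finset (Fin ℓ)
  /-- The map `T`, on indices of simple roots. -/
  T : Fin ℓ → Fin ℓ
  bijOn : Set.BijOn T Γ₁ Γ₂
  inner_eq : ∀ i ∈ Γ₁, ∀ j ∈ Γ₁,
    simpleRoot (T i) ⬝ᵥ simpleRoot (T j) = simpleRoot i ⬝ᵥ simpleRoot j
  nilpotent : ∀ i ∈ Γ₁, ∃ k : ℕ, T^[k] i ∉ Γ₁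

/-- The positive roots `e_i - e_j`, `i < j`. -/
abbrev PosRoot (ℓ : ℕ) : Type := {p : Fin (ℓ + 1) × Fin (ℓ + 1) // p.1 < p.2}

namespace PosRoot

variable {ℓ : ℕ}

/-- The root `e_i - e_j` as a vector. -/
def vec (α : PosRoot ℓ) : Fin (ℓ + 1) → ℤ := Pi.single α.1.1 1 - Pi.single α.1.2 1

/-- `|e_i - e_j| = j - i`. -/
def height (α : PosRoot ℓ) : ℕ := (α.1.2 : ℕ) - (α.1.1 : ℕ)

/-- The simple roots occurring in `e_i - e_j = α_i + ⋯ + α_{j-1}`.  The root lies in the span of a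
set `Y` of simple roots iff `support ⊆ Y`. -/
def support (α : PosRoot ℓ) : Finset (Fin ℓ) :=
  Finset.univ.filter fun k => (α.1.1 : ℕ) ≤ k ∧ (k : ℕ) < α.1.2

/-- The index of the first simple root `α_i` of `e_i - e_j`. -/
def first (α : PosRoot ℓ) : Fin ℓ :=
  ⟨α.1.1, lt_of_lt_of_le (Fin.lt_def.mp α.2) (Nat.lt_succ_iff.mp α.1.2.2)⟩

/-- The index of the last simple root `α_{j-1}` of `e_i - e_j`. -/
def last (α : PosRoot ℓ) : Fin ℓ :=
  ⟨(α.1.2 : ℕ) - 1, by have h := Fin.lt_def.mp α.2; have h' := α.1.2.2; omega⟩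

/-- For `α = e_i - e_j`: `γ = e_j - e_{2j-i}`. -/
def RightAdj (α γ : PosRoot ℓ) : Prop :=
  γ.1.1 = α.1.2 ∧ (γ.1.2 : ℕ) + (α.1.1 : ℕ) = 2 * (α.1.2 : ℕ)

/-- For `α = e_i - e_j`: `γ = e_{2i-j} - e_i`. -/
def LeftAdj (α γ : PosRoot ℓ) : Prop :=
  γ.1.2 = α.1.1 ∧ (γ.1.1 : ℕ) + (α.1.2 : ℕ) = 2 * (α.1.1 : ℕ)

end PosRoot

/-- `Mat_n(ℂ) ⊗ Mat_n(ℂ)`, `n = ℓ + 1`, through the Kronecker product: the entry in row `(i, k)` and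
column `(j, l)` is the coefficient of `e_{ij} ⊗ e_{kl}`. -/
abbrev Mat2 (ℓ : ℕ) : Type :=
  Matrix (Fin (ℓ + 1) × Fin (ℓ + 1)) (Fin (ℓ + 1) × Fin (ℓ + 1)) ℂ

/-- `e_{ij} ⊗ e_{kl}`. -/
def E {ℓ : ℕ} (i j k l : Fin (ℓ + 1)) : Mat2 ℓ := Matrix.single i j 1 ⊗ₖ Matrix.single k l 1

/-- `e_{-α} ⊗ e_β`. -/
def eNegPos {ℓ : ℕ} (α β : PosRoot ℓ) : Mat2 ℓ := E α.1.2 α.1.1 β.1.1 β.1.2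

/-- `e_β ⊗ e_{-α}`. -/
def ePosNeg {ℓ : ℕ} (β α : PosRoot ℓ) : Mat2 ℓ := E β.1.1 β.1.2 α.1.2 α.1.1

/-- The flip `x ↦ x²¹`. -/
def flip {ℓ : ℕ} (x : Mat2 ℓ) : Mat2 ℓ := x.submatrix Prod.swap Prod.swap

/-- The standard classical `r`-matrix. -/
noncomputable def rst (ℓ : ℕ) : Mat2 ℓ :=
  (1 / 2 : ℂ) • ∑ i, E i i i i + ∑ α : PosRoot ℓ, eNegPos α α

/-- The standard quantum `R`-matrix. -/
noncomputable def Rst (ℓ : ℕ) (q : ℂ) : Mat2 ℓ :=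
  q • ∑ i, E i i i i + ∑ i, ∑ j, (if i ≠ j then E i i j j else 0)
    + (q - q⁻¹) • ∑ i, ∑ j, (if j < i then E i j j i else 0)

/-- The element `∑ s_{ij} e_{ii} ⊗ e_{jj}` of `𝔥 ⊗ 𝔥`. -/
noncomputable def cartan {ℓ : ℕ} (s : Matrix (Fin (ℓ + 1)) (Fin (ℓ + 1)) ℂ) : Mat2 ℓ :=
  ∑ i, ∑ j, s i j • E i i j j

/-- `q^y = e^{yħ}`, where `q = e^ħ`. -/
noncomputable def qpow (h y : ℂ) : ℂ := Complex.exp (y * h)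

/-- `q^s = e^{ħ s}` for `s = ∑ s_{ij} e_{ii} ⊗ e_{jj}`, which is a diagonal matrix. -/
noncomputable def qpowCartan {ℓ : ℕ} (h : ℂ) (s : Matrix (Fin (ℓ + 1)) (Fin (ℓ + 1)) ℂ) :
    Mat2 ℓ :=
  Matrix.diagonal fun p => qpow h (s p.1 p.2)

namespace BDTriple

variable {ℓ : ℕ} (D : BDTriple ℓ)

/-- `T α = β` for positive roots: `α` lies in the span of `Γ₁` and `β` is its image under the
additive extension of `T`. -/
def Maps (α β : PosRoot ℓ) : Prop :=
  α.support ⊆ D.Γ₁ ∧ β.vec = ∑ k ∈ α.support, simpleRoot (D.T k)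

/-- `T^k α = β` (in particular `T^k α` is defined). -/
def Iter : ℕ → PosRoot ℓ → PosRoot ℓ → Prop
  | 0, α, β => α = β
  | k + 1, α, β => ∃ γ, Iter k α γ ∧ D.Maps γ β

/-- The ordering `α ≺ β`. -/
def Prec (α β : PosRoot ℓ) : Prop := ∃ k, 0 < k ∧ D.Iter k α β

/-- `T^k`, with `T^k α = β`, sends the first simple root of `α` to the first one of `β` and the last
one to the last one. -/
def Preserves (k : ℕ) (α β : PosRoot ℓ) : Prop :=
  D.T^[k] α.first = β.first ∧ D.T^[k] α.last = β.last

open Classical in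
/-- `C_{α,β}` for `α ≺ β`: `1` if orientation is reversed, `0` if it is preserved. -/
noncomputable def C (α β : PosRoot ℓ) : ℕ :=
  if ∃ k, 0 < k ∧ D.Iter k α β ∧ ¬ D.Preserves k α β then 1 else 0

/-- For `T^p α = γ` and `T^k α = β` with `p < k` and `γ` adjacent to `α`: the orientations agree.
If `α` is a simple root, a single root carries no orientation, and the condition is that
`T^{k-p}`, which sends `γ` to `β`, preserves the orientation of the root `α + γ`.  (If `|α| > 1`
this is the same as `C_{α,β} = C_{α,γ}`.) -/
def SameOrientation (p k : ℕ) (α γ β : PosRoot ℓ) : Prop :=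
  if 1 < α.height then D.C α β = D.C α γ
  else ∃ δ η : PosRoot ℓ, δ.vec = α.vec + γ.vec ∧ D.Iter (k - p) δ η ∧ D.Preserves (k - p) δ η

/-- The positive `T`-pair `(β, -α)` of order `k` is (right- or left-) passed: the (right- or left-)
passing order `p` of `α` is finite and smaller than `k`, and the orientations agree. -/
def Passed (adj : PosRoot ℓ → PosRoot ℓ → Prop) (α β : PosRoot ℓ) : Prop :=
  ∃ (p k : ℕ) (γ : PosRoot ℓ), 0 < p ∧ p < k ∧ D.Iter p α γ ∧ adj α γ ∧ D.Iter k α β ∧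
    D.SameOrientation p k α γ β

/-- The order of the positive `T`-pair `(β, -α)` equals the passing order of `α`. -/
def HalfPassed (adj : PosRoot ℓ → PosRoot ℓ → Prop) (α β : PosRoot ℓ) : Prop :=
  ∃ k, 0 < k ∧ D.Iter k α β ∧ adj α β

open Classical in
/-- `P^r` and `P^l`, for `adj = RightAdj` and `adj = LeftAdj`. -/
noncomputable def passing (adj : PosRoot ℓ → PosRoot ℓ → Prop) (α β : PosRoot ℓ) : ℂ :=
  if D.Passed adj α β then 1 else if D.HalfPassed adj α β then 1 / 2 else 0

/-- `P^a(β, -α) = P^r(β, -α) - P^l(β, -α)`. -/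
noncomputable def Pa (α β : PosRoot ℓ) : ℂ :=
  D.passing PosRoot.RightAdj α β - D.passing PosRoot.LeftAdj α β

/-- `s ∈ 𝔥 ∧ 𝔥` solves
`[(α - Tα) ⊗ 1] s = ½ [(α + Tα) ⊗ 1] P⁰` for all `α ∈ Γ₁`, where `P⁰ = ∑ e_{jj} ⊗ e_{jj}`. -/
def IsSolution (s : Matrix (Fin (ℓ + 1)) (Fin (ℓ + 1)) ℂ) : Prop :=
  s.transpose = -s ∧
  ∀ k ∈ D.Γ₁, ∀ j,
    ∑ i, ((simpleRoot k i : ℂ) - (simpleRoot (D.T k) i : ℂ)) * s i j =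
      (1 / 2 : ℂ) * ((simpleRoot k j : ℂ) + (simpleRoot (D.T k) j : ℂ))

open Classical in
/-- `a = ∑_{α ≺ β} (-1)^{C_{α,β}(|α|-1)} (e_{-α} ⊗ e_β - e_β ⊗ e_{-α})`. -/
noncomputable def a : Mat2 ℓ :=
  ∑ α : PosRoot ℓ, ∑ β : PosRoot ℓ,
    if D.Prec α β then
      (-1 : ℂ) ^ (D.C α β * (α.height - 1)) • (eNegPos α β - ePosNeg β α)
    else 0

/-- The classical `r`-matrix `r = s + a + r_st`. -/
noncomputable def r (s : Matrix (Fin (ℓ + 1)) (Fin (ℓ + 1)) ℂ) : Mat2 ℓ := cartan s + D.a + rst ℓ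

/-- `R`, a function of `ħ` with values in `Mat_n(ℂ) ⊗ Mat_n(ℂ)`, is the GGS matrix: its
coefficients have the form `x q^y (q - q⁻¹)^z`, `x, y ∈ ℂ`, `z ∈ {0, 1}`, `q = e^ħ`, and
`R ≡ 1 + 2ħ r + 2ħ² r²` modulo `ħ³`. -/
def IsGGSMatrix (s : Matrix (Fin (ℓ + 1)) (Fin (ℓ + 1)) ℂ) (R : ℂ → Mat2 ℓ) : Prop :=
  (∀ u v, ∃ (x y : ℂ) (z : ℕ), (z = 0 ∨ z = 1) ∧
    ∀ h : ℂ, R h u v = x * qpow h y * (Complex.exp h - (Complex.exp h)⁻¹) ^ z) ∧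
  ∀ u v, Asymptotics.IsBigO (nhds 0)
    (fun h : ℂ => R h u v - (1 + (2 * h) • D.r s + (2 * h ^ 2) • (D.r s * D.r s) : Mat2 ℓ) u v)
    (fun h : ℂ => h ^ 3)

open Classical in
/-- `J_k = 1 + ∑_{T^k α = β} (-q)^{-C_{α,β}(|α|-1)} q^{P^a(β,-α)} (q - q⁻¹) e_β ⊗ e_{-α}`,
for `q = e^h`. -/
noncomputable def Jk (h : ℂ) (k : ℕ) : Mat2 ℓ :=
  1 + ∑ α : PosRoot ℓ, ∑ β : PosRoot ℓ,
    if D.Iter k α β then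
      ((-Complex.exp h) ^ (-((D.C α β * (α.height - 1) : ℕ) : ℤ)) * qpow h (D.Pa α β) *
        (Complex.exp h - (Complex.exp h)⁻¹)) • ePosNeg β α
    else 0

/-- The largest order of a positive `T`-pair (`0` if there is none). -/
noncomputable def maxOrd : ℕ := sSup {k | 0 < k ∧ ∃ α β, D.Iter k α β}

/-- The ordered product `J = J_1 J_2 ⋯ J_m`, `m` the largest order. -/
noncomputable def J (h : ℂ) : Mat2 ℓ :=
  ((List.range D.maxOrd).map fun k => D.Jk h (k + 1)).prod

/-- The ESS matrix `R_J = q^s J⁻¹ R_st J²¹ q^s`, as a function of `ħ`. -/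
noncomputable def RJ (s : Matrix (Fin (ℓ + 1)) (Fin (ℓ + 1)) ℂ) (h : ℂ) : Mat2 ℓ :=
  qpowCartan h s * ((D.J h)⁻¹ * Rst ℓ (Complex.exp h) * flip (D.J h)) * qpowCartan h s

end BDTriple

end GGS

/-!
All matrices in the theorem preserve the sum `c` of the two indices of `e_i ⊗ e_j`, so they split
into blocks indexed by `c`, and a block is a matrix in the second index alone.  The block of `c` is
attached to the reflection `mirror c : x ↦ c - x` of the line: the term `e_β ⊗ e_{-α}` lies in it
exactly if this reflection exchanges the intervals `α` and `β`.  A root `e_i - e_j` is an interval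
`[i, j]`, and `T` moves every connected component of `Γ₁` by a translation or a reflection.  For a
rigid motion `φ` of the line, a *step* along `[i, j]` replaces `φ` by `T ∘ φ` (`Motion.Stp`,
`Motion.Pth`).  Then `T^k α = β` means that `mirror c` is reached in `k` steps along `α` from one of
the two motions which carry `α` onto itself, the identity (then `C_{α,β} = 1` if `|α| > 1`) or the
reflection of `α` (then `C_{α,β} = 0`); and `α` is passed if the reflection at one of its ends is
met on the way (`BDTriple.iter_mirror_iff`, `C_mul`, `passing_eq`).

In these terms blocks make sense for every rigid motion `φ`, not only for reflections.  The block
of `J⁻¹ R_st J²¹` is `Rb φ = (tw φ)⁻¹ * Bt0 φ * tw' φ`.  The product `J = J₁ J₂ ⋯` telescopes along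
steps: if `ψ = T φ`, then, on a component on which this step is defined, `tw ψ` is `B0 φ * tw φ`, and
`tw' φ` is `Bt0 ψ * tw' ψ`, up to diagonal matrices of powers of `q` (`tw_congr`, `tw'_congr`).
Here `B0 φ` is the block of `R_st²¹`.  The difference `D0 φ = Bt0 φ - (B0 φ)⁻¹`, for a reflection a
multiple of the flip, intertwines the two twists (`D0_mul_tw'`), and so `Rb φ` equals `D0 φ` plus
`Rb ψ`, up to powers of `q` (`Rb_step`).  By induction every entry of `Rb φ` is an explicit monomial (`Rb_diag`, `Rb_upper`,
`Rb_lower`), and `R_J` has entries of the form `x q^y (q - q⁻¹)^z`, with first order term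
`2 r` (`BDTriple.RJ_diag`, `RJ_offdiag`).

For the second order term, reversing the paths shows that `R_J²¹(ħ) = R_J(-ħ) + (q - q⁻¹) P`, with
`P` the flip (`Rb_flip`, `BDTriple.flip_RJ`).  As `s` is skew, `P R_J` is conjugate to `P R_st` and
satisfies the Hecke relation `R_J²¹ R_J = (q - q⁻¹) P R_J + 1` (`flip_RJ_mul`).  Together these say
that `R_J(-ħ) R_J(ħ) = 1`, which makes the second order term half of the square of the first one.
So `R_J` is a GGS matrix, and there is no other one, since a monomial `x q^y (q - q⁻¹)^z`,
`z ∈ {0, 1}`, is determined by its Taylor polynomial of order two (`IsMonomial.eq`).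
-/

namespace GGS

/-! ### Rigid motions of the line and the edges they move -/

/-- A rigid motion of `ℤ`: a translation or a reflection. -/
def Rigid (φ : ℤ → ℤ) : Prop := (∃ c, ∀ x, φ x = c + x) ∨ ∃ c, ∀ x, φ x = c - x

/-- The edge `{e, e + 1}` of the line is named by its lower end `e`; `edge φ e` is the name of its
image under a rigid motion `φ`. -/
def edge (φ : ℤ → ℤ) (e : ℤ) : ℤ := min (φ e) (φ (e + 1))

/-- The reflection `x ↦ c - x`.  It fixes the point `x` if `c = 2x`, and exchanges `i` and `j` if
`c = i + j`. -/
def mirror (c : ℤ) : ℤ → ℤ := fun x => c - x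

theorem rigid_id : Rigid id := Or.inl ⟨0, fun x => by simp⟩

theorem rigid_mirror (c : ℤ) : Rigid (mirror c) := Or.inr ⟨c, fun _ => rfl⟩

theorem Rigid.comp {φ ψ : ℤ → ℤ} (h : Rigid φ) (h' : Rigid ψ) : Rigid (φ ∘ ψ) := by
  rcases h with ⟨c, h⟩ | ⟨c, h⟩ <;> rcases h' with ⟨d, h'⟩ | ⟨d, h'⟩
  · exact Or.inl ⟨c + d, fun x => by simp [h, h']; ring⟩
  · exact Or.inr ⟨c + d, fun x => by simp [h, h']; ring⟩
  · exact Or.inr ⟨c - d, fun x => by simp [h, h']; ring⟩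
  · exact Or.inl ⟨c - d, fun x => by simp [h, h']; ring⟩

theorem Rigid.injective {φ : ℤ → ℤ} (h : Rigid φ) : Function.Injective φ := by
  intro x y hxy
  rcases h with ⟨c, h⟩ | ⟨c, h⟩ <;> rw [h, h] at hxy <;> omega

theorem Rigid.exists_inv {φ : ℤ → ℤ} (h : Rigid φ) :
    ∃ ψ, Rigid ψ ∧ φ ∘ ψ = id ∧ ψ ∘ φ = id := by
  rcases h with ⟨c, h⟩ | ⟨c, h⟩
  · exact ⟨fun x => -c + x, Or.inl ⟨-c, fun _ => rfl⟩, by ext x; simp [h], by ext x; simp [h]⟩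
  · exact ⟨fun x => c - x, Or.inr ⟨c, fun _ => rfl⟩, by ext x; simp [h], by ext x; simp [h]⟩

theorem edge_id (e : ℤ) : edge id e = e := by simp [edge]

theorem edge_mirror (c e : ℤ) : edge (mirror c) e = c - e - 1 := by
  simp only [edge, mirror]; omega

theorem Rigid.edge_comp {φ τ : ℤ → ℤ} (h : Rigid φ) : edge (τ ∘ φ) e = edge τ (edge φ e) := by
  rcases h with ⟨c, h⟩ | ⟨c, h⟩
  · simp only [edge, Function.comp, h, ← add_assoc]; simp
  · simp only [edge, Function.comp, h]
    rw [show min (c - e) (c - (e + 1)) = c - (e + 1) by omega,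
      show c - (e + 1) + 1 = c - e by ring, min_comm]

theorem Rigid.edge_sub {φ : ℤ → ℤ} (h : Rigid φ) (e f : ℤ) : |edge φ e - edge φ f| = |e - f| := by
  rcases h with ⟨c, h⟩ | ⟨c, h⟩ <;> simp only [edge, h]
  · congr 1; omega
  · rw [abs_sub_comm e f]; congr 1; omega

theorem Rigid.eq_of_eq {φ ψ : ℤ → ℤ} (h : Rigid φ) (h' : Rigid ψ) {x y : ℤ} (hxy : x ≠ y)
    (h1 : φ x = ψ x) (h2 : φ y = ψ y) : φ = ψ := by
  ext w
  rcases h with ⟨c, h⟩ | ⟨c, h⟩ <;> rcases h' with ⟨d, h'⟩ | ⟨d, h'⟩ <;>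
    rw [h, h'] at * <;> omega

theorem mirror_comp_mirror (c : ℤ) : mirror c ∘ mirror c = id := by ext x; simp [mirror]

theorem mirror_inj {c d : ℤ} (h : mirror c = mirror d) : c = d := by
  have := congrFun h 0; simpa [mirror] using this

theorem id_ne_mirror (c : ℤ) : id ≠ mirror c := by
  intro h
  have h0 := congrFun h 0; have h1 := congrFun h 1
  simp only [id, mirror] at h0 h1; omega

/-! ### Oriented partial isometries and their paths -/

/-- A nilpotent partial isometry of the set of edges `0, …, ℓ - 1` of a path, with domain `Γ`, and
with a choice of orientations: the edge `e ∈ Γ` is moved by the rigid motion `t e` of the whole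
line, which is the same for adjacent edges of `Γ`, hence constant on the connected components
of `Γ`. -/
structure Motion (ℓ : ℕ) where
  /-- The domain. -/
  Γ : Set ℤ
  /-- The rigid motion attached to an edge of the domain. -/
  t : ℤ → ℤ → ℤ
  mem_range : ∀ e ∈ Γ, 0 ≤ e ∧ e < ℓ
  image_range : ∀ e ∈ Γ, 0 ≤ edge (t e) e ∧ edge (t e) e < ℓ
  rigid : ∀ e ∈ Γ, Rigid (t e)
  t_succ : ∀ e ∈ Γ, e + 1 ∈ Γ → t e = t (e + 1)
  inj : ∀ e ∈ Γ, ∀ f ∈ Γ, edge (t e) e = edge (t f) f → e = f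
  adj : ∀ e ∈ Γ, ∀ f ∈ Γ, |edge (t e) e - edge (t f) f| = 1 → |e - f| = 1
  nilp : ∃ K : ℕ, ∀ c : ℕ → ℤ, ¬ ∀ s < K, c s ∈ Γ ∧ c (s + 1) = edge (t (c s)) (c s)

namespace Motion

variable {ℓ : ℕ} (M : Motion ℓ)

theorem t_eq_of_near {e f : ℤ} (he : e ∈ M.Γ) (hf : f ∈ M.Γ) (h : |e - f| ≤ 1) :
    M.t e = M.t f := by
  rcases lt_trichotomy e f with hlt | rfl | hlt
  · have : f = e + 1 := by rw [abs_le] at h; omega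
    subst this; exact M.t_succ e he hf
  · rfl
  · have : e = f + 1 := by rw [abs_le] at h; omega
    subst this; exact (M.t_succ f hf he).symm

theorem near_of_image_near {e f : ℤ} (he : e ∈ M.Γ) (hf : f ∈ M.Γ)
    (h : |edge (M.t e) e - edge (M.t f) f| ≤ 1) : |e - f| ≤ 1 := by
  have h0 := abs_nonneg (edge (M.t e) e - edge (M.t f) f)
  rcases (show |edge (M.t e) e - edge (M.t f) f| = 0 ∨ |edge (M.t e) e - edge (M.t f) f| = 1 by
    omega) with h1 | h1
  · rw [M.inj e he f hf (sub_eq_zero.mp (abs_eq_zero.mp h1))]; simp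
  · exact (M.adj e he f hf h1).le

/-- `ψ = T φ` along the interval `[i, j]`: the image of `[i, j]` under `φ` consists of edges of the
domain, and following `φ` by their motion gives `ψ`. -/
def Stp (i j : ℤ) (φ ψ : ℤ → ℤ) : Prop :=
  Rigid φ ∧ ∀ e, i ≤ e → e < j → edge φ e ∈ M.Γ ∧ ψ = M.t (edge φ e) ∘ φ

/-- `ψ = T^k φ` along the interval `[i, j]`. -/
def Pth (i j : ℤ) : ℕ → (ℤ → ℤ) → (ℤ → ℤ) → Prop
  | 0, φ, ψ => Rigid φ ∧ φ = ψ
  | k + 1, φ, ψ => ∃ χ, Pth i j k φ χ ∧ M.Stp i j χ ψ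

variable {M} {i j : ℤ} {φ ψ χ : ℤ → ℤ}

theorem Stp.rigid_right (hij : i < j) (h : M.Stp i j φ ψ) : Rigid ψ := by
  obtain ⟨h1, h2⟩ := h.2 i le_rfl hij
  rw [h2]; exact (M.rigid _ h1).comp h.1

theorem Pth.rigid_left {k : ℕ} (h : M.Pth i j k φ ψ) : Rigid φ := by
  induction k generalizing ψ with
  | zero => exact h.1
  | succ k ih => obtain ⟨χ, h, _⟩ := h; exact ih h

theorem Pth.rigid_right {k : ℕ} (hij : i < j) (h : M.Pth i j k φ ψ) : Rigid ψ := by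
  cases k with
  | zero => exact h.2 ▸ h.1
  | succ k => obtain ⟨χ, _, h⟩ := h; exact h.rigid_right hij

theorem edge_image (hφ : Rigid φ) {e : ℤ} (h : ψ = M.t (edge φ e) ∘ φ) :
    edge ψ e = edge (M.t (edge φ e)) (edge φ e) := by
  rw [h]; exact hφ.edge_comp

/-- A step forward is determined by what happens near one edge. -/
theorem Stp.det_right {i' j' e e' : ℤ} {ψ' : ℤ → ℤ} (h : M.Stp i j φ ψ) (h' : M.Stp i' j' φ ψ')
    (he : i ≤ e ∧ e < j) (he' : i' ≤ e' ∧ e' < j') (hee : |e - e'| ≤ 1) : ψ = ψ' := by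
  obtain ⟨h1, h2⟩ := h.2 e he.1 he.2
  obtain ⟨h3, h4⟩ := h'.2 e' he'.1 he'.2
  rw [h2, h4, M.t_eq_of_near h1 h3 (by rwa [h.1.edge_sub])]

/-- A step backward is determined by what happens near one edge: this is where it matters that `T`
reflects adjacency. -/
theorem Stp.det_left {i' j' e e' : ℤ} {φ' : ℤ → ℤ} (h : M.Stp i j φ ψ) (h' : M.Stp i' j' φ' ψ)
    (he : i ≤ e ∧ e < j) (he' : i' ≤ e' ∧ e' < j') (hee : |e - e'| ≤ 1) : φ = φ' := by
  have hψ : Rigid ψ := h.rigid_right (lt_of_le_of_lt he.1 he.2)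
  obtain ⟨h1, h2⟩ := h.2 e he.1 he.2
  obtain ⟨h3, h4⟩ := h'.2 e' he'.1 he'.2
  have h5 := M.near_of_image_near h1 h3 (by
    rw [← edge_image h.1 h2, ← edge_image h'.1 h4, hψ.edge_sub]; exact hee)
  have ht := M.t_eq_of_near h1 h3 h5
  have hinj := (M.rigid _ h1).injective
  ext x
  have := congrFun (h2.symm.trans h4) x
  rw [← ht] at this
  exact hinj this

theorem Pth.det_right {k : ℕ} {i' j' e e' : ℤ} {ψ' : ℤ → ℤ} (h : M.Pth i j k φ ψ)
    (h' : M.Pth i' j' k φ ψ') (he : i ≤ e ∧ e < j) (he' : i' ≤ e' ∧ e' < j')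
    (hee : |e - e'| ≤ 1) : ψ = ψ' := by
  induction k generalizing ψ ψ' with
  | zero => exact h.2.symm.trans h'.2
  | succ k ih =>
    obtain ⟨χ, h1, h2⟩ := h
    obtain ⟨χ', h3, h4⟩ := h'
    obtain rfl := ih h1 h3
    exact h2.det_right h4 he he' hee

theorem Pth.det_left {k : ℕ} {i' j' e e' : ℤ} {φ' : ℤ → ℤ} (h : M.Pth i j k φ ψ)
    (h' : M.Pth i' j' k φ' ψ) (he : i ≤ e ∧ e < j) (he' : i' ≤ e' ∧ e' < j')
    (hee : |e - e'| ≤ 1) : φ = φ' := by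
  induction k generalizing ψ with
  | zero => exact h.2.trans h'.2.symm
  | succ k ih =>
    obtain ⟨χ, h1, h2⟩ := h
    obtain ⟨χ', h3, h4⟩ := h'
    obtain rfl := h2.det_left h4 he he' hee
    exact ih h1 h3

theorem Pth.trans {k l : ℕ} (h : M.Pth i j k φ χ) (h' : M.Pth i j l χ ψ) :
    M.Pth i j (k + l) φ ψ := by
  induction l generalizing ψ with
  | zero => exact h'.2 ▸ h
  | succ l ih => obtain ⟨χ', h1, h2⟩ := h'; exact ⟨χ', ih h1, h2⟩

theorem Pth.split {k l : ℕ} (hij : i < j) (h : M.Pth i j (k + l) φ ψ) :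
    ∃ χ, M.Pth i j k φ χ ∧ M.Pth i j l χ ψ := by
  induction l generalizing ψ with
  | zero => exact ⟨ψ, h, h.rigid_right hij, rfl⟩
  | succ l ih =>
    obtain ⟨χ', h1, h2⟩ := h
    obtain ⟨χ, h3, h4⟩ := ih h1
    exact ⟨χ, h3, χ', h4, h2⟩

theorem pth_one : M.Pth i j 1 φ ψ ↔ M.Stp i j φ ψ :=
  ⟨fun ⟨_, h, h'⟩ => h.2 ▸ h', fun h => ⟨φ, ⟨h.1, rfl⟩, h⟩⟩

theorem pth_succ_left {k : ℕ} (hij : i < j) :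
    M.Pth i j (k + 1) φ ψ ↔ ∃ χ, M.Stp i j φ χ ∧ M.Pth i j k χ ψ := by
  constructor
  · intro h
    obtain ⟨χ, h1, h2⟩ := Pth.split (k := 1) (l := k) hij (by rwa [add_comm])
    exact ⟨χ, pth_one.1 h1, h2⟩
  · rintro ⟨χ, h1, h2⟩
    rw [add_comm]; exact (pth_one.2 h1).trans h2

theorem Stp.pth_iff {k : ℕ} (hij : i < j) (h : M.Stp i j φ χ) :
    M.Pth i j (k + 1) φ ψ ↔ M.Pth i j k χ ψ := by
  rw [pth_succ_left hij]
  constructor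
  · rintro ⟨χ', h1, h2⟩
    rwa [h.det_right h1 ⟨le_rfl, hij⟩ ⟨le_rfl, hij⟩ (by simp)]
  · exact fun h' => ⟨χ, h, h'⟩

theorem Stp.pth_iff' {k : ℕ} (hij : i < j) (h : M.Stp i j χ ψ) :
    M.Pth i j (k + 1) φ ψ ↔ M.Pth i j k φ χ := by
  constructor
  · rintro ⟨χ', h1, h2⟩
    rwa [h.det_left h2 ⟨le_rfl, hij⟩ ⟨le_rfl, hij⟩ (by simp)]
  · exact fun h' => ⟨χ, h', h⟩

theorem Pth.mono {k : ℕ} {i' j' : ℤ} (hi : i ≤ i') (hj : j' ≤ j) (h : M.Pth i j k φ ψ) :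
    M.Pth i' j' k φ ψ := by
  induction k generalizing ψ with
  | zero => exact h
  | succ k ih =>
    obtain ⟨χ, h1, h2⟩ := h
    exact ⟨χ, ih h1, h2.1, fun e he he' => h2.2 e (by omega) (by omega)⟩

/-- Paths along two touching intervals which start at the same motion run together. -/
theorem Pth.union {k : ℕ} {l : ℤ} (hij : i < j) (hjl : j < l) (h : M.Pth i j k φ ψ)
    {ψ' : ℤ → ℤ} (h' : M.Pth j l k φ ψ') : M.Pth i l k φ ψ := by
  induction k generalizing ψ ψ' with
  | zero => exact h
  | succ k ih =>
    obtain ⟨χ, h1, h2⟩ := h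
    obtain ⟨χ', h3, h4⟩ := h'
    have hχ : χ = χ' := h1.det_right h3 (e := j - 1) (e' := j) (by omega) (by omega) (by simp)
    subst hχ
    have hψ : ψ = ψ' := h2.det_right h4 (e := j - 1) (e' := j) (by omega) (by omega) (by simp)
    subst hψ
    refine ⟨χ, ih h1 h3, h2.1, fun e he he' => ?_⟩
    rcases lt_or_ge e j with hlt | hge
    · exact h2.2 e he hlt
    · exact h4.2 e hge he'

/-- `γ` carries `[i', j']` onto `[i, j]`. -/
def Carries (γ : ℤ → ℤ) (i' j' i j : ℤ) : Prop :=
  (γ i' = i ∧ γ j' = j) ∨ (γ i' = j ∧ γ j' = i)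

theorem Carries.edge_mem {γ : ℤ → ℤ} (hγ : Rigid γ) {i' j' e : ℤ} (h : Carries γ i' j' i j)
    (hij : i < j) (he : i' ≤ e) (he' : e < j') : i ≤ edge γ e ∧ edge γ e < j := by
  rcases hγ with ⟨c, hc⟩ | ⟨c, hc⟩ <;> simp only [Carries, edge, hc] at * <;> omega

/-- Paths may be composed with a rigid motion on the right. -/
theorem Pth.comp_right {k : ℕ} {γ : ℤ → ℤ} (hγ : Rigid γ) {i' j' : ℤ}
    (hc : Carries γ i' j' i j) (hij : i < j) (h : M.Pth i j k φ ψ) :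
    M.Pth i' j' k (φ ∘ γ) (ψ ∘ γ) := by
  induction k generalizing ψ with
  | zero => exact ⟨h.1.comp hγ, by rw [h.2]⟩
  | succ k ih =>
    obtain ⟨χ, h1, h2⟩ := h
    refine ⟨χ ∘ γ, ih h1, h2.1.comp hγ, fun e he he' => ?_⟩
    obtain ⟨h3, h4⟩ := hc.edge_mem hγ hij he he'
    obtain ⟨h5, h6⟩ := h2.2 _ h3 h4
    rw [hγ.edge_comp]
    exact ⟨h5, by rw [h6]; rfl⟩

/-- The motions met by a path. -/
theorem Pth.edges {k : ℕ} (h : M.Pth i j k φ ψ) : ∃ c : ℕ → ℤ → ℤ, c 0 = φ ∧ c k = ψ ∧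
    ∀ s < k, M.Stp i j (c s) (c (s + 1)) := by
  induction k generalizing ψ with
  | zero => exact ⟨fun _ => φ, rfl, h.2, by simp⟩
  | succ k ih =>
    obtain ⟨χ, h1, h2⟩ := h
    obtain ⟨c, h3, h4, h5⟩ := ih h1
    refine ⟨fun s => if s ≤ k then c s else ψ, by simp [h3], by simp, fun s hs => ?_⟩
    rcases Nat.lt_succ_iff_lt_or_eq.mp hs with hlt | rfl
    · simp only [hlt.le, if_true, Nat.succ_le_of_lt hlt]; exact h5 s hlt
    · simpa [h4] using h2

/-- Nilpotency bounds the length of paths. -/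
theorem exists_bound (M : Motion ℓ) : ∃ K : ℕ, ∀ (i j : ℤ) (k : ℕ) (φ ψ : ℤ → ℤ), i < j →
    M.Pth i j k φ ψ → k < K := by
  obtain ⟨K, hK⟩ := M.nilp
  refine ⟨K, fun i j k φ ψ hij h => ?_⟩
  by_contra! hle
  obtain ⟨c, -, -, h3⟩ := h.edges
  refine hK (fun s => edge (c s) i) fun s hs => ?_
  obtain ⟨h4, h5⟩ := (h3 s (by omega)).2 i le_rfl hij
  exact ⟨h4, edge_image (h3 s (by omega)).1 h5⟩

/-- Nilpotency: no positive power of `T` carries an interval onto itself. -/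
theorem Pth.eq_zero_of_loop {k : ℕ} (hij : i < j) {γ : ℤ → ℤ} (hγ : Rigid γ)
    (hc : Carries γ i j i j) (h : M.Pth i j k φ (φ ∘ γ)) : k = 0 := by
  obtain ⟨K, hK⟩ := M.exists_bound
  by_contra hk
  -- a loop may be repeated, up to the symmetry `γ` of the interval, which contradicts the bound
  have key : ∀ n, ∃ ψ, M.Pth i j (n * k) φ ψ ∧ ∃ γ', Rigid γ' ∧ Carries γ' i j i j ∧ ψ = φ ∘ γ' := by
    intro n
    induction n with
    | zero => exact ⟨φ, by rw [zero_mul]; exact ⟨h.rigid_left, rfl⟩, id, rigid_id, Or.inl ⟨rfl, rfl⟩, rfl⟩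
    | succ n ih =>
      obtain ⟨ψ, h1, γ', h2, h3, rfl⟩ := ih
      refine ⟨φ ∘ γ ∘ γ', ?_, γ ∘ γ', hγ.comp h2, ?_, rfl⟩
      · rw [Nat.succ_mul]
        exact h1.trans (h.comp_right h2 h3 hij)
      · rcases hc with ⟨a, b⟩ | ⟨a, b⟩ <;> rcases h3 with ⟨c, d⟩ | ⟨c, d⟩ <;>
          simp [Carries, a, b, c, d]
  obtain ⟨ψ, h1, -⟩ := key K
  have := hK _ _ _ _ _ hij h1
  have : K ≤ K * k := Nat.le_mul_of_pos_right K (Nat.pos_of_ne_zero hk)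
  omega

/-- The motions which carry `[i, j]` onto itself: the identity and the reflection. -/
def Special (i j : ℤ) (χ : ℤ → ℤ) : Prop := χ = id ∨ χ = mirror (i + j)

theorem Special.rigid (h : Special i j χ) : Rigid χ := by
  rcases h with rfl | rfl
  exacts [rigid_id, rigid_mirror _]

theorem Special.carries (h : Special i j χ) : Carries χ i j i j := by
  rcases h with rfl | rfl <;> simp [Carries, mirror]

theorem Special.comp_self (h : Special i j χ) : χ ∘ χ = id := by
  rcases h with rfl | rfl
  exacts [rfl, mirror_comp_mirror _]

/-- Two special motions of `[i, j]` are not joined by a path of positive length. -/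
theorem Special.eq_zero {k : ℕ} (hij : i < j) (h : Special i j φ) (h' : Special i j ψ)
    (hp : M.Pth i j k φ ψ) : k = 0 := by
  refine Pth.eq_zero_of_loop (M := M) hij (γ := φ ∘ ψ) (h.rigid.comp h'.rigid) ?_ (φ := φ) ?_
  · rcases h with rfl | rfl <;> rcases h' with rfl | rfl <;> simp [Carries, mirror]
  · rwa [← Function.comp_assoc, h.comp_self, Function.id_comp]

theorem Special.ne_mirror (hij : i < j) (h : Special i j χ) {x : ℤ} (hx : x = i ∨ x = j) :
    χ ≠ mirror (2 * x) := by
  rcases h with rfl | rfl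
  · exact id_ne_mirror _
  · intro h; have := mirror_inj h; omega

/-- A motion is reached from a special motion of `[i, j]` at one time only. -/
theorem Special.det' {k k' : ℕ} {χ' : ℤ → ℤ} (hij : i < j) (h : Special i j χ)
    (h' : Special i j χ') (hp : M.Pth i j k χ φ) (hp' : M.Pth i j k' χ' φ) : k = k' ∧ χ = χ' := by
  wlog hk : k ≤ k' generalizing k k' χ χ'
  · obtain ⟨h1, h2⟩ := this h' h hp' hp (le_of_not_ge hk)
    exact ⟨h1.symm, h2.symm⟩
  obtain ⟨d, rfl⟩ := Nat.exists_eq_add_of_le' hk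
  obtain ⟨χ₁, h1, h2⟩ := hp'.split hij
  obtain rfl := hp.det_left h2 ⟨le_rfl, hij⟩ ⟨le_rfl, hij⟩ (by simp)
  obtain rfl := h'.eq_zero hij h h1
  exact ⟨by simp, h1.2.symm⟩

/-- The image of a connected interval moves rigidly. -/
theorem exists_stp (hij : i < j) (hφ : Rigid φ) (h : ∀ e, i ≤ e → e < j → edge φ e ∈ M.Γ) :
    ∃ ψ, M.Stp i j φ ψ := by
  refine ⟨M.t (edge φ i) ∘ φ, hφ, fun e he => ?_⟩
  induction e, he using Int.leInduction with
  | base => exact fun _ => ⟨h i le_rfl hij, rfl⟩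
  | succ e he ih =>
    intro hlt
    have h1 := h (e + 1) (by omega) hlt
    obtain ⟨h2, h3⟩ := ih (by omega)
    refine ⟨h1, h3.trans ?_⟩
    rw [M.t_eq_of_near h2 h1 (by rw [hφ.edge_sub]; simp)]

/-- The set of images of the edges. -/
def Γ' (M : Motion ℓ) : Set ℤ := {f | ∃ e ∈ M.Γ, edge (M.t e) e = f}

/-- A motion which carries `[i, j]` into the set of images is the result of a step. -/
theorem exists_stp_left (hij : i < j) (hψ : Rigid ψ) (h : ∀ e, i ≤ e → e < j → edge ψ e ∈ M.Γ') :
    ∃ φ, M.Stp i j φ ψ := by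
  have key : ∀ e, i ≤ e → e < j → ∃ φ, Rigid φ ∧ edge φ e ∈ M.Γ ∧ ψ = M.t (edge φ e) ∘ φ := by
    intro e he he'
    obtain ⟨f, hf, hfe⟩ := h e he he'
    obtain ⟨τ, hτ, h1, h2⟩ := (M.rigid f hf).exists_inv
    have h3 : edge (τ ∘ ψ) e = f := by
      rw [hψ.edge_comp, ← hfe, ← (M.rigid f hf).edge_comp, h2, edge_id]
    refine ⟨τ ∘ ψ, hτ.comp hψ, by rwa [h3], ?_⟩
    rw [h3, ← Function.comp_assoc, h1, Function.id_comp]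
  obtain ⟨φ, h1, h2, h3⟩ := key i le_rfl hij
  refine ⟨φ, h1, fun e he => ?_⟩
  induction e, he using Int.leInduction with
  | base => exact fun _ => ⟨h2, h3⟩
  | succ e he ih =>
    intro hlt
    obtain ⟨h4, h5⟩ := ih (by omega)
    obtain ⟨φ', h6, h7, h8⟩ := key (e + 1) (by omega) hlt
    have s1 : M.Stp e (e + 1) φ ψ := ⟨h1, fun f hf hf' => by
      obtain rfl : f = e := by omega
      exact ⟨h4, h5⟩⟩
    have s2 : M.Stp (e + 1) (e + 2) φ' ψ := ⟨h6, fun f hf hf' => by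
      obtain rfl : f = e + 1 := by omega
      exact ⟨h7, h8⟩⟩
    obtain rfl := s1.det_left s2 (e := e) (e' := e + 1) (by omega) (by omega) (by simp)
    exact ⟨h7, h8⟩

theorem Stp.edge_mem_image {e : ℤ} (h : M.Stp i j φ ψ) (he : i ≤ e) (he' : e < j) :
    edge ψ e ∈ M.Γ' := by
  obtain ⟨h1, h2⟩ := h.2 e he he'
  exact ⟨_, h1, (edge_image h.1 h2).symm⟩

end Motion

end GGS

namespace GGS

/-! ### Triangular matrices on intervals and blocks -/

section Triangular

variable {n : ℕ} {A A' B B' : Matrix (Fin n) (Fin n) ℂ} {N : Set (Fin n)}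

/-- Lower triangular matrices. -/
def Lower (A : Matrix (Fin n) (Fin n) ℂ) : Prop := ∀ x y, x < y → A x y = 0

/-- Upper triangular matrices. -/
def Upper (A : Matrix (Fin n) (Fin n) ℂ) : Prop := ∀ x y, y < x → A x y = 0

/-- `A` and `B` have the same entries on `N × N`. -/
def CongrOn (N : Set (Fin n)) (A B : Matrix (Fin n) (Fin n) ℂ) : Prop :=
  ∀ x ∈ N, ∀ y ∈ N, A x y = B x y

/-- `A` has no nonzero entry which connects `N` with its complement. -/
def Blk (N : Set (Fin n)) (A : Matrix (Fin n) (Fin n) ℂ) : Prop :=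
  ∀ x y, A x y ≠ 0 → (x ∈ N ↔ y ∈ N)

theorem Lower.mul (hA : Lower A) (hB : Lower B) : Lower (A * B) := by
  intro x y hxy
  rw [Matrix.mul_apply]
  refine Finset.sum_eq_zero fun z _ => ?_
  rcases lt_or_ge x z with h | h
  · rw [hA x z h, zero_mul]
  · rw [hB z y (lt_of_le_of_lt h hxy), mul_zero]

theorem Upper.mul (hA : Upper A) (hB : Upper B) : Upper (A * B) := by
  intro x y hxy
  rw [Matrix.mul_apply]
  refine Finset.sum_eq_zero fun z _ => ?_
  rcases lt_or_ge z x with h | h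
  · rw [hA x z h, zero_mul]
  · rw [hB z y (lt_of_lt_of_le hxy h), mul_zero]

theorem lower_diagonal (d : Fin n → ℂ) : Lower (Matrix.diagonal d) := fun _ _ h =>
  Matrix.diagonal_apply_ne _ h.ne

theorem upper_diagonal (d : Fin n → ℂ) : Upper (Matrix.diagonal d) := fun _ _ h =>
  Matrix.diagonal_apply_ne _ h.ne'

theorem lower_one : Lower (1 : Matrix (Fin n) (Fin n) ℂ) := fun _ _ h => Matrix.one_apply_ne h.ne

theorem upper_one : Upper (1 : Matrix (Fin n) (Fin n) ℂ) := fun _ _ h => Matrix.one_apply_ne h.ne'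

theorem Lower.mul_diag (hA : Lower A) (hB : Lower B) (x : Fin n) :
    (A * B) x x = A x x * B x x := by
  rw [Matrix.mul_apply, Finset.sum_eq_single x]
  · intro z _ hz
    rcases lt_or_gt_of_ne hz with h | h
    · rw [hB z x h, mul_zero]
    · rw [hA x z h, zero_mul]
  · simp

theorem Upper.mul_diag (hA : Upper A) (hB : Upper B) (x : Fin n) :
    (A * B) x x = A x x * B x x := by
  rw [Matrix.mul_apply, Finset.sum_eq_single x]
  · intro z _ hz
    rcases lt_or_gt_of_ne hz with h | h
    · rw [hA x z h, zero_mul]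
    · rw [hB z x h, mul_zero]
  · simp

/-- Lower unitriangular matrices. -/
def LowerUni (A : Matrix (Fin n) (Fin n) ℂ) : Prop := Lower A ∧ ∀ x, A x x = 1

theorem LowerUni.mul (hA : LowerUni A) (hB : LowerUni B) : LowerUni (A * B) :=
  ⟨hA.1.mul hB.1, fun x => by rw [hA.1.mul_diag hB.1, hA.2, hB.2, one_mul]⟩

theorem LowerUni.isUnit (hA : LowerUni A) : IsUnit A.det := by
  rw [Matrix.det_of_isLowerTriangular A (fun x y h => hA.1 x y h)]
  simp [hA.2]

theorem LowerUni.inv (hA : LowerUni A) : LowerUni A⁻¹ := by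
  have hu := hA.isUnit
  let _ := A.invertibleOfIsUnitDet hu
  have hL : Lower A⁻¹ := fun x y h =>
    Matrix.blockTriangular_inv_of_blockTriangular (M := A) (b := OrderDual.toDual)
      (fun x y h => hA.1 x y h) h
  refine ⟨hL, fun x => ?_⟩
  have h1 := hA.1.mul_diag hL x
  rw [A.mul_nonsing_inv hu, hA.2, one_mul, Matrix.one_apply_eq] at h1
  exact h1.symm

/-- On an interval of indices, products of lower triangular matrices depend on the entries in that
interval only. -/
theorem CongrOn.mul_lower (hN : N.OrdConnected) (hA : Lower A) (hB : Lower B) (hA' : Lower A')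
    (hB' : Lower B') (h1 : CongrOn N A A') (h2 : CongrOn N B B') :
    CongrOn N (A * B) (A' * B') := by
  intro x hx y hy
  rw [Matrix.mul_apply, Matrix.mul_apply]
  refine Finset.sum_congr rfl fun z _ => ?_
  rcases lt_or_ge x z with h | h
  · rw [hA x z h, hA' x z h, zero_mul, zero_mul]
  rcases lt_or_ge z y with h' | h'
  · rw [hB z y h', hB' z y h', mul_zero, mul_zero]
  have hz : z ∈ N := hN.out hy hx ⟨h', h⟩
  rw [h1 x hx z hz, h2 z hz y hy]

theorem CongrOn.mul_upper (hN : N.OrdConnected) (hA : Upper A) (hB : Upper B) (hA' : Upper A')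
    (hB' : Upper B') (h1 : CongrOn N A A') (h2 : CongrOn N B B') :
    CongrOn N (A * B) (A' * B') := by
  intro x hx y hy
  rw [Matrix.mul_apply, Matrix.mul_apply]
  refine Finset.sum_congr rfl fun z _ => ?_
  rcases lt_or_ge z x with h | h
  · rw [hA x z h, hA' x z h, zero_mul, zero_mul]
  rcases lt_or_ge y z with h' | h'
  · rw [hB z y h', hB' z y h', mul_zero, mul_zero]
  have hz : z ∈ N := hN.out hx hy ⟨h, h'⟩
  rw [h1 x hx z hz, h2 z hz y hy]

theorem CongrOn.inv_lower (hN : N.OrdConnected) (hA : Lower A) (hA' : Lower A') (hB : Lower B)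
    (hB' : Lower B') (h1 : B * A = 1) (h2 : A' * B' = 1) (h : CongrOn N A A') :
    CongrOn N B B' := by
  have h3 : CongrOn N (B * A') 1 := by
    rw [← h1]
    exact CongrOn.mul_lower hN hB hA' hB hA (fun _ _ _ _ => rfl) fun x hx y hy => (h x hx y hy).symm
  have h4 := CongrOn.mul_lower hN (hB.mul hA') hB' lower_one hB' h3 fun _ _ _ _ => rfl
  rwa [mul_assoc, h2, mul_one, one_mul] at h4

theorem Blk.one : Blk N 1 := by
  intro x y h
  have : x = y := by by_contra hne; exact h (Matrix.one_apply_ne hne)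
  rw [this]

theorem Blk.diagonal (d : Fin n → ℂ) : Blk N (Matrix.diagonal d) := by
  intro x y h
  have : x = y := by by_contra hne; exact h (Matrix.diagonal_apply_ne _ hne)
  rw [this]

theorem Blk.add (hA : Blk N A) (hB : Blk N B) : Blk N (A + B) := by
  intro x y h
  by_cases h1 : A x y = 0
  · exact hB x y fun h2 => h (by rw [Matrix.add_apply, h1, h2, add_zero])
  · exact hA x y h1

theorem Blk.mul (hA : Blk N A) (hB : Blk N B) : Blk N (A * B) := by
  intro x y h
  rw [Matrix.mul_apply] at h
  obtain ⟨z, _, hz⟩ := Finset.exists_ne_zero_of_sum_ne_zero h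
  exact (hA x z (left_ne_zero_of_mul hz)).trans (hB z y (right_ne_zero_of_mul hz))

open Classical in
/-- Being block diagonal means commuting with an idempotent, a condition which passes to
inverses. -/
theorem blk_iff_commute :
    Blk N A ↔ Commute A (Matrix.diagonal fun x => if x ∈ N then (1 : ℂ) else 0) := by
  constructor
  · intro h
    ext x y
    rw [Matrix.mul_diagonal, Matrix.diagonal_mul]
    by_cases hxy : A x y = 0
    · simp [hxy]
    · simp [h x y hxy]
  · intro h x y hxy
    have := congrFun (congrFun h.eq x) y
    rw [Matrix.mul_diagonal, Matrix.diagonal_mul] at this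
    by_cases hx : x ∈ N <;> by_cases hy : y ∈ N <;> simp_all

theorem Blk.inv (hA : Blk N A) (h : IsUnit A.det) : Blk N A⁻¹ := by
  classical
  rw [blk_iff_commute] at *
  have h1 := A.mul_nonsing_inv h
  have h2 := A.nonsing_inv_mul h
  set P := Matrix.diagonal fun x => if x ∈ N then (1 : ℂ) else 0
  calc A⁻¹ * P = A⁻¹ * (P * A) * A⁻¹ := by rw [mul_assoc, mul_assoc, h1, mul_one]
    _ = A⁻¹ * (A * P) * A⁻¹ := by rw [hA.eq]
    _ = P * A⁻¹ := by rw [← mul_assoc, h2, one_mul]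

theorem Blk.list_prod {l : List ℕ} {f : ℕ → Matrix (Fin n) (Fin n) ℂ}
    (h : ∀ k, Blk N (f k)) : Blk N (l.map f).prod := by
  induction l with
  | nil => simpa using Blk.one
  | cons a l ih => simpa using (h a).mul ih

theorem LowerUni.list_prod {l : List ℕ} {f : ℕ → Matrix (Fin n) (Fin n) ℂ}
    (h : ∀ k, LowerUni (f k)) : LowerUni (l.map f).prod := by
  induction l with
  | nil => exact ⟨by simpa using lower_one, by simp⟩
  | cons a l ih => simpa using (h a).mul ih

theorem Upper.list_prod {l : List ℕ} {f : ℕ → Matrix (Fin n) (Fin n) ℂ}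
    (h : ∀ k, Upper (f k)) : Upper (l.map f).prod := by
  induction l with
  | nil => simpa using upper_one
  | cons a l ih => simpa using (h a).mul ih

/-- A product of two matrices depends, on a block of both of the inner factors, on that block
only. -/
theorem mul_congr_blk {x y : Fin n} (hx : x ∈ N) (hy : y ∈ N) (hB : Blk N B) (hA' : Blk N A')
    (h1 : CongrOn N A A') (h2 : CongrOn N B B') : (A * B) x y = (A' * B') x y := by
  rw [Matrix.mul_apply, Matrix.mul_apply]
  refine Finset.sum_congr rfl fun z _ => ?_
  by_cases hz : z ∈ N
  · rw [h1 x hx z hz, h2 z hz y hy]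
  · have e1 : B z y = 0 := by by_contra h; exact hz ((hB z y h).2 hy)
    have e2 : A' x z = 0 := by by_contra h; exact hz ((hA' x z h).1 hx)
    rw [e1, e2, mul_zero, zero_mul]

end Triangular

/-! ### The blocks of the standard `R`-matrix -/

section Blocks

variable {ℓ : ℕ}

/-- An index as a point of the line. -/
abbrev pt (x : Fin (ℓ + 1)) : ℤ := ((x : ℕ) : ℤ)

theorem pt_lt {x y : Fin (ℓ + 1)} : pt x < pt y ↔ x < y := by simp [pt]

theorem pt_inj {x y : Fin (ℓ + 1)} : pt x = pt y ↔ x = y := by simp [pt, Fin.ext_iff]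

/-- The strictly lower triangular matrix with entry `f y x` in row `x` and column `y < x`. -/
def lowerMat (f : ℤ → ℤ → ℂ) : Matrix (Fin (ℓ + 1)) (Fin (ℓ + 1)) ℂ :=
  fun x y => if y < x then f (pt y) (pt x) else 0

/-- The strictly upper triangular matrix with entry `f x y` in row `x` and column `y > x`. -/
def upperMat (f : ℤ → ℤ → ℂ) : Matrix (Fin (ℓ + 1)) (Fin (ℓ + 1)) ℂ :=
  fun x y => if x < y then f (pt x) (pt y) else 0

open Classical in
/-- `q` if `φ` is the reflection at the point `x`, and `1` otherwise. -/
noncomputable def g (q : ℂ) (φ : ℤ → ℤ) (x : ℤ) : ℂ := if φ = mirror (2 * x) then q else 1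

open Classical in
/-- The coefficient at the interval `[i, j]` of a motion `φ` which carries it onto itself. -/
noncomputable def low0 (q : ℂ) (i j : ℤ) (φ : ℤ → ℤ) : ℂ :=
  (q - q⁻¹) * if φ = id then (-q) ^ (-(j - i - 1)) else if φ = mirror (i + j) then 1 else 0

open Classical in
/-- The coefficient of the inverse matrix which belongs to `low0`, up to sign. -/
noncomputable def low0' (q : ℂ) (i j : ℤ) (φ : ℤ → ℤ) : ℂ :=
  (q - q⁻¹) * if φ = id then (-q) ^ (j - i - 1) else if φ = mirror (i + j) then 1 else 0

variable {q : ℂ} {φ ψ χ : ℤ → ℤ} {i j : ℤ}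

theorem low0_of_not_special (h : ¬ Motion.Special i j φ) : low0 q i j φ = 0 := by
  simp only [Motion.Special, not_or] at h
  simp [low0, h.1, h.2]

theorem low0'_of_not_special (h : ¬ Motion.Special i j φ) : low0' q i j φ = 0 := by
  simp only [Motion.Special, not_or] at h
  simp [low0', h.1, h.2]

/-- A special motion of `[i, j]` is not the reflection at an end, so it costs no power of `q` there. -/
theorem g_of_special (hij : i < j) (h : Motion.Special i j φ) {x : ℤ} (hx : x = i ∨ x = j) :
    g q φ x = 1 := by
  rw [g, if_neg (h.ne_mirror hij hx)]

theorem g_ne_zero (hq : q ≠ 0) (x : ℤ) : g q φ x ≠ 0 := by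
  rw [g]; split_ifs <;> simp [hq]

/-- The diagonal part of the block `Bt0 q φ` of `R_st`. -/
noncomputable def Qm (q : ℂ) (φ : ℤ → ℤ) : Matrix (Fin (ℓ + 1)) (Fin (ℓ + 1)) ℂ :=
  Matrix.diagonal fun x => g q φ (pt x)

/-- The inverse of `Qm q φ`. -/
noncomputable def Qi (q : ℂ) (φ : ℤ → ℤ) : Matrix (Fin (ℓ + 1)) (Fin (ℓ + 1)) ℂ :=
  Matrix.diagonal fun x => (g q φ (pt x))⁻¹

/-- The block of `R_st²¹` which belongs to `φ`.  For a reflection `mirror c` this is the restriction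
of `R_st²¹` to index sum `c`; the same formula is used for all motions. -/
noncomputable def B0 (q : ℂ) (φ : ℤ → ℤ) : Matrix (Fin (ℓ + 1)) (Fin (ℓ + 1)) ℂ :=
  Qm q φ + lowerMat fun i j => low0 q i j φ

/-- The inverse of `B0 q φ`. -/
noncomputable def C0 (q : ℂ) (φ : ℤ → ℤ) : Matrix (Fin (ℓ + 1)) (Fin (ℓ + 1)) ℂ :=
  Qi q φ - lowerMat fun i j => low0' q i j φ

/-- The block of `R_st` which belongs to `φ`, with the same convention as for `B0`. -/
noncomputable def Bt0 (q : ℂ) (φ : ℤ → ℤ) : Matrix (Fin (ℓ + 1)) (Fin (ℓ + 1)) ℂ :=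
  Qm q φ + upperMat fun i j => low0 q i j φ

/-- The difference of the blocks of `R_st` and of the inverse of `R_st²¹`.  For a reflection it is
`q - q⁻¹` times the flip. -/
noncomputable def D0 (q : ℂ) (φ : ℤ → ℤ) : Matrix (Fin (ℓ + 1)) (Fin (ℓ + 1)) ℂ :=
  Bt0 q φ - C0 q φ

theorem Qm_mul_Qi (hq : q ≠ 0) : (Qm q φ * Qi q φ : Matrix (Fin (ℓ + 1)) (Fin (ℓ + 1)) ℂ) = 1 := by
  rw [Qm, Qi, Matrix.diagonal_mul_diagonal, ← Matrix.diagonal_one]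
  congr 1; ext x
  exact mul_inv_cancel₀ (g_ne_zero hq _)

theorem Qi_mul_Qm (hq : q ≠ 0) : (Qi q φ * Qm q φ : Matrix (Fin (ℓ + 1)) (Fin (ℓ + 1)) ℂ) = 1 := by
  rw [Qm, Qi, Matrix.diagonal_mul_diagonal, ← Matrix.diagonal_one]
  congr 1; ext x
  exact inv_mul_cancel₀ (g_ne_zero hq _)

theorem sum_telescope (n a b : ℕ) (hab : a ≤ b) (hb : b ≤ n) (f : ℕ → ℂ) :
    ∑ w ∈ Finset.range n, (if a ≤ w ∧ w < b then f (w + 1) - f w else 0) = f b - f a := by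
  rw [← Finset.sum_filter, ← Finset.sum_Ico_sub f hab]
  refine Finset.sum_congr ?_ fun _ _ => rfl
  ext w; simp; omega

/-- The geometric sum behind the inversion of `B0 q id`. -/
theorem lowerMat_id_mul (hq : q ≠ 0) :
    (lowerMat (fun i j => low0 q i j id) * lowerMat (fun i j => low0' q i j id) :
      Matrix (Fin (ℓ + 1)) (Fin (ℓ + 1)) ℂ) =
    lowerMat (fun i j => low0 q i j id) - lowerMat fun i j => low0' q i j id := by
  have hp : (-q) ≠ 0 := neg_ne_zero.2 hq
  ext x y
  rw [Matrix.mul_apply, Matrix.sub_apply]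
  simp only [lowerMat, low0, low0', if_true]
  rcases lt_or_ge y x with hyx | hyx
  swap
  · rw [if_neg (by omega), if_neg (by omega), sub_self]
    refine Finset.sum_eq_zero fun w _ => ?_
    by_cases h1 : w < x
    · rw [if_neg (show ¬ y < w by omega), mul_zero]
    · rw [if_neg h1, zero_mul]
  rw [if_pos hyx, if_pos hyx]
  -- the product of the two coefficients at `w` is `f (w + 1) - f w`
  let f : ℕ → ℂ := fun w => -(q - q⁻¹) * (-q) ^ (2 * (w : ℤ) - 1 - pt x - pt y)
  have h1 : ∀ w : Fin (ℓ + 1), (if w < x then (q - q⁻¹) * (-q) ^ (-(pt x - pt w - 1)) else 0) *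
      (if y < w then (q - q⁻¹) * (-q) ^ (pt w - pt y - 1) else 0) =
      if (y : ℕ) + 1 ≤ (w : ℕ) ∧ (w : ℕ) < (x : ℕ) then f (w + 1) - f w else 0 := by
    intro w
    by_cases hw : w < x
    · by_cases hw' : y < w
      · rw [if_pos hw, if_pos hw', if_pos ⟨hw', hw⟩]
        simp only [f]
        have e1 : (2 * ((w : ℕ) + 1 : ℕ) - 1 - pt x - pt y : ℤ) =
          (-(pt x - pt w - 1)) + (pt w - pt y - 1) + 1 := by push_cast; simp only [pt]; ring
        have e2 : (2 * ((w : ℕ) : ℤ) - 1 - pt x - pt y : ℤ) =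
          (-(pt x - pt w - 1)) + (pt w - pt y - 1) - 1 := by simp only [pt]; ring
        rw [e1, e2]
        generalize -(pt x - pt w - 1) = a
        generalize pt w - pt y - 1 = b
        rw [zpow_add_one₀ hp, zpow_sub_one₀ hp, zpow_add₀ hp, inv_neg]
        ring
      · rw [if_neg hw', mul_zero, if_neg (fun h => hw' h.1)]
    · rw [if_neg hw, zero_mul, if_neg (fun h => hw h.2)]
  rw [Finset.sum_congr rfl fun w _ => h1 w,
    Fin.sum_univ_eq_sum_range (fun w => if (y : ℕ) + 1 ≤ w ∧ w < (x : ℕ) then f (w + 1) - f w else 0),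
    sum_telescope _ _ _ hyx (by omega)]
  simp only [f]
  rw [show (2 * ((x : ℕ) : ℤ) - 1 - pt x - pt y) = pt x - pt y - 1 by simp only [pt]; ring,
    show (2 * (((y : ℕ) + 1 : ℕ) : ℤ) - 1 - pt x - pt y) = -(pt x - pt y - 1) by
      push_cast; simp only [pt]; ring]
  ring

theorem B0_mul_C0 (hq : q ≠ 0) : (B0 q φ * C0 q φ : Matrix (Fin (ℓ + 1)) (Fin (ℓ + 1)) ℂ) = 1 := by
  have h1 : (lowerMat (fun i j => low0 q i j φ) * Qi q φ : Matrix (Fin (ℓ + 1)) (Fin (ℓ + 1)) ℂ) =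
      lowerMat fun i j => low0 q i j φ := by
    ext x y
    rw [Qi, Matrix.mul_diagonal, lowerMat]
    split_ifs with h
    · by_cases hs : Motion.Special (pt y) (pt x) φ
      · rw [g_of_special (pt_lt.2 h) hs (Or.inl rfl), inv_one, mul_one]
      · rw [low0_of_not_special hs, zero_mul]
    · rw [zero_mul]
  have h2 : (Qm q φ * lowerMat (fun i j => low0' q i j φ) :
      Matrix (Fin (ℓ + 1)) (Fin (ℓ + 1)) ℂ) = lowerMat fun i j => low0' q i j φ := by
    ext x y
    rw [Qm, Matrix.diagonal_mul, lowerMat]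
    split_ifs with h
    · by_cases hs : Motion.Special (pt y) (pt x) φ
      · rw [g_of_special (pt_lt.2 h) hs (Or.inr rfl), one_mul]
      · rw [low0'_of_not_special hs, mul_zero]
    · rw [mul_zero]
  have h3 : (lowerMat (fun i j => low0 q i j φ) * lowerMat (fun i j => low0' q i j φ) :
      Matrix (Fin (ℓ + 1)) (Fin (ℓ + 1)) ℂ) =
      lowerMat (fun i j => low0 q i j φ) - lowerMat fun i j => low0' q i j φ := by
    by_cases hid : φ = id
    · subst hid; exact lowerMat_id_mul hq
    · ext x y
      have e : ∀ a b, low0' q a b φ = low0 q a b φ := fun a b => by simp [low0, low0', hid]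
      rw [show (fun i j => low0' q i j φ) = fun i j => low0 q i j φ from funext₂ e, sub_self,
        Matrix.mul_apply, Matrix.zero_apply]
      refine Finset.sum_eq_zero fun w _ => ?_
      simp only [lowerMat]
      by_cases ha : w < x
      swap
      · rw [if_neg ha, zero_mul]
      by_cases hb : y < w
      swap
      · rw [if_neg hb, mul_zero]
      rw [if_pos ha, if_pos hb]
      by_cases hs : Motion.Special (pt w) (pt x) φ
      · rw [low0_of_not_special (i := pt y) (j := pt w), mul_zero]
        rintro (h | h)
        · exact hid h
        · rcases hs with hs | hs
          · exact hid hs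
          · have := mirror_inj (h.symm.trans hs)
            have := pt_lt.2 ha; have := pt_lt.2 hb
            omega
      · rw [low0_of_not_special hs, zero_mul]
  rw [B0, C0, mul_sub, add_mul, add_mul, h1, h2, h3, Qm_mul_Qi hq]
  abel

end Blocks

end GGS

namespace GGS

/-! ### Paths and the factors of the twist -/

namespace Motion

variable {ℓ : ℕ} (M : Motion ℓ) (q : ℂ)

open Classical in
/-- The coefficient at the interval `[i, j]` of level `k` in the block of `ψ`: it vanishes unless `ψ`
is reached in `k` steps from a motion which carries `[i, j]` onto itself, and every passage through
the reflection at an end of the interval contributes a power of `q`.  The motion before a step is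
unique if there is one, so that the choice in the recursion is harmless. -/
noncomputable def low (i j : ℤ) : ℕ → (ℤ → ℤ) → ℂ
  | 0, φ => low0 q i j φ
  | k + 1, ψ => if h : ∃ φ, M.Stp i j φ ψ then
      low i j k h.choose * (g q h.choose j / g q h.choose i) else 0

open Classical in
/-- The counterpart of `low` for the transposed twist, with paths which start at `φ`. -/
noncomputable def up (i j : ℤ) : ℕ → (ℤ → ℤ) → ℂ
  | 0, φ => low0 q i j φ
  | k + 1, φ => if h : ∃ ψ, M.Stp i j φ ψ then
      up i j k h.choose * (g q h.choose i / g q h.choose j) else 0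

variable {M q} {i j : ℤ} {φ ψ χ : ℤ → ℤ}

theorem low_succ (hij : i < j) (h : M.Stp i j φ ψ) (k : ℕ) :
    M.low q i j (k + 1) ψ = M.low q i j k φ * (g q φ j / g q φ i) := by
  have hex : ∃ φ, M.Stp i j φ ψ := ⟨φ, h⟩
  have : hex.choose = φ := hex.choose_spec.det_left h ⟨le_rfl, hij⟩ ⟨le_rfl, hij⟩ (by simp)
  rw [low, dif_pos hex, this]

theorem up_succ (hij : i < j) (h : M.Stp i j φ ψ) (k : ℕ) :
    M.up q i j (k + 1) φ = M.up q i j k ψ * (g q ψ i / g q ψ j) := by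
  have hex : ∃ ψ, M.Stp i j φ ψ := ⟨ψ, h⟩
  have : hex.choose = ψ := hex.choose_spec.det_right h ⟨le_rfl, hij⟩ ⟨le_rfl, hij⟩ (by simp)
  rw [up, dif_pos hex, this]

theorem exists_stp_of_low_ne_zero {k : ℕ} (h : M.low q i j (k + 1) ψ ≠ 0) :
    ∃ φ, M.Stp i j φ ψ := by
  by_contra hex; exact h (by rw [low, dif_neg hex])

theorem exists_stp_of_up_ne_zero {k : ℕ} (h : M.up q i j (k + 1) φ ≠ 0) :
    ∃ ψ, M.Stp i j φ ψ := by
  by_contra hex; exact h (by rw [up, dif_neg hex])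

theorem exists_pth_of_low_ne_zero (hij : i < j) {k : ℕ} (h : M.low q i j k ψ ≠ 0) :
    ∃ χ, Special i j χ ∧ M.Pth i j k χ ψ := by
  induction k generalizing ψ with
  | zero =>
    have hs : Special i j ψ := by by_contra hs; exact h (low0_of_not_special hs)
    exact ⟨ψ, hs, hs.rigid, rfl⟩
  | succ k ih =>
    obtain ⟨φ, hφ⟩ := exists_stp_of_low_ne_zero h
    rw [low_succ hij hφ] at h
    obtain ⟨χ, h1, h2⟩ := ih (left_ne_zero_of_mul h)
    exact ⟨χ, h1, φ, h2, hφ⟩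

theorem exists_pth_of_up_ne_zero (hij : i < j) {k : ℕ} (h : M.up q i j k φ ≠ 0) :
    ∃ χ, Special i j χ ∧ M.Pth i j k φ χ := by
  induction k generalizing φ with
  | zero =>
    have hs : Special i j φ := by by_contra hs; exact h (low0_of_not_special hs)
    exact ⟨φ, hs, hs.rigid, rfl⟩
  | succ k ih =>
    obtain ⟨ψ, hψ⟩ := exists_stp_of_up_ne_zero h
    rw [up_succ hij hψ] at h
    obtain ⟨χ, h1, h2⟩ := ih (left_ne_zero_of_mul h)
    exact ⟨χ, h1, (pth_succ_left hij).2 ⟨ψ, hψ, h2⟩⟩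

variable (M)

open Classical in
/-- The number of `s` with `0 < s ≤ k` such that `ψ` is reached in `s` steps from the reflection at
`x`, along `[i, j]`. -/
noncomputable def passBefore (i j x : ℤ) (k : ℕ) (ψ : ℤ → ℤ) : ℤ :=
  ∑ s ∈ Finset.range k, if M.Pth i j (s + 1) (mirror (2 * x)) ψ then 1 else 0

open Classical in
/-- The number of `s` with `0 < s ≤ k` such that the reflection at `x` is reached in `s` steps from
`φ`, along `[i, j]`. -/
noncomputable def passAfter (i j x : ℤ) (k : ℕ) (φ : ℤ → ℤ) : ℤ :=
  ∑ s ∈ Finset.range k, if M.Pth i j (s + 1) φ (mirror (2 * x)) then 1 else 0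

open Classical in
/-- `1` if `φ` is the reflection at `x`, and `0` otherwise. -/
noncomputable def atPt (φ : ℤ → ℤ) (x : ℤ) : ℤ := if φ = mirror (2 * x) then 1 else 0

variable {M}

theorem g_eq_zpow (q : ℂ) (φ : ℤ → ℤ) (x : ℤ) : g q φ x = q ^ atPt φ x := by
  rw [g, atPt]; split_ifs <;> simp

theorem passBefore_succ (hij : i < j) (h : M.Stp i j φ ψ) (x : ℤ) (k : ℕ) :
    M.passBefore i j x (k + 1) ψ = M.passBefore i j x k φ + atPt φ x := by
  classical
  simp only [passBefore, h.pth_iff' hij]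
  rw [Finset.sum_range_succ']
  congr 1
  rw [atPt]
  refine if_congr ?_ rfl rfl
  exact ⟨fun h => h.2.symm, fun h => ⟨rigid_mirror _, h.symm⟩⟩

theorem passAfter_succ (hij : i < j) (h : M.Stp i j φ ψ) (x : ℤ) (k : ℕ) :
    M.passAfter i j x (k + 1) φ = M.passAfter i j x k ψ + atPt ψ x := by
  classical
  simp only [passAfter, h.pth_iff hij]
  rw [Finset.sum_range_succ']
  congr 1
  rw [atPt]
  refine if_congr ?_ rfl rfl
  exact ⟨fun h => h.2, fun h' => ⟨h.rigid_right hij, h'⟩⟩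

theorem low_eq (hq : q ≠ 0) (hij : i < j) {k : ℕ} (h : M.Pth i j k χ ψ) :
    M.low q i j k ψ =
      low0 q i j χ * q ^ (M.passBefore i j j k ψ - M.passBefore i j i k ψ) := by
  induction k generalizing ψ with
  | zero => rw [← h.2]; simp [low, passBefore]
  | succ k ih =>
    obtain ⟨φ, h1, h2⟩ := h
    rw [low_succ hij h2, ih h1, passBefore_succ hij h2, passBefore_succ hij h2, g_eq_zpow,
      g_eq_zpow, mul_assoc, ← zpow_sub₀ hq, ← zpow_add₀ hq]
    congr 2; ring

theorem up_eq (hq : q ≠ 0) (hij : i < j) {k : ℕ} (h : M.Pth i j k φ χ) :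
    M.up q i j k φ =
      low0 q i j χ * q ^ (M.passAfter i j i k φ - M.passAfter i j j k φ) := by
  induction k generalizing φ with
  | zero => rw [h.2]; simp [up, passAfter]
  | succ k ih =>
    obtain ⟨ψ, h1, h2⟩ := (pth_succ_left hij).1 h
    rw [up_succ hij h1, ih h2, passAfter_succ hij h1, passAfter_succ hij h1, g_eq_zpow,
      g_eq_zpow, mul_assoc, ← zpow_sub₀ hq, ← zpow_add₀ hq]
    congr 2; ring

variable (M q)

/-- A bound for the number of steps. -/
noncomputable def depth : ℕ := M.exists_bound.choose

/-- The factor of level `k` of the twist in the block of `φ`. -/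
noncomputable def fac (φ : ℤ → ℤ) (k : ℕ) : Matrix (Fin (ℓ + 1)) (Fin (ℓ + 1)) ℂ :=
  1 + lowerMat fun i j => M.low q i j k φ

/-- The factor of level `k` of the transposed twist in the block of `φ`. -/
noncomputable def fac' (φ : ℤ → ℤ) (k : ℕ) : Matrix (Fin (ℓ + 1)) (Fin (ℓ + 1)) ℂ :=
  1 + upperMat fun i j => M.up q i j k φ

/-- The block of the twist `J` which belongs to the motion `φ`. -/
noncomputable def tw (φ : ℤ → ℤ) : Matrix (Fin (ℓ + 1)) (Fin (ℓ + 1)) ℂ :=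
  ((List.range M.depth).map fun k => M.fac q φ (k + 1)).prod

/-- The block of the transposed twist `J²¹` which belongs to the motion `φ`. -/
noncomputable def tw' (φ : ℤ → ℤ) : Matrix (Fin (ℓ + 1)) (Fin (ℓ + 1)) ℂ :=
  ((List.range M.depth).map fun k => M.fac' q φ (k + 1)).prod

/-- The block of `J⁻¹ R_st J²¹` which belongs to the motion `φ`. -/
noncomputable def Rb (φ : ℤ → ℤ) : Matrix (Fin (ℓ + 1)) (Fin (ℓ + 1)) ℂ :=
  (M.tw q φ)⁻¹ * Bt0 q φ * M.tw' q φ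

variable {M q}

theorem low_eq_zero_of_depth (hij : i < j) {k : ℕ} (hk : M.depth ≤ k) : M.low q i j k φ = 0 := by
  by_contra h
  obtain ⟨χ, -, h2⟩ := exists_pth_of_low_ne_zero hij h
  have := M.exists_bound.choose_spec _ _ _ _ _ hij h2
  exact absurd hk (not_le.2 this)

theorem up_eq_zero_of_depth (hij : i < j) {k : ℕ} (hk : M.depth ≤ k) : M.up q i j k φ = 0 := by
  by_contra h
  obtain ⟨χ, -, h2⟩ := exists_pth_of_up_ne_zero hij h
  have := M.exists_bound.choose_spec _ _ _ _ _ hij h2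
  exact absurd hk (not_le.2 this)

theorem fac_eq_one_of_depth {k : ℕ} (hk : M.depth ≤ k) : M.fac q φ k = 1 := by
  ext x y
  simp only [fac, Matrix.add_apply, lowerMat]
  split_ifs with h
  · rw [low_eq_zero_of_depth (pt_lt.2 h) hk, add_zero]
  · rw [add_zero]

theorem fac'_eq_one_of_depth {k : ℕ} (hk : M.depth ≤ k) : M.fac' q φ k = 1 := by
  ext x y
  simp only [fac', Matrix.add_apply, upperMat]
  split_ifs with h
  · rw [up_eq_zero_of_depth (pt_lt.2 h) hk, add_zero]
  · rw [add_zero]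

/-- Factors equal to one at the end of a product may be dropped. -/
theorem prod_range_eq {α : Type*} [Monoid α] (f : ℕ → α) {m m' : ℕ} (h : ∀ k, m ≤ k → f k = 1)
    (hm : m ≤ m') : ((List.range m').map f).prod = ((List.range m).map f).prod := by
  induction m', hm using Nat.le_induction with
  | base => rfl
  | succ n hn ih => rw [List.range_succ, List.map_append, List.prod_append, ih]; simp [h n hn]

theorem tw_eq {m : ℕ} (hm : M.depth ≤ m) :
    M.tw q φ = ((List.range m).map fun k => M.fac q φ (k + 1)).prod :=
  (prod_range_eq _ (fun _ hk => fac_eq_one_of_depth (by omega)) hm).symm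

theorem tw'_eq {m : ℕ} (hm : M.depth ≤ m) :
    M.tw' q φ = ((List.range m).map fun k => M.fac' q φ (k + 1)).prod :=
  (prod_range_eq _ (fun _ hk => fac'_eq_one_of_depth (by omega)) hm).symm

theorem tw_cons : M.tw q φ =
    M.fac q φ 1 * ((List.range M.depth).map fun k => M.fac q φ (k + 2)).prod := by
  rw [tw_eq (Nat.le_succ _), List.range_succ_eq_map, List.map_cons, List.prod_cons, List.map_map]
  rfl

theorem tw'_cons : M.tw' q φ =
    M.fac' q φ 1 * ((List.range M.depth).map fun k => M.fac' q φ (k + 2)).prod := by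
  rw [tw'_eq (Nat.le_succ _), List.range_succ_eq_map, List.map_cons, List.prod_cons, List.map_map]
  rfl

theorem lowerUni_fac (k : ℕ) : LowerUni (M.fac q φ k) := by
  constructor
  · intro x y h
    simp [fac, lowerMat, h.ne, h.le.not_gt]
  · intro x; simp [fac, lowerMat]

theorem upper_fac' (k : ℕ) : Upper (M.fac' q φ k) := by
  intro x y h
  simp [fac', upperMat, h.ne', h.le.not_gt]

theorem lowerUni_tw : LowerUni (M.tw q φ) := LowerUni.list_prod fun _ => lowerUni_fac _

theorem upper_tw' : Upper (M.tw' q φ) := Upper.list_prod fun _ => upper_fac' _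

theorem lower_B0 : Lower (B0 q φ : Matrix (Fin (ℓ + 1)) (Fin (ℓ + 1)) ℂ) := by
  intro x y h
  simp [B0, Qm, lowerMat, h.ne, h.le.not_gt]

theorem lower_C0 : Lower (C0 q φ : Matrix (Fin (ℓ + 1)) (Fin (ℓ + 1)) ℂ) := by
  intro x y h
  simp [C0, Qi, lowerMat, h.ne, h.le.not_gt]

theorem upper_Bt0 : Upper (Bt0 q φ : Matrix (Fin (ℓ + 1)) (Fin (ℓ + 1)) ℂ) := by
  intro x y h
  simp [Bt0, Qm, upperMat, h.ne', h.le.not_gt]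

/-! ### Connected components and the recursion for the blocks -/

/-- All edges between `x` and `y` satisfy `P`. -/
def Conn (P : ℤ → Prop) (x y : ℤ) : Prop := ∀ e, min x y ≤ e → e < max x y → P e

/-- The indices in the connected component of `x`. -/
def cls (P : ℤ → Prop) (x : ℤ) : Set (Fin (ℓ + 1)) := {w | Conn P x (pt w)}

theorem ordConnected_cls (P : ℤ → Prop) (x : ℤ) : (cls P x : Set (Fin (ℓ + 1))).OrdConnected := by
  constructor
  intro a ha b hb c hc e he he'
  have h1 : pt a ≤ pt c := by simpa [pt] using hc.1
  have h2 : pt c ≤ pt b := by simpa [pt] using hc.2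
  rcases le_total x (pt c) with h | h
  · exact hb e (by omega) (by omega)
  · exact ha e (by omega) (by omega)

theorem Conn.mem_iff {P : ℤ → Prop} {x : ℤ} {a b : Fin (ℓ + 1)}
    (h : ∀ e, pt a ≤ e → e < pt b → P e) (hab : a < b) : a ∈ cls P x ↔ b ∈ cls P x := by
  have hab' := pt_lt.2 hab
  constructor
  · intro ha e he he'
    by_cases h1 : pt a ≤ e ∧ e < pt b
    · exact h e h1.1 h1.2
    · exact ha e (by omega) (by omega)
  · intro hb e he he'
    by_cases h1 : pt a ≤ e ∧ e < pt b
    · exact h e h1.1 h1.2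
    · exact hb e (by omega) (by omega)

theorem Blk.one_add_lowerMat {N : Set (Fin (ℓ + 1))} {f : ℤ → ℤ → ℂ}
    (h : ∀ x y : Fin (ℓ + 1), x < y → f (pt x) (pt y) ≠ 0 → (x ∈ N ↔ y ∈ N)) :
    Blk N (1 + lowerMat f) := by
  refine Blk.one.add fun x y hxy => ?_
  simp only [lowerMat] at hxy
  split_ifs at hxy with hlt
  · exact (h y x hlt hxy).symm
  · exact absurd rfl hxy

theorem Blk.one_add_upperMat {N : Set (Fin (ℓ + 1))} {f : ℤ → ℤ → ℂ}
    (h : ∀ x y : Fin (ℓ + 1), x < y → f (pt x) (pt y) ≠ 0 → (x ∈ N ↔ y ∈ N)) :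
    Blk N (1 + upperMat f) := by
  refine Blk.one.add fun x y hxy => ?_
  simp only [upperMat] at hxy
  split_ifs at hxy with hlt
  · exact h x y hlt hxy
  · exact absurd rfl hxy

/-- The transposed twist respects the components on which `φ` can be followed by `T`. -/
theorem blk_tw' (φ : ℤ → ℤ) (x : ℤ) :
    Blk (cls (fun e => edge φ e ∈ M.Γ) x) (M.tw' q φ) := by
  refine Blk.list_prod fun k => Blk.one_add_upperMat fun a b hab h => ?_
  obtain ⟨ψ, hψ⟩ := exists_stp_of_up_ne_zero h
  exact Conn.mem_iff (fun e he he' => (hψ.2 e he he').1) hab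

/-- The twist respects the components which `ψ` maps into the image of `T`. -/
theorem blk_tw (ψ : ℤ → ℤ) (x : ℤ) :
    Blk (cls (fun e => edge ψ e ∈ M.Γ') x) (M.tw q ψ) := by
  refine Blk.list_prod fun k => Blk.one_add_lowerMat fun a b hab h => ?_
  obtain ⟨φ, hφ⟩ := exists_stp_of_low_ne_zero h
  exact Conn.mem_iff (fun e he he' => hφ.edge_mem_image he he') hab

variable {x₀ y₀ : ℤ}

theorem Stp.of_cls (hxy : x₀ < y₀) (h : M.Stp x₀ y₀ φ ψ) {a b : Fin (ℓ + 1)}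
    (ha : a ∈ cls (fun e => edge φ e ∈ M.Γ) x₀) (hb : b ∈ cls (fun e => edge φ e ∈ M.Γ) x₀) :
    M.Stp (min x₀ (pt a)) (max y₀ (pt b)) φ ψ := by
  have h1 : ∀ e, min x₀ (pt a) ≤ e → e < max y₀ (pt b) → edge φ e ∈ M.Γ := by
    intro e he he'
    rcases lt_or_ge e x₀ with h1 | h1
    · exact ha e (by omega) (by omega)
    rcases lt_or_ge e y₀ with h2 | h2
    · exact (h.2 e h1 h2).1
    · exact hb e (by omega) (by omega)
  obtain ⟨ψ', h2⟩ := exists_stp (by omega) h.1 h1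
  rwa [h.det_right h2 (e := x₀) (e' := x₀) (by omega) (by omega) (by simp)]

theorem Stp.mono {i' j' : ℤ} (h : M.Stp i j φ ψ) (hi : i ≤ i') (hj : j' ≤ j) :
    M.Stp i' j' φ ψ := ⟨h.1, fun e he he' => h.2 e (by omega) (by omega)⟩

theorem Stp.of_cls' (hxy : x₀ < y₀) (h : M.Stp x₀ y₀ φ ψ) {a b : Fin (ℓ + 1)}
    (ha : a ∈ cls (fun e => edge φ e ∈ M.Γ) x₀) (hb : b ∈ cls (fun e => edge φ e ∈ M.Γ) x₀) :
    M.Stp (pt a) (pt b) φ ψ :=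
  (h.of_cls hxy ha hb).mono (min_le_right _ _) (le_max_right _ _)

/-- The twist in the block of `ψ = T φ` respects the components of the domain of this step: the
image of a component of the domain is a component of the image. -/
theorem blk_tw_of_stp (hxy : x₀ < y₀) (h : M.Stp x₀ y₀ φ ψ) :
    Blk (cls (fun e => edge φ e ∈ M.Γ) x₀) (M.tw q ψ) := by
  refine Blk.list_prod fun k => Blk.one_add_lowerMat fun a b hab hne => ?_
  obtain ⟨φ', hφ'⟩ := exists_stp_of_low_ne_zero hne
  have hab' := pt_lt.2 hab
  have key : ∀ c : Fin (ℓ + 1), c = a ∨ c = b → c ∈ cls (fun e => edge φ e ∈ M.Γ) x₀ → φ' = φ := by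
    intro c hc hmem
    have h1 := h.of_cls hxy hmem hmem
    rcases hc with rfl | rfl
    · rcases le_total x₀ (pt c) with h2 | h2
      · rcases lt_or_ge (pt c) y₀ with h3 | h3
        · exact hφ'.det_left h1 (e := pt c) (e' := pt c) (by omega) (by omega) (by simp)
        · exact hφ'.det_left h1 (e := pt c) (e' := pt c - 1) (by omega) (by omega) (by simp)
      · exact hφ'.det_left h1 (e := pt c) (e' := pt c) (by omega) (by omega) (by simp)
    · rcases le_total (pt c) x₀ with h2 | h2
      · exact hφ'.det_left h1 (e := pt c - 1) (e' := pt c) (by omega) (by omega) (by simp)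
      · rcases eq_or_lt_of_le h2 with h3 | h3
        · exact hφ'.det_left h1 (e := pt c - 1) (e' := pt c) (by omega) (by omega) (by simp)
        · exact hφ'.det_left h1 (e := pt c - 1) (e' := pt c - 1) (by omega) (by omega) (by simp)
  have key2 : φ' = φ → (a ∈ cls (fun e => edge φ e ∈ M.Γ) x₀ ↔
      b ∈ cls (fun e => edge φ e ∈ M.Γ) x₀) := by
    rintro rfl
    exact Conn.mem_iff (fun e he he' => (hφ'.2 e he he').1) hab
  constructor
  · intro ha; exact (key2 (key a (Or.inl rfl) ha)).1 ha
  · intro hb; exact (key2 (key b (Or.inr rfl) hb)).2 hb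

/-- A congruence of the factors up to conjugation gives one of the products.  Triangularity makes
congruence on an interval of indices multiplicative. -/
theorem CongrOn.list_prod_conj {n : ℕ} {N : Set (Fin n)} (hN : N.OrdConnected)
    {Q Q' : Matrix (Fin n) (Fin n) ℂ}
    (hQ : Lower Q) (hQ' : Lower Q') (hQQ : Q' * Q = 1) (hQQ' : Q * Q' = 1)
    {f f' : ℕ → Matrix (Fin n) (Fin n) ℂ} (hf : ∀ k, Lower (f k)) (hf' : ∀ k, Lower (f' k))
    (h : ∀ k, CongrOn N (f k) (Q * f' k * Q')) (l : List ℕ) :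
    Lower (l.map f).prod ∧ Lower (l.map f').prod ∧
      CongrOn N (l.map f).prod (Q * (l.map f').prod * Q') := by
  induction l with
  | nil =>
    refine ⟨by simpa using lower_one, by simpa using lower_one, fun x _ y _ => ?_⟩
    simp [hQQ']
  | cons a l ih =>
    obtain ⟨h1, h2, h3⟩ := ih
    refine ⟨by simpa using (hf a).mul h1, by simpa using (hf' a).mul h2, ?_⟩
    have h4 := CongrOn.mul_lower hN (hf a) h1 ((hQ.mul (hf' a)).mul hQ') ((hQ.mul h2).mul hQ')
      (h a) h3
    have e : Q * f' a * Q' * (Q * (l.map f').prod * Q') = Q * (f' a * (l.map f').prod) * Q' := by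
      calc _ = Q * f' a * (Q' * Q) * (l.map f').prod * Q' := by simp only [mul_assoc]
        _ = _ := by rw [hQQ, mul_one]; simp only [mul_assoc]
    rw [e] at h4
    simpa using h4

theorem CongrOn.list_prod_conj' {n : ℕ} {N : Set (Fin n)} (hN : N.OrdConnected)
    {Q Q' : Matrix (Fin n) (Fin n) ℂ}
    (hQ : Upper Q) (hQ' : Upper Q') (hQQ : Q' * Q = 1) (hQQ' : Q * Q' = 1)
    {f f' : ℕ → Matrix (Fin n) (Fin n) ℂ} (hf : ∀ k, Upper (f k)) (hf' : ∀ k, Upper (f' k))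
    (h : ∀ k, CongrOn N (f k) (Q * f' k * Q')) (l : List ℕ) :
    Upper (l.map f).prod ∧ Upper (l.map f').prod ∧
      CongrOn N (l.map f).prod (Q * (l.map f').prod * Q') := by
  induction l with
  | nil =>
    refine ⟨by simpa using upper_one, by simpa using upper_one, fun x _ y _ => ?_⟩
    simp [hQQ']
  | cons a l ih =>
    obtain ⟨h1, h2, h3⟩ := ih
    refine ⟨by simpa using (hf a).mul h1, by simpa using (hf' a).mul h2, ?_⟩
    have h4 := CongrOn.mul_upper hN (hf a) h1 ((hQ.mul (hf' a)).mul hQ') ((hQ.mul h2).mul hQ')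
      (h a) h3
    have e : Q * f' a * Q' * (Q * (l.map f').prod * Q') = Q * (f' a * (l.map f').prod) * Q' := by
      calc _ = Q * f' a * (Q' * Q) * (l.map f').prod * Q' := by simp only [mul_assoc]
        _ = _ := by rw [hQQ, mul_one]; simp only [mul_assoc]
    rw [e] at h4
    simpa using h4

theorem lower_Qm : Lower (Qm q φ : Matrix (Fin (ℓ + 1)) (Fin (ℓ + 1)) ℂ) := lower_diagonal _
theorem lower_Qi : Lower (Qi q φ : Matrix (Fin (ℓ + 1)) (Fin (ℓ + 1)) ℂ) := lower_diagonal _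
theorem upper_Qm : Upper (Qm q φ : Matrix (Fin (ℓ + 1)) (Fin (ℓ + 1)) ℂ) := upper_diagonal _
theorem upper_Qi : Upper (Qi q φ : Matrix (Fin (ℓ + 1)) (Fin (ℓ + 1)) ℂ) := upper_diagonal _

/-- Level `k + 1` in the block of `ψ = T φ` is level `k` in the block of `φ`, up to conjugation. -/
theorem fac_congr (hq : q ≠ 0) (hxy : x₀ < y₀) (h : M.Stp x₀ y₀ φ ψ) (k : ℕ) :
    CongrOn (cls (fun e => edge φ e ∈ M.Γ) x₀) (M.fac q ψ (k + 1))
      (Qm q φ * M.fac q φ k * Qi q φ) := by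
  intro x hx y hy
  rw [Qi, Matrix.mul_diagonal, Qm, Matrix.diagonal_mul]
  simp only [fac, Matrix.add_apply, lowerMat]
  split_ifs with hlt
  · rw [low_succ (pt_lt.2 hlt) (h.of_cls' hxy hy hx), Matrix.one_apply_ne hlt.ne']
    have := g_ne_zero (φ := φ) hq (pt y)
    field_simp
    ring
  · rcases eq_or_ne x y with rfl | hne
    · rw [Matrix.one_apply_eq, add_zero, mul_one, mul_inv_cancel₀ (g_ne_zero hq _)]
    · rw [Matrix.one_apply_ne hne]; simp

/-- Level one in the block of `ψ = T φ` comes from the special motions at `φ`, which make up `B0 q φ`. -/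
theorem fac_one_congr (hq : q ≠ 0) (hxy : x₀ < y₀) (h : M.Stp x₀ y₀ φ ψ) :
    CongrOn (cls (fun e => edge φ e ∈ M.Γ) x₀) (M.fac q ψ 1) (B0 q φ * Qi q φ) := by
  intro x hx y hy
  rw [Qi, Matrix.mul_diagonal]
  simp only [fac, B0, Qm, Matrix.add_apply, lowerMat]
  split_ifs with hlt
  · rw [low_succ (pt_lt.2 hlt) (h.of_cls' hxy hy hx), Matrix.one_apply_ne hlt.ne',
      Matrix.diagonal_apply_ne _ hlt.ne']
    simp only [low]
    by_cases hs : Special (pt y) (pt x) φ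
    · rw [g_of_special (pt_lt.2 hlt) hs (Or.inl rfl), g_of_special (pt_lt.2 hlt) hs (Or.inr rfl)]
      simp
    · simp [low0_of_not_special hs]
  · rcases eq_or_ne x y with rfl | hne
    · rw [Matrix.one_apply_eq, Matrix.diagonal_apply_eq, add_zero, add_zero,
        mul_inv_cancel₀ (g_ne_zero hq _)]
    · rw [Matrix.one_apply_ne hne, Matrix.diagonal_apply_ne _ hne]; simp

/-- The twist telescopes along a step `ψ = T φ`. -/
theorem tw_congr (hq : q ≠ 0) (hxy : x₀ < y₀) (h : M.Stp x₀ y₀ φ ψ) :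
    CongrOn (cls (fun e => edge φ e ∈ M.Γ) x₀) (B0 q φ * M.tw q φ) (M.tw q ψ * Qm q φ) := by
  have hN := ordConnected_cls (ℓ := ℓ) (fun e => edge φ e ∈ M.Γ) x₀
  obtain ⟨h1, h2, h3⟩ := CongrOn.list_prod_conj hN lower_Qm lower_Qi (Qi_mul_Qm hq) (Qm_mul_Qi hq)
    (fun k => (lowerUni_fac (M := M) (q := q) (φ := ψ) (k + 2)).1)
    (fun k => (lowerUni_fac (M := M) (q := q) (φ := φ) (k + 1)).1)
    (fun k => fac_congr hq hxy h (k + 1)) (List.range M.depth)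
  have h4 := CongrOn.mul_lower hN (lowerUni_fac (M := M) (q := q) (φ := ψ) 1).1 h1
    (lower_B0.mul lower_Qi) ((lower_Qm.mul h2).mul lower_Qi) (fac_one_congr hq hxy h) h3
  rw [← tw_cons] at h4
  have h5 := CongrOn.mul_lower hN lowerUni_tw.1 (lower_Qm (q := q) (φ := φ))
    ((lower_B0.mul lower_Qi).mul ((lower_Qm.mul h2).mul lower_Qi)) lower_Qm h4 fun _ _ _ _ => rfl
  have e : B0 q φ * Qi q φ * (Qm q φ * M.tw q φ * Qi q φ) * Qm q φ = B0 q φ * M.tw q φ := by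
    calc _ = B0 q φ * (Qi q φ * Qm q φ) * M.tw q φ * (Qi q φ * Qm q φ) := by simp only [mul_assoc]
      _ = _ := by rw [Qi_mul_Qm hq, mul_one, mul_one]
  rw [show ((List.range M.depth).map fun k => M.fac q φ (k + 1)).prod = M.tw q φ from rfl, e] at h5
  exact fun x hx y hy => (h5 x hx y hy).symm

theorem fac'_congr (hq : q ≠ 0) (hxy : x₀ < y₀) (h : M.Stp x₀ y₀ φ ψ) (k : ℕ) :
    CongrOn (cls (fun e => edge φ e ∈ M.Γ) x₀) (M.fac' q φ (k + 1))
      (Qm q ψ * M.fac' q ψ k * Qi q ψ) := by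
  intro x hx y hy
  rw [Qi, Matrix.mul_diagonal, Qm, Matrix.diagonal_mul]
  simp only [fac', Matrix.add_apply, upperMat]
  split_ifs with hlt
  · rw [up_succ (pt_lt.2 hlt) (h.of_cls' hxy hx hy), Matrix.one_apply_ne hlt.ne]
    have := g_ne_zero (φ := ψ) hq (pt y)
    field_simp
    ring
  · rcases eq_or_ne x y with rfl | hne
    · rw [Matrix.one_apply_eq, add_zero, mul_one, mul_inv_cancel₀ (g_ne_zero hq _)]
    · rw [Matrix.one_apply_ne hne]; simp

theorem fac'_one_congr (hq : q ≠ 0) (hxy : x₀ < y₀) (h : M.Stp x₀ y₀ φ ψ) :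
    CongrOn (cls (fun e => edge φ e ∈ M.Γ) x₀) (M.fac' q φ 1) (Bt0 q ψ * Qi q ψ) := by
  intro x hx y hy
  rw [Qi, Matrix.mul_diagonal]
  simp only [fac', Bt0, Qm, Matrix.add_apply, upperMat]
  split_ifs with hlt
  · rw [up_succ (pt_lt.2 hlt) (h.of_cls' hxy hx hy), Matrix.one_apply_ne hlt.ne,
      Matrix.diagonal_apply_ne _ hlt.ne]
    simp only [up]
    by_cases hs : Special (pt x) (pt y) ψ
    · rw [g_of_special (pt_lt.2 hlt) hs (Or.inl rfl), g_of_special (pt_lt.2 hlt) hs (Or.inr rfl)]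
      simp
    · simp [low0_of_not_special hs]
  · rcases eq_or_ne x y with rfl | hne
    · rw [Matrix.one_apply_eq, Matrix.diagonal_apply_eq, add_zero, add_zero,
        mul_inv_cancel₀ (g_ne_zero hq _)]
    · rw [Matrix.one_apply_ne hne, Matrix.diagonal_apply_ne _ hne]; simp

/-- The transposed twist telescopes along a step `φ, ψ = T φ`, in the other direction. -/
theorem tw'_congr (hq : q ≠ 0) (hxy : x₀ < y₀) (h : M.Stp x₀ y₀ φ ψ) :
    CongrOn (cls (fun e => edge φ e ∈ M.Γ) x₀) (M.tw' q φ) (Bt0 q ψ * M.tw' q ψ * Qi q ψ) := by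
  have hN := ordConnected_cls (ℓ := ℓ) (fun e => edge φ e ∈ M.Γ) x₀
  obtain ⟨h1, h2, h3⟩ := CongrOn.list_prod_conj' hN upper_Qm upper_Qi (Qi_mul_Qm hq) (Qm_mul_Qi hq)
    (fun k => upper_fac' (M := M) (q := q) (φ := φ) (k + 2))
    (fun k => upper_fac' (M := M) (q := q) (φ := ψ) (k + 1))
    (fun k => fac'_congr hq hxy h (k + 1)) (List.range M.depth)
  have h4 := CongrOn.mul_upper hN (upper_fac' (M := M) (q := q) (φ := φ) 1) h1
    (upper_Bt0.mul upper_Qi) ((upper_Qm.mul h2).mul upper_Qi) (fac'_one_congr hq hxy h) h3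
  rw [← tw'_cons] at h4
  have e : Bt0 q ψ * Qi q ψ * (Qm q ψ * M.tw' q ψ * Qi q ψ) = Bt0 q ψ * M.tw' q ψ * Qi q ψ := by
    calc _ = Bt0 q ψ * (Qi q ψ * Qm q ψ) * M.tw' q ψ * Qi q ψ := by simp only [mul_assoc]
      _ = _ := by rw [Qi_mul_Qm hq, mul_one]
  rwa [show ((List.range M.depth).map fun k => M.fac' q ψ (k + 1)).prod = M.tw' q ψ from rfl,
    e] at h4

end Motion

end GGS

namespace GGS

namespace Motion

variable {ℓ : ℕ} {M : Motion ℓ} {q : ℂ} {i j : ℤ} {φ ψ χ : ℤ → ℤ}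

/-! ### Flip symmetry in the block of a reflection -/

/-- In the block of a reflection, passing a reflection at an end of `[i, j]` before the end of a
path which comes from a special motion is the same as passing, equally long after the start, the
reflection at the corresponding end of the reflected interval. -/
theorem pass_iff (hij : i < j) {c x : ℤ} {k s : ℕ} (hχ : Special i j χ)
    (h : M.Pth i j k χ (mirror c)) (hs : s ≤ k) (hx : x = i ∨ x = j) :
    M.Pth i j s (mirror (2 * x)) (mirror c) ↔
      M.Pth (c - j) (c - i) s (mirror c) (mirror (2 * (c - x))) := by
  have hc1 : Carries (mirror c) (c - j) (c - i) i j := Or.inr ⟨by simp [mirror], by simp [mirror]⟩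
  have hc2 : Carries (mirror c) i j (c - j) (c - i) := Or.inr ⟨by simp [mirror], by simp [mirror]⟩
  have hx1 : Carries (mirror (2 * x)) (2 * x - j) (2 * x - i) i j :=
    Or.inr ⟨by simp [mirror], by simp [mirror]⟩
  have near : ∃ e e', (i ≤ e ∧ e < j) ∧ (2 * x - j ≤ e' ∧ e' < 2 * x - i) ∧ |e - e'| ≤ 1 := by
    rcases hx with rfl | rfl
    · exact ⟨x, x - 1, by omega, by omega, by simp⟩
    · exact ⟨x - 1, x, by omega, by omega, by simp⟩
  obtain ⟨e, e', he, he', hee⟩ := near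
  constructor
  · intro h1
    have h2 := h1.comp_right (rigid_mirror _) hx1 hij
    rw [mirror_comp_mirror] at h2
    obtain ⟨d, rfl⟩ := Nat.exists_eq_add_of_le hs
    obtain ⟨b, h3, -⟩ := h.split hij
    have h4 := h3.comp_right hχ.rigid hχ.carries hij
    rw [hχ.comp_self] at h4
    have h5 := h4.det_right h2 he he' hee
    rw [h5] at h4
    have h6 := h4.comp_right (rigid_mirror c) hc1 hij
    have e1 : (mirror c ∘ mirror (2 * x)) ∘ mirror c = mirror (2 * (c - x)) := by
      ext y; simp only [mirror, Function.comp]; ring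
    rwa [Function.id_comp, e1] at h6
  · intro h1
    have h2 := h1.comp_right (rigid_mirror c) hc2 (by omega)
    rw [mirror_comp_mirror] at h2
    have h3 := h2.comp_right (rigid_mirror (2 * x)) hx1 hij
    have e1 : (mirror (2 * (c - x)) ∘ mirror c) ∘ mirror (2 * x) = mirror c := by
      ext y; simp only [mirror, Function.comp]; ring
    rw [Function.id_comp, e1] at h3
    obtain ⟨d, rfl⟩ := Nat.exists_eq_add_of_le' hs
    obtain ⟨a, -, h4⟩ := h.split hij
    have h5 := h4.det_left h3 he he' hee
    rwa [h5] at h4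

theorem passBefore_mirror (hij : i < j) {c x : ℤ} {k : ℕ} (hχ : Special i j χ)
    (h : M.Pth i j k χ (mirror c)) (hx : x = i ∨ x = j) :
    M.passBefore i j x k (mirror c) = M.passAfter (c - j) (c - i) (c - x) k (mirror c) := by
  classical
  refine Finset.sum_congr rfl fun s hs => ?_
  rw [Finset.mem_range] at hs
  exact if_congr (pass_iff hij hχ h hs hx) rfl rfl

/-- The special motion which corresponds to `χ` on the reflected interval. -/
theorem Special.reflect {c : ℤ} (hχ : Special i j χ) :
    Special (c - j) (c - i) (mirror c ∘ χ ∘ mirror c) ∧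
      low0 q (c - j) (c - i) (mirror c ∘ χ ∘ mirror c) = low0 q i j χ ∧
      low0' q (c - j) (c - i) (mirror c ∘ χ ∘ mirror c) = low0' q i j χ := by
  rcases hχ with rfl | rfl
  · rw [Function.id_comp, mirror_comp_mirror]
    refine ⟨Or.inl rfl, ?_, ?_⟩ <;> simp only [low0, low0', if_true] <;>
      rw [show c - i - (c - j) = j - i by ring]
  · have e : mirror c ∘ mirror (i + j) ∘ mirror c = mirror (c - j + (c - i)) := by
      ext y; simp only [mirror, Function.comp]; ring
    rw [e]
    refine ⟨Or.inr rfl, ?_, ?_⟩ <;>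
      simp only [low0, low0', if_true, (id_ne_mirror _).symm, if_false]

theorem Pth.reflect (hij : i < j) {c : ℤ} {k : ℕ} (hχ : Special i j χ)
    (h : M.Pth i j k χ (mirror c)) :
    M.Pth (c - j) (c - i) k (mirror c) (mirror c ∘ χ ∘ mirror c) := by
  have hc1 : Carries (mirror c) (c - j) (c - i) i j := Or.inr ⟨by simp [mirror], by simp [mirror]⟩
  have h1 := (h.comp_right hχ.rigid hχ.carries hij).comp_right (rigid_mirror c) hc1 hij
  rwa [hχ.comp_self, Function.id_comp, Function.comp_assoc] at h1

theorem Pth.reflect' (hij : i < j) {c : ℤ} {k : ℕ} (hχ : Special (c - j) (c - i) χ)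
    (h : M.Pth (c - j) (c - i) k (mirror c) χ) :
    ∃ χ', Special i j χ' ∧ M.Pth i j k χ' (mirror c) := by
  have hc2 : Carries (mirror c) i j (c - j) (c - i) := Or.inr ⟨by simp [mirror], by simp [mirror]⟩
  have h1 := (h.comp_right hχ.rigid hχ.carries (by omega)).comp_right (rigid_mirror c) hc2
    (by omega)
  rw [hχ.comp_self, Function.id_comp] at h1
  refine ⟨_, ?_, h1⟩
  have := (hχ.reflect (q := 1) (c := c)).1
  simpa [Function.comp_assoc] using this

/-- In the block of a reflection, the coefficients of the transposed twist are those of the twist at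
the reflected intervals. -/
theorem up_mirror (hq : q ≠ 0) (hij : i < j) (c : ℤ) (k : ℕ) :
    M.up q (c - j) (c - i) k (mirror c) = M.low q i j k (mirror c) := by
  by_cases hex : ∃ χ, Special i j χ ∧ M.Pth i j k χ (mirror c)
  · obtain ⟨χ, h1, h2⟩ := hex
    rw [low_eq hq hij h2, up_eq hq (by omega) (h2.reflect hij h1), h1.reflect.2.1,
      passBefore_mirror hij h1 h2 (Or.inl rfl), passBefore_mirror hij h1 h2 (Or.inr rfl)]
  · have h1 : M.low q i j k (mirror c) = 0 := by
      by_contra h; exact hex (exists_pth_of_low_ne_zero hij h)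
    rw [h1]
    by_contra h
    obtain ⟨χ, h2, h3⟩ := exists_pth_of_up_ne_zero (by omega) h
    exact hex (h3.reflect' hij h2)

/-! ### The difference of the two standard matrices intertwines the two twists -/

theorem D0_upper {x y : Fin (ℓ + 1)} (h : x < y) : D0 q φ x y = low0 q (pt x) (pt y) φ := by
  simp [D0, Bt0, C0, Qm, Qi, upperMat, lowerMat, h.ne, h, h.le.not_gt]

theorem D0_lower {x y : Fin (ℓ + 1)} (h : y < x) : D0 q φ x y = low0' q (pt y) (pt x) φ := by
  simp [D0, Bt0, C0, Qm, Qi, upperMat, lowerMat, h.ne', h, h.le.not_gt]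

theorem D0_diag (x : Fin (ℓ + 1)) : D0 q φ x x = g q φ (pt x) - (g q φ (pt x))⁻¹ := by
  simp [D0, Bt0, C0, Qm, Qi, upperMat, lowerMat]

/-- The partial permutation matrix of the reflection `mirror c`. -/
def perm (c : ℤ) : Matrix (Fin (ℓ + 1)) (Fin (ℓ + 1)) ℂ :=
  fun x y => if pt x + pt y = c then 1 else 0

theorem D0_mirror (c : ℤ) :
    (D0 q (mirror c) : Matrix (Fin (ℓ + 1)) (Fin (ℓ + 1)) ℂ) = (q - q⁻¹) • perm c := by
  ext x y
  have e : ∀ a : ℤ, mirror c = mirror a ↔ a = c := fun a =>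
    ⟨fun h => (mirror_inj h).symm, fun h => h ▸ rfl⟩
  rw [Matrix.smul_apply, perm, smul_eq_mul]
  rcases lt_trichotomy x y with h | rfl | h
  · simp only [D0_upper h, low0, (id_ne_mirror c).symm, if_false, e]
  · simp only [D0_diag, g, e, ← two_mul]
    split_ifs <;> simp
  · simp only [D0_lower h, low0', (id_ne_mirror c).symm, if_false, e, add_comm]

theorem exists_pt {a : ℤ} (h : 0 ≤ a) (h' : a ≤ ℓ) : ∃ x : Fin (ℓ + 1), pt x = a := by
  refine ⟨⟨a.toNat, by omega⟩, ?_⟩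
  simp [pt, h]

theorem perm_mul_apply {c : ℤ} {x w : Fin (ℓ + 1)} (h : pt x + pt w = c)
    (A : Matrix (Fin (ℓ + 1)) (Fin (ℓ + 1)) ℂ) (y : Fin (ℓ + 1)) :
    ((perm c : Matrix (Fin (ℓ + 1)) (Fin (ℓ + 1)) ℂ) * A) x y = A w y := by
  rw [Matrix.mul_apply, Finset.sum_eq_single w]
  · simp [perm, h]
  · intro b _ hb
    rw [perm, if_neg, zero_mul]
    intro h'; exact hb (pt_inj.1 (by omega))
  · simp

theorem mul_perm_apply {c : ℤ} {y w : Fin (ℓ + 1)} (h : pt w + pt y = c)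
    (A : Matrix (Fin (ℓ + 1)) (Fin (ℓ + 1)) ℂ) (x : Fin (ℓ + 1)) :
    (A * (perm c : Matrix (Fin (ℓ + 1)) (Fin (ℓ + 1)) ℂ)) x y = A x w := by
  rw [Matrix.mul_apply, Finset.sum_eq_single w]
  · simp [perm, h]
  · intro b _ hb
    rw [perm, if_neg, mul_zero]
    intro h'; exact hb (pt_inj.1 (by omega))
  · simp

theorem perm_mul_apply_zero {c : ℤ} {x : Fin (ℓ + 1)} (h : ∀ w : Fin (ℓ + 1), pt x + pt w ≠ c)
    (A : Matrix (Fin (ℓ + 1)) (Fin (ℓ + 1)) ℂ) (y : Fin (ℓ + 1)) :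
    ((perm c : Matrix (Fin (ℓ + 1)) (Fin (ℓ + 1)) ℂ) * A) x y = 0 := by
  rw [Matrix.mul_apply]
  refine Finset.sum_eq_zero fun w _ => ?_
  rw [perm, if_neg (h w), zero_mul]

theorem mul_perm_apply_zero {c : ℤ} {y : Fin (ℓ + 1)} (h : ∀ w : Fin (ℓ + 1), pt w + pt y ≠ c)
    (A : Matrix (Fin (ℓ + 1)) (Fin (ℓ + 1)) ℂ) (x : Fin (ℓ + 1)) :
    (A * (perm c : Matrix (Fin (ℓ + 1)) (Fin (ℓ + 1)) ℂ)) x y = 0 := by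
  rw [Matrix.mul_apply]
  refine Finset.sum_eq_zero fun w _ => ?_
  rw [perm, if_neg (h w), mul_zero]

theorem range_of_low_ne_zero {k : ℕ} (h : M.low q i j (k + 1) ψ ≠ 0) {e : ℤ}
    (he : i ≤ e) (he' : e < j) : 0 ≤ edge ψ e ∧ edge ψ e < ℓ := by
  obtain ⟨φ, hφ⟩ := exists_stp_of_low_ne_zero h
  obtain ⟨f, hf, hfe⟩ := hφ.edge_mem_image he he'
  rw [← hfe]; exact M.image_range f hf

theorem range_of_up_ne_zero {k : ℕ} (h : M.up q i j (k + 1) φ ≠ 0) {e : ℤ}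
    (he : i ≤ e) (he' : e < j) : 0 ≤ edge φ e ∧ edge φ e < ℓ := by
  obtain ⟨ψ, hψ⟩ := exists_stp_of_up_ne_zero h
  exact M.mem_range _ (hψ.2 e he he').1

/-- In the block of a reflection, `fac'` is the flip of `fac`.  Where the reflection leaves the range of
indices both sides vanish, because images of edges are edges. -/
theorem perm_mul_fac' (hq : q ≠ 0) (c : ℤ) (k : ℕ) :
    perm c * M.fac' q (mirror c) (k + 1) = M.fac q (mirror c) (k + 1) * perm c := by
  rw [fac', fac, mul_add, add_mul, mul_one, one_mul]
  congr 1
  ext x y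
  by_cases hx : ∃ w : Fin (ℓ + 1), pt x + pt w = c
  · obtain ⟨x', hx'⟩ := hx
    rw [perm_mul_apply hx']
    by_cases hy : ∃ w : Fin (ℓ + 1), pt w + pt y = c
    · obtain ⟨y', hy'⟩ := hy
      rw [mul_perm_apply hy', upperMat, lowerMat]
      have hiff : x' < y ↔ y' < x := by rw [← pt_lt, ← pt_lt]; omega
      by_cases h : y' < x
      · rw [if_pos h, if_pos (hiff.2 h), ← up_mirror hq (pt_lt.2 h)]
        rw [show c - pt x = pt x' by omega, show c - pt y' = pt y by omega]
      · rw [if_neg h, if_neg (fun h' => h (hiff.1 h'))]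
    · rw [mul_perm_apply_zero (not_exists.1 hy), upperMat]
      split_ifs with h
      · by_contra hne
        have := range_of_up_ne_zero hne (e := pt y - 1)
          (by have := pt_lt.2 h; omega) (by omega)
        rw [edge_mirror] at this
        obtain ⟨w, hw⟩ := exists_pt (ℓ := ℓ) (a := c - pt y) (by omega) (by omega)
        exact hy ⟨w, by omega⟩
      · rfl
  · rw [perm_mul_apply_zero (not_exists.1 hx)]
    by_cases hy : ∃ w : Fin (ℓ + 1), pt w + pt y = c
    · obtain ⟨y', hy'⟩ := hy
      rw [mul_perm_apply hy', lowerMat]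
      split_ifs with h
      · by_contra hne
        have := range_of_low_ne_zero (Ne.symm hne) (e := pt x - 1)
          (by have := pt_lt.2 h; omega) (by omega)
        rw [edge_mirror] at this
        obtain ⟨w, hw⟩ := exists_pt (ℓ := ℓ) (a := c - pt x) (by omega) (by omega)
        exact hx ⟨w, by omega⟩
      · rfl
    · rw [mul_perm_apply_zero (not_exists.1 hy)]

theorem fac_id (k : ℕ) : M.fac q id (k + 1) = 1 := by
  ext x y
  simp only [fac, Matrix.add_apply, lowerMat]
  split_ifs with h
  · have : M.low q (pt y) (pt x) (k + 1) id = 0 := by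
      by_contra hne
      obtain ⟨χ, h1, h2⟩ := exists_pth_of_low_ne_zero (pt_lt.2 h) hne
      exact Nat.succ_ne_zero k (h1.eq_zero (pt_lt.2 h) (Or.inl rfl) h2)
    rw [this, add_zero]
  · rw [add_zero]

theorem fac'_id (k : ℕ) : M.fac' q id (k + 1) = 1 := by
  ext x y
  simp only [fac', Matrix.add_apply, upperMat]
  split_ifs with h
  · have : M.up q (pt x) (pt y) (k + 1) id = 0 := by
      by_contra hne
      obtain ⟨χ, h1, h2⟩ := exists_pth_of_up_ne_zero (pt_lt.2 h) hne
      exact Nat.succ_ne_zero k (Special.eq_zero (pt_lt.2 h) (Or.inl rfl) h1 h2)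
    rw [this, add_zero]
  · rw [add_zero]

theorem mul_list_prod {n : ℕ} {P : Matrix (Fin n) (Fin n) ℂ} {f f' : ℕ → Matrix (Fin n) (Fin n) ℂ}
    (h : ∀ k, P * f' k = f k * P) (l : List ℕ) : P * (l.map f').prod = (l.map f).prod * P := by
  induction l with
  | nil => simp
  | cons a l ih =>
    rw [List.map_cons, List.map_cons, List.prod_cons, List.prod_cons, ← mul_assoc, h, mul_assoc, ih,
      mul_assoc]

/-- `D0` intertwines the two twists: it is a multiple of the flip for a reflection, there is nothing to
show for the identity since the twist is then trivial by nilpotency, and it vanishes for the other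
translations. -/
theorem D0_mul_tw' (hq : q ≠ 0) (φ : ℤ → ℤ) : D0 q φ * M.tw' q φ = M.tw q φ * D0 q φ := by
  by_cases hid : φ = id
  · subst hid
    -- a path from a special motion to the identity has length zero
    exact mul_list_prod (fun k => by rw [fac_id, fac'_id, mul_one, one_mul]) _
  by_cases hm : ∃ c, φ = mirror c
  · obtain ⟨c, rfl⟩ := hm
    rw [D0_mirror, Matrix.smul_mul, Matrix.mul_smul]
    congr 1
    exact mul_list_prod (fun k => perm_mul_fac' hq c k) _
  · have : (D0 q φ : Matrix (Fin (ℓ + 1)) (Fin (ℓ + 1)) ℂ) = 0 := by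
      ext x y
      have hm' : ∀ c, φ ≠ mirror c := fun c h => hm ⟨c, h⟩
      rcases lt_trichotomy x y with h | rfl | h
      · simp [D0_upper h, low0, hid, hm']
      · simp [D0_diag, g, hm']
      · simp [D0_lower h, low0', hid, hm']
    rw [this, zero_mul, mul_zero]

/-- The block of `J⁻¹ R_st J²¹` with the part which intertwines the twists split off. -/
theorem Rb_eq (hq : q ≠ 0) (φ : ℤ → ℤ) :
    M.Rb q φ = (M.tw q φ)⁻¹ * C0 q φ * M.tw' q φ + D0 q φ := by
  have h1 : Bt0 q φ = C0 q φ + (D0 q φ : Matrix (Fin (ℓ + 1)) (Fin (ℓ + 1)) ℂ) := by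
    rw [D0]; abel
  rw [Rb, h1, mul_add, add_mul]
  congr 1
  rw [mul_assoc, D0_mul_tw' hq, ← mul_assoc, Matrix.nonsing_inv_mul _ lowerUni_tw.isUnit, one_mul]

/-- The blocks of `φ` and of `T φ` agree on the components of the step, up to the difference of the
standard matrices and powers of `q`. -/
theorem Rb_step (hq : q ≠ 0) {x₀ y₀ : ℤ} (hxy : x₀ < y₀) (h : M.Stp x₀ y₀ φ ψ)
    {x y : Fin (ℓ + 1)} (hx : x ∈ cls (fun e => edge φ e ∈ M.Γ) x₀)
    (hy : y ∈ cls (fun e => edge φ e ∈ M.Γ) x₀) :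
    M.Rb q φ x y = D0 q φ x y + (g q φ (pt x))⁻¹ * M.Rb q ψ x y * (g q ψ (pt y))⁻¹ := by
  have hN := ordConnected_cls (ℓ := ℓ) (fun e => edge φ e ∈ M.Γ) x₀
  have u1 := (lowerUni_tw (M := M) (q := q) (φ := φ)).isUnit
  have u2 := (lowerUni_tw (M := M) (q := q) (φ := ψ)).isUnit
  have hCB : (C0 q φ * B0 q φ : Matrix (Fin (ℓ + 1)) (Fin (ℓ + 1)) ℂ) = 1 :=
    mul_eq_one_comm.1 (B0_mul_C0 hq)
  -- the inverse form of `tw_congr`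
  have c1 : CongrOn (cls (fun e => edge φ e ∈ M.Γ) x₀) ((M.tw q φ)⁻¹ * C0 q φ)
      (Qi q φ * (M.tw q ψ)⁻¹) := by
    refine CongrOn.inv_lower hN (lower_B0.mul lowerUni_tw.1) (lowerUni_tw.1.mul lower_Qm)
      (lowerUni_tw.inv.1.mul lower_C0) (lower_Qi.mul lowerUni_tw.inv.1) ?_ ?_ (tw_congr hq hxy h)
    · calc _ = (M.tw q φ)⁻¹ * (C0 q φ * B0 q φ) * M.tw q φ := by simp only [mul_assoc]
        _ = 1 := by rw [hCB, mul_one, Matrix.nonsing_inv_mul _ u1]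
    · calc _ = M.tw q ψ * (Qm q φ * Qi q φ) * (M.tw q ψ)⁻¹ := by simp only [mul_assoc]
        _ = 1 := by rw [Qm_mul_Qi hq, mul_one, Matrix.mul_nonsing_inv _ u2]
  have c2 := mul_congr_blk hx hy (blk_tw' (M := M) (q := q) φ x₀)
    ((show Blk _ (Qi q φ) from Blk.diagonal _).mul ((blk_tw_of_stp (q := q) hxy h).inv u2)) c1 (tw'_congr hq hxy h)
  have e : Qi q φ * (M.tw q ψ)⁻¹ * (Bt0 q ψ * M.tw' q ψ * Qi q ψ) =
      Qi q φ * M.Rb q ψ * Qi q ψ := by rw [Rb]; simp only [mul_assoc]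
  rw [Rb_eq hq, Matrix.add_apply, c2, add_comm, e, Qi, Qi, Matrix.mul_diagonal,
    Matrix.diagonal_mul]

theorem mem_cls_self (P : ℤ → Prop) (x : Fin (ℓ + 1)) : x ∈ cls P (pt x) := by
  intro e he he'; omega

/-- If no step is possible on `[x, y]`, the entry comes from `D0` alone. -/
theorem Rb_upper_of_not_stp (hq : q ≠ 0) {x y : Fin (ℓ + 1)} (hxy : x < y) (hφ : Rigid φ)
    (h : ¬ ∃ ψ, M.Stp (pt x) (pt y) φ ψ) : M.Rb q φ x y = low0 q (pt x) (pt y) φ := by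
  have hxy' := pt_lt.2 hxy
  rw [Rb_eq hq, Matrix.add_apply, D0_upper hxy, Matrix.mul_apply, Finset.sum_eq_zero, zero_add]
  intro w _
  by_contra hne
  have h1 := (blk_tw' (M := M) (q := q) φ (pt y) w y (right_ne_zero_of_mul hne)).2
    (mem_cls_self _ _)
  have h2 : w ≤ x := by
    by_contra hlt
    exact left_ne_zero_of_mul hne ((lowerUni_tw.inv.1.mul lower_C0) x w (not_le.1 hlt))
  refine h (exists_stp hxy' hφ fun e he he' => h1 e ?_ ?_)
  · have : pt w ≤ pt x := by simpa [pt] using h2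
    omega
  · omega

theorem Rb_lower_of_not_stp {x y : Fin (ℓ + 1)} (hxy : y < x) (hψ : Rigid ψ)
    (h : ¬ ∃ φ, M.Stp (pt y) (pt x) φ ψ) : M.Rb q ψ x y = 0 := by
  have hxy' := pt_lt.2 hxy
  rw [Rb, mul_assoc, Matrix.mul_apply, Finset.sum_eq_zero]
  intro w _
  by_contra hne
  have h1 := ((blk_tw (M := M) (q := q) ψ (pt x)).inv lowerUni_tw.isUnit x w
    (left_ne_zero_of_mul hne)).1 (mem_cls_self _ _)
  have h2 : w ≤ y := by
    by_contra hlt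
    exact right_ne_zero_of_mul hne ((upper_Bt0.mul upper_tw') w y (not_le.1 hlt))
  refine h (exists_stp_left hxy' hψ fun e he he' => h1 e ?_ ?_)
  · have : pt w ≤ pt y := by simpa [pt] using h2
    omega
  · omega

theorem left_mem_cls {x : Fin (ℓ + 1)} (hx : pt x = i) :
    x ∈ cls (fun e => edge φ e ∈ M.Γ) i := by
  intro e he he'; omega

theorem right_mem_cls (h : M.Stp i j φ ψ) {x : Fin (ℓ + 1)} (hx : pt x = j) (hij : i < j) :
    x ∈ cls (fun e => edge φ e ∈ M.Γ) i := by
  intro e he he'; exact (h.2 e (by omega) (by omega)).1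

theorem diag_fac' (k : ℕ) (x : Fin (ℓ + 1)) : M.fac' q φ k x x = 1 := by
  simp [fac', upperMat]

theorem diag_tw' (x : Fin (ℓ + 1)) : M.tw' q φ x x = 1 := by
  rw [tw']
  induction List.range M.depth with
  | nil => simp
  | cons a l ih =>
    rw [List.map_cons, List.prod_cons,
      Upper.mul_diag (upper_fac' _) (Upper.list_prod fun _ => upper_fac' _), diag_fac', ih, one_mul]

/-! ### The entries of the blocks -/

theorem Pth.lt_depth {k : ℕ} (hij : i < j) (h : M.Pth i j k φ ψ) : k < M.depth :=
  M.exists_bound.choose_spec _ _ _ _ _ hij h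

/-- The diagonal entries are those of `R_st`. -/
theorem Rb_diag (hq : q ≠ 0) (hφ : Rigid φ) (x : Fin (ℓ + 1)) :
    M.Rb q φ x x = g q φ (pt x) := by
  -- induction on a bound for the number of steps along the edge below `x`
  have key : ∀ n φ, Rigid φ → (∀ ψ, ¬ M.Pth (pt x - 1) (pt x) n φ ψ) →
      M.Rb q φ x x = g q φ (pt x) := by
    intro n
    induction n with
    | zero => intro φ hφ h; exact absurd ⟨hφ, rfl⟩ (h φ)
    | succ n ih =>
      intro φ hφ h
      by_cases hex : ∃ ψ, M.Stp (pt x - 1) (pt x) φ ψ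
      · obtain ⟨ψ, hψ⟩ := hex
        have hlt : pt x - 1 < pt x := by omega
        rw [Rb_step hq hlt hψ (right_mem_cls hψ rfl hlt) (right_mem_cls hψ rfl hlt), D0_diag,
          ih ψ (hψ.rigid_right hlt) fun ψ' h' => h ψ' ((hψ.pth_iff hlt).2 h'), mul_assoc,
          mul_inv_cancel₀ (g_ne_zero hq _)]
        ring
      · rw [Rb_eq hq, Matrix.add_apply, D0_diag, Matrix.mul_apply, Finset.sum_eq_single x,
          lowerUni_tw.inv.1.mul_diag lower_C0, lowerUni_tw.inv.2, diag_tw']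
        · simp [C0, Qi, lowerMat]
        · intro w _ hw
          by_contra hne
          have h1 := (blk_tw' (M := M) (q := q) φ (pt x) w x (right_ne_zero_of_mul hne)).2
            (mem_cls_self _ _)
          have h2 : w < x := by
            refine lt_of_le_of_ne ?_ hw
            by_contra hlt
            exact left_ne_zero_of_mul hne ((lowerUni_tw.inv.1.mul lower_C0) x w (not_le.1 hlt))
          have h3 := pt_lt.2 h2
          exact hex (exists_stp (by omega) hφ fun e he he' => h1 e (by omega) (by omega))
        · simp
  refine key M.depth φ hφ fun ψ h => ?_
  exact lt_irrefl _ (h.lt_depth (by omega))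

theorem Rb_upper_zero (hq : q ≠ 0) {x y : Fin (ℓ + 1)} (hxy : x < y) (hφ : Rigid φ)
    (h : ∀ k χ, Special (pt x) (pt y) χ → ¬ M.Pth (pt x) (pt y) k φ χ) : M.Rb q φ x y = 0 := by
  have hxy' := pt_lt.2 hxy
  have key : ∀ n φ, Rigid φ → (∀ k χ, Special (pt x) (pt y) χ → ¬ M.Pth (pt x) (pt y) k φ χ) →
      (∀ ψ, ¬ M.Pth (pt x) (pt y) n φ ψ) → M.Rb q φ x y = 0 := by
    intro n
    induction n with
    | zero => intro φ hφ _ h; exact absurd ⟨hφ, rfl⟩ (h φ)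
    | succ n ih =>
      intro φ hφ hsp h
      have h0 : low0 q (pt x) (pt y) φ = 0 :=
        low0_of_not_special fun hs => hsp 0 φ hs ⟨hφ, rfl⟩
      by_cases hex : ∃ ψ, M.Stp (pt x) (pt y) φ ψ
      · obtain ⟨ψ, hψ⟩ := hex
        rw [Rb_step hq hxy' hψ (left_mem_cls rfl) (right_mem_cls hψ rfl hxy'),
          D0_upper hxy, h0, ih ψ (hψ.rigid_right hxy')
            (fun k χ hχ h' => hsp (k + 1) χ hχ ((hψ.pth_iff hxy').2 h'))
            fun ψ' h' => h ψ' ((hψ.pth_iff hxy').2 h')]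
        ring
      · rw [Rb_upper_of_not_stp hq hxy hφ hex, h0]
  exact key M.depth φ hφ h fun ψ h => lt_irrefl _ (h.lt_depth hxy')

/-- The upper entry at `[x, y]` if a special motion `χ` is reached from `φ`. -/
theorem Rb_upper (hq : q ≠ 0) {x y : Fin (ℓ + 1)} (hxy : x < y) {k : ℕ}
    (hχ : Special (pt x) (pt y) χ) (h : M.Pth (pt x) (pt y) k φ χ) :
    M.Rb q φ x y = low0 q (pt x) (pt y) χ * q ^ (-(atPt φ (pt x) +
      M.passAfter (pt x) (pt y) (pt x) k φ + M.passAfter (pt x) (pt y) (pt y) k φ)) := by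
  have hxy' := pt_lt.2 hxy
  induction k generalizing φ with
  | zero =>
    obtain ⟨-, rfl⟩ := h
    have e : atPt φ (pt x) = 0 := if_neg (hχ.ne_mirror hxy' (Or.inl rfl))
    simp only [e, passAfter, Finset.range_zero, Finset.sum_empty, add_zero, neg_zero, zpow_zero,
      mul_one]
    by_cases hex : ∃ ψ, M.Stp (pt x) (pt y) φ ψ
    · obtain ⟨ψ, hψ⟩ := hex
      rw [Rb_step hq hxy' hψ (left_mem_cls rfl) (right_mem_cls hψ rfl hxy'),
        D0_upper hxy, Rb_upper_zero hq hxy (hψ.rigid_right hxy')]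
      · ring
      · intro k χ' hχ' h'
        exact Nat.succ_ne_zero k (hχ.eq_zero hxy' hχ' ((hψ.pth_iff hxy').2 h'))
    · exact Rb_upper_of_not_stp hq hxy hχ.rigid hex
  | succ k ih =>
    obtain ⟨ψ, h1, h2⟩ := (pth_succ_left hxy').1 h
    have h0 : low0 q (pt x) (pt y) φ = 0 :=
      low0_of_not_special fun hs => Nat.succ_ne_zero k (hs.eq_zero hxy' hχ h)
    rw [Rb_step hq hxy' h1 (left_mem_cls rfl) (right_mem_cls h1 rfl hxy'),
      D0_upper hxy, h0, ih h2, passAfter_succ hxy' h1, passAfter_succ hxy' h1, g_eq_zpow, g_eq_zpow,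
      ← zpow_neg, ← zpow_neg, zero_add]
    rw [show ∀ a b c d : ℂ, a * (b * c) * d = b * (a * c * d) by intros; ring, ← zpow_add₀ hq,
      ← zpow_add₀ hq]
    congr 2; ring

theorem Rb_lower_zero (hq : q ≠ 0) {x y : Fin (ℓ + 1)} (hxy : y < x) (hψ : Rigid ψ)
    (h : ∀ k χ, Special (pt y) (pt x) χ → ¬ M.Pth (pt y) (pt x) (k + 1) χ ψ) :
    M.Rb q ψ x y = 0 := by
  have hxy' := pt_lt.2 hxy
  have key : ∀ n ψ, Rigid ψ →
      (∀ k χ, Special (pt y) (pt x) χ → ¬ M.Pth (pt y) (pt x) (k + 1) χ ψ) →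
      (∀ φ, ¬ M.Pth (pt y) (pt x) n φ ψ) → M.Rb q ψ x y = 0 := by
    intro n
    induction n with
    | zero => intro ψ hψ _ h; exact absurd ⟨hψ, rfl⟩ (h ψ)
    | succ n ih =>
      intro ψ hψ hsp h
      by_cases hex : ∃ φ, M.Stp (pt y) (pt x) φ ψ
      · obtain ⟨φ, hφ⟩ := hex
        have h0 : low0' q (pt y) (pt x) φ = 0 :=
          low0'_of_not_special fun hs => hsp 0 φ hs (pth_one.2 hφ)
        have h1 := Rb_step hq hxy' hφ (right_mem_cls hφ rfl hxy') (left_mem_cls rfl)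
        rw [D0_lower hxy, h0, ih φ hφ.1
            (fun k χ hχ h' => hsp (k + 1) χ hχ ((hφ.pth_iff' hxy').2 h'))
            fun ψ' h' => h ψ' ((hφ.pth_iff' hxy').2 h'), zero_add, eq_comm, mul_eq_zero,
            mul_eq_zero] at h1
        have g1 := inv_ne_zero (g_ne_zero (φ := φ) hq (pt x))
        have g2 := inv_ne_zero (g_ne_zero (φ := ψ) hq (pt y))
        simpa [g1, g2] using h1
      · exact Rb_lower_of_not_stp hxy hψ hex
  exact key M.depth ψ hψ h fun ψ h => lt_irrefl _ (h.lt_depth hxy')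

/-- The lower entries, in a form which is also valid for paths of length zero. -/
theorem Rb_lower_aux (hq : q ≠ 0) {x y : Fin (ℓ + 1)} (hxy : y < x) {k : ℕ}
    (hχ : Special (pt y) (pt x) χ) (h : M.Pth (pt y) (pt x) k χ ψ) :
    M.Rb q ψ x y - low0' q (pt y) (pt x) ψ = -(low0' q (pt y) (pt x) χ * q ^ (atPt ψ (pt y) +
      M.passBefore (pt y) (pt x) (pt y) k ψ + M.passBefore (pt y) (pt x) (pt x) k ψ)) := by
  have hxy' := pt_lt.2 hxy
  induction k generalizing ψ with
  | zero =>
    obtain ⟨-, rfl⟩ := h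
    have e : atPt χ (pt y) = 0 := if_neg (hχ.ne_mirror hxy' (Or.inl rfl))
    simp only [e, passBefore, Finset.range_zero, Finset.sum_empty, add_zero, zpow_zero, mul_one]
    rw [Rb_lower_zero hq hxy hχ.rigid, zero_sub]
    intro k χ' hχ' h'
    exact Nat.succ_ne_zero k (hχ'.eq_zero hxy' hχ h')
  | succ k ih =>
    have h0 : low0' q (pt y) (pt x) ψ = 0 :=
      low0'_of_not_special fun hs => Nat.succ_ne_zero k (hχ.eq_zero hxy' hs h)
    obtain ⟨φ, h1, h2⟩ := h
    have h3 := Rb_step hq hxy' h2 (right_mem_cls h2 rfl hxy') (left_mem_cls rfl)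
    have h4 := ih h1
    rw [h3, D0_lower hxy, add_sub_cancel_left] at h4
    have g1 := g_ne_zero (φ := φ) hq (pt x)
    have g2 := g_ne_zero (φ := ψ) hq (pt y)
    have h5 : M.Rb q ψ x y = g q φ (pt x) * ((g q φ (pt x))⁻¹ * M.Rb q ψ x y * (g q ψ (pt y))⁻¹) *
        g q ψ (pt y) := by field_simp
    rw [h0, sub_zero, h5, h4, passBefore_succ hxy' h2, passBefore_succ hxy' h2, g_eq_zpow,
      g_eq_zpow]
    rw [show ∀ a b c d : ℂ, a * -(b * c) * d = -(b * (a * c * d)) by intros; ring,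
      ← zpow_add₀ hq, ← zpow_add₀ hq]
    congr 3; ring

/-- The lower entry at `[y, x]` if `ψ` is reached from a special motion `χ` in a positive number of
steps. -/
theorem Rb_lower (hq : q ≠ 0) {x y : Fin (ℓ + 1)} (hxy : y < x) {k : ℕ} (hk : k ≠ 0)
    (hχ : Special (pt y) (pt x) χ) (h : M.Pth (pt y) (pt x) k χ ψ) :
    M.Rb q ψ x y = -(low0' q (pt y) (pt x) χ * q ^ (atPt ψ (pt y) +
      M.passBefore (pt y) (pt x) (pt y) k ψ + M.passBefore (pt y) (pt x) (pt x) k ψ)) := by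
  rw [← Rb_lower_aux hq hxy hχ h, low0'_of_not_special, sub_zero]
  exact fun hs => hk (hχ.eq_zero (pt_lt.2 hxy) hs h)

end Motion

end GGS

namespace GGS

/-! ### The motion of a Belavin–Drinfeld triple -/

theorem simpleRoot_apply {ℓ : ℕ} (k : Fin ℓ) (y : Fin (ℓ + 1)) :
    simpleRoot k y =
      (if pt y = (k : ℕ) then 1 else 0) - (if pt y = (k : ℕ) + 1 then 1 else 0) := by
  simp only [simpleRoot, Pi.sub_apply, Pi.single_apply, Fin.ext_iff, pt]
  congr 1
  · simp
  · simp only [Fin.val_succ]; norm_cast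

theorem simpleRoot_dotProduct {ℓ : ℕ} (i j : Fin ℓ) :
    simpleRoot i ⬝ᵥ simpleRoot j =
      if i = j then 2 else if |((i : ℕ) : ℤ) - (j : ℕ)| = 1 then -1 else 0 := by
  rw [simpleRoot, sub_dotProduct, single_one_dotProduct, single_one_dotProduct, simpleRoot_apply,
    simpleRoot_apply]
  simp only [pt, Fin.val_castSucc, Fin.val_succ, Fin.ext_iff]
  have h : |((i : ℕ) : ℤ) - (j : ℕ)| = 1 ↔ (i : ℕ) = j + 1 ∨ (j : ℕ) = i + 1 := by
    rw [abs_eq (by norm_num)]; omega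
  simp only [h]
  push_cast
  split_ifs <;> omega

namespace BDTriple

variable {ℓ : ℕ} (D : BDTriple ℓ)

/-- `Γ₁` as a set of edges. -/
def edges : Set ℤ := {e | ∃ k ∈ D.Γ₁, ((k : ℕ) : ℤ) = e}

open Classical in
/-- `T` on edges, with the value `0` outside of the range of edges. -/
noncomputable def Te (e : ℤ) : ℤ :=
  if h : ∃ k : Fin ℓ, ((k : ℕ) : ℤ) = e then ((D.T h.choose : ℕ) : ℤ) else 0

open Classical in
/-- The direction in which `T` moves the component of the edge `e`: `1` if it preserves the
orientation and `-1` if it reverses it.  An isolated edge is given the direction `1`. -/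
noncomputable def dir (e : ℤ) : ℤ :=
  if e + 1 ∈ D.edges then D.Te (e + 1) - D.Te e
  else if e - 1 ∈ D.edges then D.Te e - D.Te (e - 1) else 1

/-- The rigid motion which extends `T` on the component of the edge `e`. -/
noncomputable def move (e : ℤ) : ℤ → ℤ :=
  fun x => if D.dir e = 1 then D.Te e - e + x else D.Te e + e + 1 - x

theorem Te_coe (k : Fin ℓ) : D.Te ((k : ℕ) : ℤ) = (D.T k : ℕ) := by
  have hex : ∃ k' : Fin ℓ, ((k' : ℕ) : ℤ) = ((k : ℕ) : ℤ) := ⟨k, rfl⟩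
  have : hex.choose = k := Fin.ext (by exact_mod_cast hex.choose_spec)
  rw [Te, dif_pos hex, this]

theorem coe_mem_edges {k : Fin ℓ} : ((k : ℕ) : ℤ) ∈ D.edges ↔ k ∈ D.Γ₁ := by
  constructor
  · rintro ⟨k', h, h'⟩
    have : k' = k := Fin.ext (by exact_mod_cast h')
    rwa [← this]
  · exact fun h => ⟨k, h, rfl⟩

theorem Te_inj {e f : ℤ} (he : e ∈ D.edges) (hf : f ∈ D.edges) (h : D.Te e = D.Te f) : e = f := by
  obtain ⟨k, hk, rfl⟩ := he
  obtain ⟨l, hl, rfl⟩ := hf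
  rw [Te_coe, Te_coe] at h
  have : D.T k = D.T l := Fin.ext (by exact_mod_cast h)
  rw [D.bijOn.injOn hk hl this]

/-- Preservation of the inner product is preservation of adjacency. -/
theorem Te_adj {e f : ℤ} (he : e ∈ D.edges) (hf : f ∈ D.edges) :
    |D.Te e - D.Te f| = 1 ↔ |e - f| = 1 := by
  obtain ⟨k, hk, rfl⟩ := he
  obtain ⟨l, hl, rfl⟩ := hf
  have h := D.inner_eq k hk l hl
  rw [Te_coe, Te_coe]
  by_cases hkl : k = l
  · subst hkl; simp
  · have hkl' : D.T k ≠ D.T l := fun h => hkl (D.bijOn.injOn hk hl h)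
    rw [simpleRoot_dotProduct, simpleRoot_dotProduct, if_neg hkl, if_neg hkl'] at h
    split_ifs at h with h1 h2 h2 <;> simp_all

theorem Te_succ {e : ℤ} (he : e ∈ D.edges) (he' : e + 1 ∈ D.edges) :
    D.Te (e + 1) - D.Te e = 1 ∨ D.Te (e + 1) - D.Te e = -1 := by
  have := (D.Te_adj he' he).2 (by simp)
  rcases abs_cases (D.Te (e + 1) - D.Te e) with ⟨h, -⟩ | ⟨h, -⟩ <;> omega

/-- The two cases in the definition of `dir` agree, since `T` is injective and preserves adjacency. -/
theorem dir_succ {e : ℤ} (he : e ∈ D.edges) (he' : e + 1 ∈ D.edges) :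
    D.dir (e + 1) = D.Te (e + 1) - D.Te e := by
  rw [dir]
  split_ifs with h1 h2
  · have h3 := D.Te_succ he he'
    have h4 := D.Te_succ he' h1
    have h5 : D.Te (e + 1 + 1) ≠ D.Te e := fun h => by
      have := D.Te_inj h1 he h; omega
    omega
  · rw [add_sub_cancel_right]
  · exact absurd (by rwa [add_sub_cancel_right]) h2

theorem edge_move (e : ℤ) : edge (D.move e) e = D.Te e := by
  simp only [edge, move]; split_ifs <;> omega

/-- Nilpotency for all edges at once. -/
theorem not_chain : ∃ K : ℕ, ∀ c : ℕ → ℤ, ¬ ∀ s < K, c s ∈ D.edges ∧ c (s + 1) = D.Te (c s) := by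
  have h : ∀ i : Fin ℓ, ∃ k : ℕ, D.T^[k] i ∉ D.Γ₁ := fun i => by
    by_cases hi : i ∈ D.Γ₁
    · exact D.nilpotent i hi
    · exact ⟨0, hi⟩
  choose k hk using h
  refine ⟨Finset.univ.sup k + 1, fun c hc => ?_⟩
  obtain ⟨i, hi, hi'⟩ := (hc 0 (by omega)).1
  have key : ∀ s ≤ Finset.univ.sup k, c s = ((D.T^[s] i : Fin ℓ) : ℕ) := by
    intro s
    induction s with
    | zero => intro _; exact hi'.symm
    | succ s ih =>
      intro hs
      rw [(hc s (by omega)).2, ih (by omega), Te_coe, Function.iterate_succ_apply']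
  have hle : k i ≤ Finset.univ.sup k := Finset.le_sup (Finset.mem_univ i)
  have h1 := (hc (k i) (by omega)).1
  rw [key _ hle, coe_mem_edges] at h1
  exact hk i h1

/-- The partial isometry of edges given by a Belavin–Drinfeld triple. -/
noncomputable def motion : Motion ℓ where
  Γ := D.edges
  t := D.move
  mem_range := by
    rintro e ⟨k, -, rfl⟩
    have := k.2
    omega
  image_range := by
    rintro e ⟨k, -, rfl⟩
    rw [edge_move, Te_coe]
    have := (D.T k).2
    omega
  rigid e _ := by
    by_cases h : D.dir e = 1
    · exact Or.inl ⟨D.Te e - e, fun x => by simp [move, h]⟩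
    · exact Or.inr ⟨D.Te e + e + 1, fun x => by simp [move, h]⟩
  t_succ e he he' := by
    have h1 : D.dir e = D.Te (e + 1) - D.Te e := by rw [dir, if_pos he']
    have h2 := D.Te_succ he he'
    ext x
    simp only [move, h1, D.dir_succ he he']
    split_ifs <;> omega
  inj e he f hf h := by
    rw [edge_move, edge_move] at h
    exact D.Te_inj he hf h
  adj e he f hf h := by
    rw [edge_move, edge_move] at h
    exact (D.Te_adj he hf).1 h
  nilp := by
    obtain ⟨K, hK⟩ := D.not_chain
    refine ⟨K, fun c hc => hK c fun s hs => ?_⟩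
    rw [← edge_move]
    exact hc s hs

end BDTriple

end GGS

namespace GGS

/-! ### Iterates of `T` on positive roots as paths of motions -/

namespace Motion

theorem Carries.comp {γ δ : ℤ → ℤ} {i j i' j' i'' j'' : ℤ} (h : Carries γ i' j' i j)
    (h' : Carries δ i'' j'' i' j') : Carries (γ ∘ δ) i'' j'' i j := by
  rcases h with ⟨a, b⟩ | ⟨a, b⟩ <;> rcases h' with ⟨c, d⟩ | ⟨c, d⟩ <;>
    simp [Carries, a, b, c, d]

theorem Carries.symm {γ δ : ℤ → ℤ} {i j i' j' : ℤ} (h : Carries γ i' j' i j)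
    (hδ : δ ∘ γ = id) : Carries δ i j i' j' := by
  have e : ∀ x, δ (γ x) = x := congrFun hδ
  rcases h with ⟨rfl, rfl⟩ | ⟨rfl, rfl⟩ <;> simp [Carries, e]

variable {ℓ : ℕ} {M : Motion ℓ} {i j : ℤ} {φ ψ θ : ℤ → ℤ}

/-- A step along an interval is a step along its image. -/
theorem stp_iff_of_carries (hij : i < j) {i' j' : ℤ} (hij' : i' < j') (hθ : Rigid θ)
    (hc : Carries θ i j i' j') :
    (∃ ψ, M.Stp i j θ ψ ∧ Carries ψ i j i'' j'') ↔
      ∃ τ, M.Stp i' j' id τ ∧ Carries τ i' j' i'' j'' := by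
  constructor
  · rintro ⟨ψ, h1, h2⟩
    obtain ⟨δ, h3, h4, h5⟩ := hθ.exists_inv
    have h6 := hc.symm h5
    have h7 := (pth_one.2 h1).comp_right h3 h6 hij
    rw [h4] at h7
    exact ⟨_, pth_one.1 h7, h2.comp h6⟩
  · rintro ⟨τ, h1, h2⟩
    have h3 := (pth_one.2 h1).comp_right hθ hc hij'
    exact ⟨_, pth_one.1 h3, h2.comp hc⟩

end Motion

namespace PosRoot

variable {ℓ : ℕ} (α β : PosRoot ℓ)

theorem pt_lt_pt : pt α.1.1 < pt α.1.2 := pt_lt.2 α.2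

theorem vec_apply (y : Fin (ℓ + 1)) :
    α.vec y = (if pt y = pt α.1.1 then 1 else 0) - (if pt y = pt α.1.2 then 1 else 0) := by
  simp only [vec, Pi.sub_apply, Pi.single_apply, pt_inj]

theorem vec_eq_iff {a b : ℤ} :
    (∀ y, α.vec y = (if pt y = a then 1 else 0) - (if pt y = b then 1 else 0)) ↔
      pt α.1.1 = a ∧ pt α.1.2 = b := by
  constructor
  · intro h
    have h0 := α.pt_lt_pt
    have h1 := h α.1.1
    have h2 := h α.1.2
    rw [vec_apply, if_pos rfl, if_neg h0.ne] at h1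
    rw [vec_apply, if_neg h0.ne', if_pos rfl] at h2
    constructor
    · by_contra hne; rw [if_neg hne] at h1; split_ifs at h1 <;> omega
    · by_contra hne; rw [if_neg hne] at h2; split_ifs at h2 <;> omega
  · rintro ⟨rfl, rfl⟩ y; exact vec_apply _ _

theorem mem_support {k : Fin ℓ} :
    k ∈ α.support ↔ pt α.1.1 ≤ (k : ℕ) ∧ ((k : ℕ) : ℤ) < pt α.1.2 := by
  simp [support, pt]

/-- Telescoping over the simple roots of a positive root. -/
theorem sum_support (f : ℤ → ℤ) :
    ∑ k ∈ α.support, (f (k : ℕ) - f ((k : ℕ) + 1)) = f (pt α.1.1) - f (pt α.1.2) := by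
  rw [support, Finset.sum_filter,
    Fin.sum_univ_eq_sum_range (fun k => if (α.1.1 : ℕ) ≤ k ∧ k < (α.1.2 : ℕ) then
      (f (k : ℕ) - f ((k : ℕ) + 1)) else 0) ℓ, ← Finset.sum_filter]
  have e : (Finset.range ℓ).filter (fun k => (α.1.1 : ℕ) ≤ k ∧ k < (α.1.2 : ℕ)) =
      Finset.Ico (α.1.1 : ℕ) α.1.2 := by
    ext k; have := α.1.2.2; simp; omega
  have h := Finset.sum_Ico_sub (fun k : ℕ => f k) (Fin.le_def.1 α.2.le)
  rw [e, ← neg_inj, ← Finset.sum_neg_distrib, neg_sub, ← h]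
  refine Finset.sum_congr rfl fun k _ => ?_
  push_cast; ring

theorem ext_pt {α β : PosRoot ℓ} (h1 : pt α.1.1 = pt β.1.1) (h2 : pt α.1.2 = pt β.1.2) : α = β :=
  Subtype.ext (Prod.ext (pt_inj.1 h1) (pt_inj.1 h2))

theorem exists_root {a b : ℤ} (h : a < b) (ha : 0 ≤ a) (hb : b ≤ ℓ) :
    ∃ α : PosRoot ℓ, pt α.1.1 = a ∧ pt α.1.2 = b := by
  obtain ⟨x, hx⟩ := Motion.exists_pt (ℓ := ℓ) ha (by omega)
  obtain ⟨y, hy⟩ := Motion.exists_pt (ℓ := ℓ) (a := b) (by omega) hb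
  exact ⟨⟨(x, y), (pt_lt (x := x) (y := y)).1 (by omega)⟩, hx, hy⟩

end PosRoot

namespace BDTriple

open Motion

variable {ℓ : ℕ} (D : BDTriple ℓ) {α β γ : PosRoot ℓ} {k : ℕ} {θ : ℤ → ℤ}

theorem Te_eq_edge {i j e : ℤ} {τ : ℤ → ℤ} (h : D.motion.Stp i j id τ) (he : i ≤ e) (he' : e < j) :
    D.Te e = edge τ e := by
  obtain ⟨h1, h2⟩ := h.2 e he he'
  rw [edge_id] at h2
  rw [h2, Function.comp_id]
  exact (D.edge_move e).symm

/-- The additive extension of `T` to a root whose interval is moved by `τ`. -/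
theorem sum_support_T {τ : ℤ → ℤ} (hτ : D.motion.Stp (pt γ.1.1) (pt γ.1.2) id τ)
    (y : Fin (ℓ + 1)) : (∑ k ∈ γ.support, simpleRoot (D.T k)) y =
      (if pt y = min (τ (pt γ.1.1)) (τ (pt γ.1.2)) then 1 else 0) -
        (if pt y = max (τ (pt γ.1.1)) (τ (pt γ.1.2)) then 1 else 0) := by
  have h0 := γ.pt_lt_pt
  have h1 : ∀ k ∈ γ.support, simpleRoot (D.T k) y =
      (if pt y = edge τ (k : ℕ) then 1 else 0) - (if pt y = edge τ (k : ℕ) + 1 then 1 else 0) := by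
    intro k hk
    obtain ⟨h2, h3⟩ := γ.mem_support.1 hk
    rw [simpleRoot_apply, ← D.Te_coe, D.Te_eq_edge hτ h2 h3]
  rw [Finset.sum_apply, Finset.sum_congr rfl h1]
  rcases hτ.rigid_right h0 with ⟨c, hc⟩ | ⟨c, hc⟩
  · have h2 := γ.sum_support fun e => if pt y = c + e then 1 else 0
    simp only [edge, hc]
    rw [show min (c + pt γ.1.1) (c + pt γ.1.2) = c + pt γ.1.1 by omega,
      show max (c + pt γ.1.1) (c + pt γ.1.2) = c + pt γ.1.2 by omega, ← h2]
    refine Finset.sum_congr rfl fun k _ => ?_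
    rw [show min (c + ((k : ℕ) : ℤ)) (c + ((k : ℕ) + 1)) = c + (k : ℕ) by omega, add_assoc]
  · have h2 := γ.sum_support fun e => if pt y = c - e then 1 else 0
    simp only [edge, hc]
    rw [show min (c - pt γ.1.1) (c - pt γ.1.2) = c - pt γ.1.2 by omega,
      show max (c - pt γ.1.1) (c - pt γ.1.2) = c - pt γ.1.1 by omega, ← neg_sub, ← h2,
      ← Finset.sum_neg_distrib]
    refine Finset.sum_congr rfl fun k _ => ?_
    rw [show min (c - ((k : ℕ) : ℤ)) (c - ((k : ℕ) + 1)) = c - ((k : ℕ) + 1) by omega, neg_sub,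
      show c - (((k : ℕ) : ℤ) + 1) + 1 = c - (k : ℕ) by ring]

/-- `T γ = β` in terms of a step. -/
theorem maps_iff : D.Maps γ β ↔ ∃ τ, D.motion.Stp (pt γ.1.1) (pt γ.1.2) id τ ∧
    Carries τ (pt γ.1.1) (pt γ.1.2) (pt β.1.1) (pt β.1.2) := by
  have h0 := γ.pt_lt_pt
  have h0' := β.pt_lt_pt
  have key : ∀ τ, D.motion.Stp (pt γ.1.1) (pt γ.1.2) id τ →
      (β.vec = ∑ k ∈ γ.support, simpleRoot (D.T k) ↔
        Carries τ (pt γ.1.1) (pt γ.1.2) (pt β.1.1) (pt β.1.2)) := by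
    intro τ hτ
    rw [funext_iff]
    simp only [D.sum_support_T hτ]
    rw [PosRoot.vec_eq_iff, Carries]
    omega
  constructor
  · rintro ⟨h1, h2⟩
    obtain ⟨τ, hτ⟩ := exists_stp (M := D.motion) h0 rigid_id (fun e he he' => by
      obtain ⟨x, hx⟩ : ∃ x : Fin ℓ, ((x : ℕ) : ℤ) = e :=
        ⟨⟨e.toNat, by have := γ.1.2.2; simp only [pt] at *; omega⟩, by simp [pt] at *; omega⟩
      rw [edge_id, ← hx]
      exact (D.coe_mem_edges).2 (h1 (γ.mem_support.2 (by omega))))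
    exact ⟨τ, hτ, (key τ hτ).1 h2⟩
  · rintro ⟨τ, hτ, hc⟩
    refine ⟨fun x hx => ?_, (key τ hτ).2 hc⟩
    obtain ⟨h2, h3⟩ := γ.mem_support.1 hx
    have := (hτ.2 _ h2 h3).1
    rw [edge_id] at this
    exact (D.coe_mem_edges).1 this

/-- `T^k α = β` in terms of a path. -/
theorem iter_iff : D.Iter k α β ↔ ∃ θ, D.motion.Pth (pt α.1.1) (pt α.1.2) k id θ ∧
    Carries θ (pt α.1.1) (pt α.1.2) (pt β.1.1) (pt β.1.2) := by
  have h0 := α.pt_lt_pt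
  have h0' := β.pt_lt_pt
  induction k generalizing β with
  | zero =>
    constructor
    · rintro rfl; exact ⟨id, ⟨rigid_id, rfl⟩, Or.inl ⟨rfl, rfl⟩⟩
    · rintro ⟨θ, ⟨-, rfl⟩, h | h⟩
      · exact PosRoot.ext_pt h.1 h.2
      · simp only [id] at h; omega
  | succ k ih =>
    constructor
    · rintro ⟨γ, h1, h2⟩
      obtain ⟨θ, h3, h4⟩ := (ih γ.pt_lt_pt).1 h1
      obtain ⟨ψ, h5, h6⟩ := (stp_iff_of_carries h0 γ.pt_lt_pt (h3.rigid_right h0) h4).2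
        (D.maps_iff.1 h2)
      exact ⟨ψ, ⟨θ, h3, h5⟩, h6⟩
    · rintro ⟨ψ, ⟨θ, h1, h2⟩, h3⟩
      have h4 := h1.rigid_right h0
      obtain ⟨γ, hγ⟩ : ∃ γ : PosRoot ℓ,
          Carries θ (pt α.1.1) (pt α.1.2) (pt γ.1.1) (pt γ.1.2) := by
        have e1 := D.motion.mem_range _ (h2.2 (pt α.1.1) le_rfl h0).1
        have e2 := D.motion.mem_range _ (h2.2 (pt α.1.2 - 1) (by omega) (by omega)).1
        rcases h4 with ⟨c, hc⟩ | ⟨c, hc⟩ <;> simp only [edge, hc] at e1 e2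
        · obtain ⟨γ, h5, h6⟩ := PosRoot.exists_root (ℓ := ℓ) (a := c + pt α.1.1)
            (b := c + pt α.1.2) (by omega) (by omega) (by omega)
          exact ⟨γ, Or.inl ⟨by rw [hc, h5], by rw [hc, h6]⟩⟩
        · obtain ⟨γ, h5, h6⟩ := PosRoot.exists_root (ℓ := ℓ) (a := c - pt α.1.2)
            (b := c - pt α.1.1) (by omega) (by omega) (by omega)
          exact ⟨γ, Or.inr ⟨by rw [hc, h6], by rw [hc, h5]⟩⟩
      exact ⟨γ, (ih γ.pt_lt_pt).2 ⟨θ, h1, hγ⟩,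
        D.maps_iff.2 ((stp_iff_of_carries h0 γ.pt_lt_pt h4 hγ).1 ⟨ψ, h2, h3⟩)⟩

/-- The image of a root under a path is a root. -/
theorem exists_carries (h : D.motion.Pth (pt α.1.1) (pt α.1.2) k id θ) :
    ∃ β : PosRoot ℓ, Carries θ (pt α.1.1) (pt α.1.2) (pt β.1.1) (pt β.1.2) := by
  have h0 := α.pt_lt_pt
  cases k with
  | zero => exact ⟨α, Or.inl (by simp [← h.2])⟩
  | succ k =>
    have h4 := h.rigid_right h0
    obtain ⟨χ, -, h2⟩ := h
    obtain ⟨f, hf, hf'⟩ := h2.edge_mem_image le_rfl h0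
    obtain ⟨f', hg, hg'⟩ := h2.edge_mem_image (e := pt α.1.2 - 1) (by omega) (by omega)
    have e1 := D.motion.image_range f hf
    have e2 := D.motion.image_range f' hg
    rw [hf'] at e1
    rw [hg'] at e2
    rcases h4 with ⟨c, hc⟩ | ⟨c, hc⟩ <;> simp only [edge, hc] at e1 e2
    · obtain ⟨γ, h5, h6⟩ := PosRoot.exists_root (ℓ := ℓ) (a := c + pt α.1.1)
        (b := c + pt α.1.2) (by omega) (by omega) (by omega)
      exact ⟨γ, Or.inl ⟨by rw [hc, h5], by rw [hc, h6]⟩⟩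
    · obtain ⟨γ, h5, h6⟩ := PosRoot.exists_root (ℓ := ℓ) (a := c - pt α.1.2)
        (b := c - pt α.1.1) (by omega) (by omega) (by omega)
      exact ⟨γ, Or.inr ⟨by rw [hc, h6], by rw [hc, h5]⟩⟩

/-- `T^k` on the simple roots of an interval. -/
theorem iterate_eq_edge {i j : ℤ} (h : D.motion.Pth i j k id θ) (f : Fin ℓ) (hf : i ≤ (f : ℕ))
    (hf' : ((f : ℕ) : ℤ) < j) : ((D.T^[k] f : ℕ) : ℤ) = edge θ (f : ℕ) := by
  induction k generalizing θ with
  | zero => rw [← h.2, edge_id]; rfl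
  | succ k ih =>
    obtain ⟨χ, h1, h2⟩ := h
    obtain ⟨-, h4⟩ := h2.2 _ hf hf'
    rw [edge_image h2.1 h4, ← ih h1, Function.iterate_succ_apply', ← D.Te_coe]
    exact (D.edge_move _).symm

/-- Orientation is preserved by translations, and always on simple roots. -/
theorem preserves_iff (h : D.motion.Pth (pt α.1.1) (pt α.1.2) k id θ)
    (hc : Carries θ (pt α.1.1) (pt α.1.2) (pt β.1.1) (pt β.1.2)) :
    D.Preserves k α β ↔ θ (pt α.1.1) = pt β.1.1 ∨ α.height = 1 := by
  have h0 := α.pt_lt_pt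
  have h0' := β.pt_lt_pt
  have e1 : ((α.first : ℕ) : ℤ) = pt α.1.1 := rfl
  have e2 : ((α.last : ℕ) : ℤ) = pt α.1.2 - 1 := by simp only [PosRoot.last, pt] at *; omega
  have e3 : ((β.first : ℕ) : ℤ) = pt β.1.1 := rfl
  have e4 : ((β.last : ℕ) : ℤ) = pt β.1.2 - 1 := by simp only [PosRoot.last, pt] at *; omega
  have e5 : (α.height : ℤ) = pt α.1.2 - pt α.1.1 := by simp only [PosRoot.height, pt] at *; omega
  have e6 : α.height = 1 ↔ (α.height : ℤ) = 1 := by omega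
  have e7 := D.iterate_eq_edge h α.first (by omega) (by omega)
  have e8 := D.iterate_eq_edge h α.last (by omega) (by omega)
  rw [e1] at e7
  rw [e2] at e8
  rw [Preserves, Fin.ext_iff, Fin.ext_iff, ← Int.natCast_inj, ← Int.natCast_inj (n := β.last), e7,
    e8, e3, e4, e6, e5]
  rcases h.rigid_right h0 with ⟨c, hc'⟩ | ⟨c, hc'⟩ <;> simp only [Carries, edge, hc'] at * <;> omega

end BDTriple

end GGS

namespace GGS

namespace BDTriple

open Motion

variable {ℓ : ℕ} (D : BDTriple ℓ) {α β γ : PosRoot ℓ} {k : ℕ} {θ χ : ℤ → ℤ} {c : ℤ}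

/-! ### Pairs of roots in the block of a reflection -/

theorem Iter.sum_eq (h : D.Iter k α β) : pt α.1.2 + pt β.1.1 = pt α.1.1 + pt β.1.2 := by
  obtain ⟨θ, h1, h2⟩ := D.iter_iff.1 h
  have h0 := α.pt_lt_pt
  have h0' := β.pt_lt_pt
  rcases h1.rigid_right h0 with ⟨d, hd⟩ | ⟨d, hd⟩ <;> simp only [Carries, hd] at h2 <;> omega

/-- The image of `α` under the reflection `mirror c` is `β`. -/
def Mirrors (c : ℤ) (α β : PosRoot ℓ) : Prop :=
  pt α.1.2 + pt β.1.1 = c ∧ pt α.1.1 + pt β.1.2 = c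

theorem carries_of_special (hc : Mirrors c α β) (hχ : Special (pt α.1.1) (pt α.1.2) χ) :
    Carries (mirror c ∘ χ) (pt α.1.1) (pt α.1.2) (pt β.1.1) (pt β.1.2) := by
  refine Carries.comp (Or.inr ?_) hχ.carries
  simp only [mirror, Mirrors] at *; omega

theorem pth_of_special (h : D.motion.Pth (pt α.1.1) (pt α.1.2) k χ (mirror c))
    (hχ : Special (pt α.1.1) (pt α.1.2) χ) :
    D.motion.Pth (pt α.1.1) (pt α.1.2) k id (mirror c ∘ χ) := by
  have h1 := h.comp_right hχ.rigid hχ.carries α.pt_lt_pt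
  rwa [hχ.comp_self] at h1

/-- `T^k α = β` means that the reflection which exchanges `α` and `β` is reached in `k` steps from
one of the two motions which carry `α` onto itself. -/
theorem iter_mirror_iff (hc : Mirrors c α β) : D.Iter k α β ↔
    ∃ χ, Special (pt α.1.1) (pt α.1.2) χ ∧
      D.motion.Pth (pt α.1.1) (pt α.1.2) k χ (mirror c) := by
  have h0 := α.pt_lt_pt
  rw [D.iter_iff]
  constructor
  · rintro ⟨θ, h1, h2⟩
    have hθ := h1.rigid_right h0
    rcases h2 with ⟨h2, h3⟩ | ⟨h2, h3⟩
    · refine ⟨mirror (pt α.1.1 + pt α.1.2), Or.inr rfl, ?_⟩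
      have hs : Special (pt α.1.1) (pt α.1.2) (mirror (pt α.1.1 + pt α.1.2)) := Or.inr rfl
      have h4 := h1.comp_right hs.rigid hs.carries h0
      rw [Function.id_comp] at h4
      have e : θ ∘ mirror (pt α.1.1 + pt α.1.2) = mirror c := by
        refine (hθ.comp hs.rigid).eq_of_eq (rigid_mirror c) h0.ne ?_ ?_
        · simp only [Function.comp, mirror, add_sub_cancel_left, h3]; have := hc.2; omega
        · simp only [Function.comp, mirror, add_sub_cancel_right, h2]; have := hc.1; omega
      rwa [e] at h4
    · refine ⟨id, Or.inl rfl, ?_⟩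
      have e : θ = mirror c := by
        refine hθ.eq_of_eq (rigid_mirror c) h0.ne ?_ ?_
        · simp only [mirror, h2]; have := hc.2; omega
        · simp only [mirror, h3]; have := hc.1; omega
      rwa [e] at h1
  · rintro ⟨χ, h1, h2⟩
    exact ⟨_, D.pth_of_special h2 h1, carries_of_special hc h1⟩

theorem Iter.det {k' : ℕ} (h : D.Iter k α β) (h' : D.Iter k' α β) : k = k' := by
  have hc : Mirrors (pt α.1.2 + pt β.1.1) α β := ⟨rfl, (Iter.sum_eq D h).symm⟩
  obtain ⟨χ, h1, h2⟩ := (D.iter_mirror_iff hc).1 h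
  obtain ⟨χ', h3, h4⟩ := (D.iter_mirror_iff hc).1 h'
  exact (Special.det' α.pt_lt_pt h1 h3 h2 h4).1

theorem coe_height (α : PosRoot ℓ) : (α.height : ℤ) = pt α.1.2 - pt α.1.1 := by
  have := α.pt_lt_pt
  simp only [PosRoot.height, pt] at *; omega

theorem preserves_mirror_iff (hc : Mirrors c α β) (hχ : Special (pt α.1.1) (pt α.1.2) χ)
    (h : D.motion.Pth (pt α.1.1) (pt α.1.2) k χ (mirror c)) :
    D.Preserves k α β ↔ χ ≠ id ∨ α.height = 1 := by
  have h0 := α.pt_lt_pt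
  have h1 := coe_height α
  rw [D.preserves_iff (D.pth_of_special h hχ) (carries_of_special hc hχ)]
  obtain ⟨hc1, hc2⟩ := hc
  rcases hχ with rfl | rfl
  · simp only [Function.comp, mirror, id, ne_eq, not_true_eq_false, false_or]; omega
  · simp only [Function.comp, mirror, ne_eq, (id_ne_mirror _).symm, not_false_eq_true, true_or,
      iff_true]
    omega

open Classical in
/-- `C_{α,β} = 1` exactly if `|α| > 1` and the path starts at the identity: as it ends at a reflection,
`T^k` then reverses the orientation of `α`. -/
theorem C_eq (hc : Mirrors c α β) (hk : 0 < k) (hχ : Special (pt α.1.1) (pt α.1.2) χ)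
    (h : D.motion.Pth (pt α.1.1) (pt α.1.2) k χ (mirror c)) :
    D.C α β = if χ = id ∧ 1 < α.height then 1 else 0 := by
  have h0 := α.pt_lt_pt
  have h1 := coe_height α
  refine if_congr ?_ rfl rfl
  constructor
  · rintro ⟨k', -, h3, h4⟩
    obtain rfl := Iter.det D h3 ((D.iter_mirror_iff hc).2 ⟨χ, hχ, h⟩)
    rw [D.preserves_mirror_iff hc hχ h, not_or, not_not] at h4
    exact ⟨h4.1, by omega⟩
  · rintro ⟨h2, h3⟩
    refine ⟨k, hk, (D.iter_mirror_iff hc).2 ⟨χ, hχ, h⟩, ?_⟩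
    rw [D.preserves_mirror_iff hc hχ h, not_or, not_not]
    exact ⟨h2, by omega⟩

open Classical in
/-- The exponent in the coefficients of the twist. -/
theorem C_mul (hc : Mirrors c α β) (hk : 0 < k) (hχ : Special (pt α.1.1) (pt α.1.2) χ)
    (h : D.motion.Pth (pt α.1.1) (pt α.1.2) k χ (mirror c)) :
    D.C α β * (α.height - 1) = if χ = id then α.height - 1 else 0 := by
  have h0 := α.pt_lt_pt
  have h1 := coe_height α
  rw [D.C_eq hc hk hχ h]
  by_cases h2 : χ = id
  · by_cases h3 : 1 < α.height
    · simp [h2, h3]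
    · have : α.height = 1 := by omega
      simp [this]
  · simp [h2]

/-! ### Passing -/

/-- `adj` is adjacency at the point `x`: the reflection at `x` exchanges the two roots. -/
def AdjAt (adj : PosRoot ℓ → PosRoot ℓ → Prop) (x : ℤ) (α : PosRoot ℓ) : Prop :=
  (x = pt α.1.1 ∨ x = pt α.1.2) ∧ ∀ γ, adj α γ ↔ Mirrors (2 * x) α γ

theorem adjAt_right (α : PosRoot ℓ) : AdjAt PosRoot.RightAdj (pt α.1.2) α := by
  refine ⟨Or.inr rfl, fun γ => ?_⟩
  simp only [PosRoot.RightAdj, Mirrors, ← pt_inj, pt]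
  omega

theorem adjAt_left (α : PosRoot ℓ) : AdjAt PosRoot.LeftAdj (pt α.1.1) α := by
  refine ⟨Or.inl rfl, fun γ => ?_⟩
  simp only [PosRoot.LeftAdj, Mirrors, ← pt_inj, pt]
  omega

variable {x : ℤ} {adj : PosRoot ℓ → PosRoot ℓ → Prop}

/-- For a simple root `α` and its neighbour `γ` at `x`: `δ` is their union. -/
theorem vec_add_iff (hx : x = pt α.1.1 ∨ x = pt α.1.2) (hα : α.height = 1)
    (hγ : Mirrors (2 * x) α γ) (δ : PosRoot ℓ) :
    δ.vec = α.vec + γ.vec ↔ pt δ.1.1 = x - 1 ∧ pt δ.1.2 = x + 1 := by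
  have h1 := coe_height α
  rw [hα] at h1
  rw [← PosRoot.vec_eq_iff, funext_iff]
  refine forall_congr' fun y => ?_
  rw [Pi.add_apply, α.vec_apply, γ.vec_apply]
  obtain ⟨h2, h3⟩ := hγ
  rcases hx with rfl | rfl
  · rw [show pt α.1.2 = pt α.1.1 + 1 by omega, show pt γ.1.1 = pt α.1.1 - 1 by omega,
      show pt γ.1.2 = pt α.1.1 by omega, add_comm (_ - _), sub_add_sub_cancel]
  · rw [show pt α.1.1 = pt α.1.2 - 1 by omega, show pt γ.1.1 = pt α.1.2 by omega,
      show pt γ.1.2 = pt α.1.2 + 1 by omega, sub_add_sub_cancel]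

theorem carries_mirror (hγ : Mirrors c α γ) :
    Carries (mirror c) (pt α.1.1) (pt α.1.2) (pt γ.1.1) (pt γ.1.2) ∧
      Carries (mirror c) (pt γ.1.1) (pt γ.1.2) (pt α.1.1) (pt α.1.2) := by
  obtain ⟨h2, h3⟩ := hγ
  simp only [Carries, mirror]; omega

/-- For `α` of height one: the orientation condition on the union of `α` and its neighbour. -/
theorem orientation_iff (hx : x = pt α.1.1 ∨ x = pt α.1.2) (hα : α.height = 1)
    (hγ : Mirrors (2 * x) α γ) {p s : ℕ} {χ : ℤ → ℤ}
    (hχ : Special (pt α.1.1) (pt α.1.2) χ)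
    (h : D.motion.Pth (pt α.1.1) (pt α.1.2) (p + s) χ (mirror c))
    (hp : D.Iter p α γ) :
    (∃ δ η : PosRoot ℓ, δ.vec = α.vec + γ.vec ∧ D.Iter s δ η ∧ D.Preserves s δ η) ↔
      D.motion.Pth (pt α.1.1) (pt α.1.2) s (mirror (2 * x)) (mirror c) := by
  have h0 := α.pt_lt_pt
  have h1 := coe_height α
  rw [hα] at h1
  have hγ1 := carries_mirror hγ
  have hγ0 := γ.pt_lt_pt
  have hγ' := hγ
  obtain ⟨hγ2, hγ3⟩ := hγ'
  constructor
  · rintro ⟨δ, η, hδ, hη, hpr⟩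
    obtain ⟨hδ1, hδ2⟩ := (vec_add_iff hx hα hγ δ).1 hδ
    have hδh := coe_height δ
    obtain ⟨τ, h2, h3⟩ := D.iter_iff.1 hη
    rw [D.preserves_iff h2 h3] at hpr
    have h4 : τ (pt δ.1.1) = pt η.1.1 := hpr.resolve_right (by omega)
    have h5 : τ (pt δ.1.2) = pt η.1.2 := by
      rcases h3 with h3 | h3
      · exact h3.2
      · have := (h2.rigid_right (by omega)).injective (h4.trans h3.2.symm); omega
    have hη0 := η.pt_lt_pt
    obtain ⟨d, hd⟩ : ∃ d, ∀ y, τ y = d + y := by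
      rcases h2.rigid_right (by omega) with hd | ⟨d, hd⟩
      · exact hd
      · rw [hd] at h4 h5; omega
    have h6 : D.motion.Pth (pt γ.1.1) (pt γ.1.2) s id τ := h2.mono (by omega) (by omega)
    have h7 := h6.comp_right (rigid_mirror (2 * x)) hγ1.1 hγ0
    rw [Function.id_comp] at h7
    obtain ⟨a, h8, h9⟩ := h.split h0
    obtain ⟨χ', h10, h11⟩ := (D.iter_mirror_iff hγ).1 hp
    have h12 : D.motion.Pth (pt α.1.1) (pt α.1.2) p χ (mirror (2 * x) ∘ χ' ∘ χ) := by
      have h13 := (h11.comp_right h10.rigid h10.carries h0).comp_right hχ.rigid hχ.carries h0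
      rwa [h10.comp_self, Function.id_comp] at h13
    obtain rfl := h8.det_right h12 ⟨le_rfl, h0⟩ ⟨le_rfl, h0⟩ (by simp)
    have e1 : ∀ e, τ ∘ mirror (2 * x) = mirror c ∘ mirror e → False := by
      intro e he
      have h14 := congrFun he 0
      have h15 := congrFun he 1
      simp only [Function.comp, hd, mirror] at h14 h15
      omega
    -- the motion met after `p` steps is the reflection at `x` if `T^p` and `T^(p+s)` start at the same
    -- special motion; otherwise it is a translation, which the path from `δ` to `η` excludes
    by_cases h16 : χ' = χ
    · subst h16
      rw [h10.comp_self, Function.comp_id] at h9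
      exact h9
    · exfalso
      have h17 : χ' ∘ χ = mirror (pt α.1.1 + pt α.1.2) := by
        rcases hχ with rfl | rfl <;> rcases h10 with rfl | rfl <;> first | rfl | exact absurd rfl h16
      have hs : Special (pt α.1.1) (pt α.1.2) (mirror (pt α.1.1 + pt α.1.2)) := Or.inr rfl
      rw [h17] at h9
      have h18 := h9.comp_right hs.rigid hs.carries h0
      rw [Function.comp_assoc, hs.comp_self, Function.comp_id] at h18
      exact e1 _ (h7.det_right h18 ⟨le_rfl, h0⟩ ⟨le_rfl, h0⟩ (by simp))
  · intro h2
    have h3 := h2.comp_right (rigid_mirror (2 * x)) hγ1.2 h0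
    rw [mirror_comp_mirror] at h3
    have h4 := D.pth_of_special h hχ
    rw [add_comm p s] at h4
    obtain ⟨θ, h5, -⟩ := h4.split h0
    -- the paths along `α` and along its neighbour run together on their union
    have h6 : D.motion.Pth (x - 1) (x + 1) s id (mirror c ∘ mirror (2 * x)) := by
      rcases hx with rfl | rfl
      · rw [show pt γ.1.1 = pt α.1.1 - 1 by omega, show pt γ.1.2 = pt α.1.1 by omega] at h3
        rw [show pt α.1.2 = pt α.1.1 + 1 by omega] at h5
        exact h3.union (by omega) (by omega) h5
      · rw [show pt γ.1.1 = pt α.1.2 by omega, show pt γ.1.2 = pt α.1.2 + 1 by omega] at h3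
        rw [show pt α.1.1 = pt α.1.2 - 1 by omega] at h5
        obtain rfl := h5.det_right h3 (e := pt α.1.2 - 1) (e' := pt α.1.2) (by omega) (by omega)
          (by simp)
        exact h5.union (by omega) (by omega) h3
    have r1 : (0 : ℤ) ≤ pt α.1.1 ∧ (0 : ℤ) ≤ pt γ.1.1 := by simp [pt]
    have r2 : pt α.1.2 ≤ (ℓ : ℤ) ∧ pt γ.1.2 ≤ (ℓ : ℤ) := by
      have := α.1.2.2; have := γ.1.2.2; simp only [pt]; omega
    obtain ⟨δ, h7, h8⟩ := PosRoot.exists_root (ℓ := ℓ) (a := x - 1) (b := x + 1) (by omega)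
      (by omega) (by omega)
    rw [← h7, ← h8] at h6
    obtain ⟨η, h9⟩ := D.exists_carries h6
    refine ⟨δ, η, (vec_add_iff hx hα hγ δ).2 ⟨h7, h8⟩, D.iter_iff.2 ⟨_, h6, h9⟩, ?_⟩
    rw [D.preserves_iff h6 h9]
    left
    have := η.pt_lt_pt
    have := δ.pt_lt_pt
    simp only [Carries, Function.comp, mirror] at h9 ⊢
    omega

/-- A pair is passed if the reflection at `x` is met on the way to the reflection of its block. -/
theorem passed_iff (hadj : AdjAt adj x α) (hc : Mirrors c α β)
    (hχ : Special (pt α.1.1) (pt α.1.2) χ)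
    (h : D.motion.Pth (pt α.1.1) (pt α.1.2) k χ (mirror c)) :
    D.Passed adj α β ↔ ∃ s, 0 < s ∧ s < k ∧
      D.motion.Pth (pt α.1.1) (pt α.1.2) s (mirror (2 * x)) (mirror c) := by
  classical
  have h0 := α.pt_lt_pt
  have h1 := coe_height α
  have key : ∀ p s γ, 0 < p → 0 < s → p + s = k → D.Iter p α γ → Mirrors (2 * x) α γ →
      (D.SameOrientation p k α γ β ↔
        D.motion.Pth (pt α.1.1) (pt α.1.2) s (mirror (2 * x)) (mirror c)) := by
    rintro p s γ hp hs rfl hpγ hγ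
    rw [SameOrientation]
    split_ifs with hh
    · obtain ⟨χ', h2, h3⟩ := (D.iter_mirror_iff hγ).1 hpγ
      rw [D.C_eq hc (by omega) hχ h, D.C_eq hγ hp h2 h3]
      have e : ((if χ = id ∧ 1 < α.height then 1 else 0) =
          if χ' = id ∧ 1 < α.height then 1 else 0) ↔ χ = χ' := by
        rcases hχ with rfl | rfl <;> rcases h2 with rfl | rfl <;>
          simp [hh, id_ne_mirror, (id_ne_mirror _).symm]
      rw [e]
      obtain ⟨a, h4, h5⟩ := h.split h0
      constructor
      · rintro rfl
        rwa [h4.det_right h3 ⟨le_rfl, h0⟩ ⟨le_rfl, h0⟩ (by simp)] at h5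
      · intro h6
        obtain rfl := h5.det_left h6 ⟨le_rfl, h0⟩ ⟨le_rfl, h0⟩ (by simp)
        exact (Special.det' h0 hχ h2 h4 h3).2
    · rw [Nat.add_sub_cancel_left]
      exact D.orientation_iff hadj.1 (by omega) hγ hχ h hpγ
  constructor
  · rintro ⟨p, k', γ, hp, hpk, h2, h3, h4, h5⟩
    obtain rfl := Iter.det D h4 ((D.iter_mirror_iff hc).2 ⟨χ, hχ, h⟩)
    exact ⟨k' - p, by omega, by omega,
      (key p (k' - p) γ hp (by omega) (by omega) h2 ((hadj.2 γ).1 h3)).1 h5⟩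
  · rintro ⟨s, hs, hsk, h2⟩
    obtain ⟨p, rfl⟩ := Nat.exists_eq_add_of_le' hsk.le
    obtain ⟨a, h3, h4⟩ := h.split h0
    obtain rfl := h4.det_left h2 ⟨le_rfl, h0⟩ ⟨le_rfl, h0⟩ (by simp)
    obtain ⟨γ, hγ⟩ := D.exists_carries (D.pth_of_special h3 hχ)
    have hγ0 := γ.pt_lt_pt
    have hγ' : Mirrors (2 * x) α γ := by
      rcases hχ with rfl | rfl <;> simp only [Carries, mirror, Function.comp, id, Mirrors] at * <;>
        omega
    have h5 := (D.iter_mirror_iff hγ').2 ⟨χ, hχ, h3⟩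
    exact ⟨p, p + s, γ, by omega, by omega, h5, (hadj.2 γ).2 hγ',
      (D.iter_mirror_iff hc).2 ⟨χ, hχ, h⟩, (key p s γ (by omega) hs rfl h5 hγ').2 h2⟩

/-- The last motion of the path is the reflection at `x` exactly if `β` is the neighbour of `α` at `x`. -/
theorem halfPassed_iff (hadj : AdjAt adj x α) (hc : Mirrors c α β) (hk : 0 < k)
    (hχ : Special (pt α.1.1) (pt α.1.2) χ)
    (h : D.motion.Pth (pt α.1.1) (pt α.1.2) k χ (mirror c)) :
    D.HalfPassed adj α β ↔ mirror c = mirror (2 * x) := by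
  constructor
  · rintro ⟨-, -, -, h2⟩
    have h3 := (hadj.2 β).1 h2
    rw [← hc.1, ← h3.1]
  · intro h1
    have h2 := mirror_inj h1
    exact ⟨k, hk, (D.iter_mirror_iff hc).2 ⟨χ, hχ, h⟩, (hadj.2 β).2 (h2 ▸ hc)⟩

/-- The passing statistics count the passages through the reflection at an end of the interval, the
last one with weight one half. -/
theorem passing_eq (hadj : AdjAt adj x α) (hc : Mirrors c α β) (hk : 0 < k)
    (hχ : Special (pt α.1.1) (pt α.1.2) χ)
    (h : D.motion.Pth (pt α.1.1) (pt α.1.2) k χ (mirror c)) :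
    D.passing adj α β = (D.motion.passBefore (pt α.1.1) (pt α.1.2) x k (mirror c) : ℂ) +
      1 / 2 * (atPt (mirror c) x : ℂ) := by
  classical
  have h0 := α.pt_lt_pt
  have loop : ∀ t, D.motion.Pth (pt α.1.1) (pt α.1.2) t (mirror (2 * x)) (mirror (2 * x)) →
      t = 0 := fun t ht => ht.eq_zero_of_loop h0 rigid_id (γ := id) (Or.inl ⟨rfl, rfl⟩)
  have det : ∀ s t, D.motion.Pth (pt α.1.1) (pt α.1.2) s (mirror (2 * x)) (mirror c) →
      D.motion.Pth (pt α.1.1) (pt α.1.2) t (mirror (2 * x)) (mirror c) → s ≤ t → s = t := by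
    intro s t hs ht hst
    obtain ⟨d, rfl⟩ := Nat.exists_eq_add_of_le' hst
    obtain ⟨a, h1, h2⟩ := ht.split h0
    obtain rfl := h2.det_left hs ⟨le_rfl, h0⟩ ⟨le_rfl, h0⟩ (by simp)
    have := loop d h1; omega
  -- by nilpotency the reflection at `x` is met at most once
  rw [passing]
  simp only [D.passed_iff hadj hc hχ h, D.halfPassed_iff hadj hc hk hχ h]
  by_cases hP : ∃ s, 0 < s ∧ s < k ∧
      D.motion.Pth (pt α.1.1) (pt α.1.2) s (mirror (2 * x)) (mirror c)
  · obtain ⟨s, hs, hsk, h1⟩ := hP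
    rw [if_pos ⟨s, hs, hsk, h1⟩, passBefore, Finset.sum_eq_single (s - 1), Nat.sub_add_cancel hs,
      if_pos h1, atPt, if_neg]
    · simp
    · intro h2
      rw [h2] at h1
      have := loop s h1; omega
    · intro t _ ht
      rw [if_neg]
      intro h2
      rcases le_total s (t + 1) with h3 | h3
      · have := det _ _ h1 h2 h3; omega
      · have := det _ _ h2 h1 h3; omega
    · intro h2; rw [Finset.mem_range] at h2; omega
  · rw [if_neg hP, passBefore, Finset.sum_eq_zero, atPt]
    · split_ifs <;> simp
    · intro s hs
      rw [if_neg]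
      intro h1
      rw [Finset.mem_range] at hs
      rcases Nat.lt_or_ge (s + 1) k with h2 | h2
      · exact hP ⟨s + 1, by omega, h2, h1⟩
      · obtain rfl : s + 1 = k := by omega
        exact hχ.ne_mirror h0 hadj.1 (h.det_left h1 ⟨le_rfl, h0⟩ ⟨le_rfl, h0⟩ (by simp))

end BDTriple

end GGS

namespace GGS

/-! ### The flip of a block -/

namespace Motion

variable {ℓ : ℕ} {M : Motion ℓ} {q : ℂ} {i j : ℤ} {φ ψ χ : ℤ → ℤ}

theorem low0_inv (hχ : Special i j χ) : low0 q⁻¹ i j χ = -low0' q i j χ := by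
  simp only [low0, low0']
  rcases hχ with rfl | rfl
  · rw [if_pos rfl, if_pos rfl, inv_inv, neg_inv, inv_zpow', neg_neg]; ring
  · rw [if_neg (id_ne_mirror _).symm, if_neg (id_ne_mirror _).symm, if_pos rfl,
      inv_inv]; ring

/-- Inverting `q` in an upper entry of the block of a reflection gives the lower entry in the
reflected position. -/
theorem Rb_flip (hq : q ≠ 0) {c : ℤ} {x y x' y' : Fin (ℓ + 1)} (hxy : x < y)
    (hx : pt x + pt x' = c) (hy : pt y + pt y' = c) :
    g q (mirror c) (pt x) * M.Rb q (mirror c) x' y' =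
      g q (mirror c) (pt y) * M.Rb q⁻¹ (mirror c) x y +
        (q - q⁻¹) * if pt x + pt y = c then 1 else 0 := by
  classical
  have hq' := inv_ne_zero hq
  have hxy0 := pt_lt.2 hxy
  have hyx : y' < x' := pt_lt.1 (by omega)
  have hyx0 := pt_lt.2 hyx
  have e1 : c - pt x' = pt x := by omega
  have e2 : c - pt y' = pt y := by omega
  by_cases hc : pt x + pt y = c
  · have hs : Special (pt x) (pt y) (mirror c) := Or.inr (by rw [hc])
    have hs' : Special (pt y') (pt x') (mirror c) := Or.inr (by congr 1; omega)
    have h0 : M.Pth (pt x) (pt y) 0 (mirror c) (mirror c) := ⟨rigid_mirror _, rfl⟩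
    have e : atPt (mirror c) (pt x) = 0 := if_neg (hs.ne_mirror hxy0 (Or.inl rfl))
    rw [Rb_lower_zero hq hyx (rigid_mirror _) fun k χ hχ h =>
        Nat.succ_ne_zero k (hχ.eq_zero hyx0 hs' h),
      Rb_upper hq' hxy hs h0, g_of_special hxy0 hs (Or.inr rfl), if_pos hc, e, low0,
      if_neg (id_ne_mirror _).symm, if_pos (by rw [hc])]
    simp [passAfter]
  rw [if_neg hc, mul_zero, add_zero]
  by_cases hex : ∃ k χ, Special (pt y') (pt x') χ ∧ M.Pth (pt y') (pt x') k χ (mirror c)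
  · obtain ⟨k, χ, h1, h2⟩ := hex
    have hk : k ≠ 0 := by
      rintro rfl
      rcases h1 with rfl | rfl
      · exact id_ne_mirror _ h2.2
      · have := mirror_inj h2.2; omega
    have h3 := h2.reflect hyx0 h1
    have h4 := h1.reflect (q := q) (c := c)
    rw [e1, e2] at h3 h4
    rw [Rb_lower hq hyx hk h1 h2, Rb_upper hq' hxy h4.1 h3, low0_inv h4.1, h4.2.2,
      passBefore_mirror hyx0 h1 h2 (Or.inl rfl), passBefore_mirror hyx0 h1 h2 (Or.inr rfl), e1, e2,
      g_eq_zpow, g_eq_zpow, inv_zpow', neg_neg]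
    have e3 : atPt (mirror c) (pt y') = atPt (mirror c) (pt y) := by
      simp only [atPt]
      refine if_congr ⟨fun h => ?_, fun h => ?_⟩ rfl rfl <;>
        (have := mirror_inj h; congr 1; omega)
    rw [e3, mul_neg, mul_left_comm, ← zpow_add₀ hq, neg_mul, mul_neg, mul_left_comm,
      ← zpow_add₀ hq]
    congr 3; ring
  · rw [Rb_lower_zero hq hyx (rigid_mirror _) fun k χ hχ h => hex ⟨_, χ, hχ, h⟩,
      Rb_upper_zero hq' hxy (rigid_mirror _), mul_zero, mul_zero]
    intro k χ hχ h
    rw [← e1, ← e2] at hχ h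
    obtain ⟨χ', h1, h2⟩ := h.reflect' hyx0 hχ
    exact hex ⟨k, χ', h1, h2⟩

end Motion

/-! ### Assembling matrices on `ℂⁿ ⊗ ℂⁿ` from their blocks -/

section Assemble

variable {ℓ : ℕ} {A B : ℤ → Matrix (Fin (ℓ + 1)) (Fin (ℓ + 1)) ℂ}

/-- The sum of the two indices, which is preserved by all the matrices considered. -/
abbrev tot (u : Fin (ℓ + 1) × Fin (ℓ + 1)) : ℤ := pt u.1 + pt u.2

/-- The second indices which occur in the block of total `c`. -/
def box (c : ℤ) : Set (Fin (ℓ + 1)) := {x | 0 ≤ c - pt x ∧ c - pt x ≤ ℓ}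

/-- The matrix on `ℂⁿ ⊗ ℂⁿ` whose block of total `c`, in terms of the second indices, is the
restriction of `A c` to `box c`. -/
def asm (A : ℤ → Matrix (Fin (ℓ + 1)) (Fin (ℓ + 1)) ℂ) : Mat2 ℓ :=
  fun u v => if tot u = tot v then A (tot u) u.2 v.2 else 0

theorem mem_box (u : Fin (ℓ + 1) × Fin (ℓ + 1)) : u.2 ∈ box (tot u) := by
  have := u.1.2
  simp only [box, tot, pt, Set.mem_ofPred_eq]; omega

theorem tot_ext {u v : Fin (ℓ + 1) × Fin (ℓ + 1)} (h : tot u = tot v) (h' : u.2 = v.2) : u = v := by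
  refine Prod.ext ?_ h'
  rw [tot, tot, h'] at h
  exact pt_inj.1 (by omega)

/-- Assembly is multiplicative if the left factors do not lead out of the boxes. -/
theorem asm_mul (hA : ∀ c, Blk (box c) (A c)) : asm A * asm B = asm fun c => A c * B c := by
  ext u v
  rw [Matrix.mul_apply]
  simp only [asm]
  split_ifs with huv
  · rw [Matrix.mul_apply]
    refine Finset.sum_bij_ne_zero (fun w _ _ => w.2) (fun _ _ _ => Finset.mem_univ _) ?_ ?_ ?_
    · intro w _ hw w' _ hw' h
      have h1 : tot u = tot w := by
        by_contra hne; rw [if_neg hne, zero_mul] at hw; exact hw rfl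
      have h2 : tot u = tot w' := by
        by_contra hne; rw [if_neg hne, zero_mul] at hw'; exact hw' rfl
      exact tot_ext (h1.symm.trans h2) h
    · intro x _ hx
      have h1 : x ∈ box (tot u) :=
        ((hA (tot u)) _ _ (left_ne_zero_of_mul hx)).1 (mem_box u)
      obtain ⟨b, hb⟩ := Motion.exists_pt h1.1 h1.2
      have e : tot (b, x) = tot u := by simp only [tot] at hb ⊢; omega
      refine ⟨(b, x), Finset.mem_univ _, ?_, rfl⟩
      rw [e, if_pos rfl, if_pos huv]
      exact hx
    · intro w _ hw
      have h1 : tot u = tot w := by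
        by_contra hne; rw [if_neg hne, zero_mul] at hw; exact hw rfl
      rw [if_pos h1, ← h1, if_pos huv]
  · refine Finset.sum_eq_zero fun w _ => ?_
    by_cases h1 : tot u = tot w
    · rw [← h1, if_neg huv, mul_zero]
    · rw [if_neg h1, zero_mul]

theorem asm_one : asm (fun _ => 1) = (1 : Mat2 ℓ) := by
  ext u v
  simp only [asm, Matrix.one_apply]
  by_cases h : u = v
  · simp [h]
  · rw [if_neg h]
    split_ifs with h1 h2
    · exact absurd (tot_ext h1 h2) h
    · rfl
    · rfl

theorem asm_list_prod {f : ℕ → ℤ → Matrix (Fin (ℓ + 1)) (Fin (ℓ + 1)) ℂ}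
    (h : ∀ k c, Blk (box c) (f k c)) (l : List ℕ) :
    (l.map fun k => asm (f k)).prod = asm fun c => (l.map fun k => f k c).prod := by
  induction l with
  | nil => simp [asm_one]
  | cons a l ih => simp only [List.map_cons, List.prod_cons, ih, asm_mul (h a)]

theorem asm_inv (hA : ∀ c, Blk (box c) (A c)) (hu : ∀ c, IsUnit (A c).det) :
    (asm A)⁻¹ = asm fun c => (A c)⁻¹ := by
  refine Matrix.inv_eq_right_inv ?_
  rw [asm_mul hA, ← asm_one]
  congr 1; ext1 c
  exact Matrix.mul_nonsing_inv _ (hu c)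

theorem flip_mul (X Y : Mat2 ℓ) : flip (X * Y) = flip X * flip Y :=
  (Matrix.submatrix_mul_equiv X Y Prod.swap (Equiv.prodComm _ _) Prod.swap).symm

theorem flip_one : flip (1 : Mat2 ℓ) = 1 := Matrix.submatrix_one_equiv (Equiv.prodComm _ _)

theorem flip_list_prod (l : List (Mat2 ℓ)) : flip l.prod = (l.map flip).prod := by
  induction l with
  | nil => simp [flip_one]
  | cons a l ih => simp [flip_mul, ih]

theorem flip_apply (X : Mat2 ℓ) (u v : Fin (ℓ + 1) × Fin (ℓ + 1)) :
    flip X u v = X u.swap v.swap := rfl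

/-- The flip of `ℂⁿ ⊗ ℂⁿ`. -/
def flipMat (ℓ : ℕ) : Mat2 ℓ := fun u v => if u.swap = v then 1 else 0

theorem flipMat_mul_apply (X : Mat2 ℓ) (u v : Fin (ℓ + 1) × Fin (ℓ + 1)) :
    (flipMat ℓ * X) u v = X u.swap v := by
  rw [Matrix.mul_apply, Finset.sum_eq_single u.swap]
  · simp [flipMat]
  · intro w _ hw; rw [flipMat, if_neg (Ne.symm hw), zero_mul]
  · simp

theorem mul_flipMat_apply (X : Mat2 ℓ) (u v : Fin (ℓ + 1) × Fin (ℓ + 1)) :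
    (X * flipMat ℓ) u v = X u v.swap := by
  rw [Matrix.mul_apply, Finset.sum_eq_single v.swap]
  · simp [flipMat]
  · intro w _ hw
    rw [flipMat, if_neg, mul_zero]
    rintro rfl; simp at hw
  · simp

theorem flip_mul_flipMat (X : Mat2 ℓ) : flip X * flipMat ℓ = flipMat ℓ * X := by
  ext u v
  rw [mul_flipMat_apply, flipMat_mul_apply, flip_apply, Prod.swap_swap]

theorem tot_swap (u : Fin (ℓ + 1) × Fin (ℓ + 1)) : tot u.swap = tot u := add_comm _ _

/-- In the block of `c` the flip replaces the second indices by the first ones. -/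
theorem flip_asm (h : ∀ u v : Fin (ℓ + 1) × Fin (ℓ + 1), tot u = tot v →
    A (tot u) u.1 v.1 = B (tot u) u.2 v.2) : flip (asm A) = asm B := by
  ext u v
  simp only [flip_apply, asm, tot_swap, Prod.snd_swap]
  split_ifs with huv
  · exact h u v huv
  · rfl

end Assemble

end GGS

namespace GGS

open Motion

variable {ℓ : ℕ}

/-! ### The coefficients of sums of matrix units -/

theorem E_apply (i j k l : Fin (ℓ + 1)) (u v : Fin (ℓ + 1) × Fin (ℓ + 1)) :
    E i j k l u v = if u = (i, k) ∧ v = (j, l) then 1 else 0 := by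
  simp only [E, Matrix.kroneckerMap_apply, Matrix.single_apply, Prod.ext_iff, ← ite_and, mul_ite,
    mul_one, mul_zero]
  refine if_congr ?_ rfl rfl
  constructor
  · rintro ⟨⟨rfl, rfl⟩, rfl, rfl⟩; simp
  · rintro ⟨⟨h1, h2⟩, h3, h4⟩; simp [h1, h2, h3, h4]

theorem sum_E_diag (f : Fin (ℓ + 1) → Fin (ℓ + 1) → ℂ) :
    ∑ i, ∑ j, f i j • E i i j j = Matrix.diagonal fun p => f p.1 p.2 := by
  ext u v
  simp only [Matrix.sum_apply, Matrix.smul_apply, E_apply, smul_eq_mul]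
  rw [Finset.sum_eq_single u.1, Finset.sum_eq_single u.2]
  · rw [Matrix.diagonal_apply]
    by_cases h : u = v
    · subst h; simp
    · rw [if_neg h, if_neg, mul_zero]
      rintro ⟨-, h'⟩; exact h h'.symm
  · intro b _ hb
    rw [if_neg, mul_zero]
    rintro ⟨h, -⟩; exact hb (congrArg Prod.snd h).symm
  · simp
  · intro b _ hb
    refine Finset.sum_eq_zero fun j _ => ?_
    rw [if_neg, mul_zero]
    rintro ⟨h, -⟩; exact hb (congrArg Prod.fst h).symm
  · simp

theorem sum_E_diag_same : ∑ i : Fin (ℓ + 1), E i i i i =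
    Matrix.diagonal fun p => if p.1 = p.2 then 1 else 0 := by
  rw [← sum_E_diag fun i j => if i = j then 1 else 0]
  refine Finset.sum_congr rfl fun i _ => ?_
  simp

theorem sum_ePosNeg (f : PosRoot ℓ → PosRoot ℓ → ℂ) (u v : Fin (ℓ + 1) × Fin (ℓ + 1)) :
    (∑ α : PosRoot ℓ, ∑ β : PosRoot ℓ, f α β • ePosNeg β α) u v =
      if h : v.2 < u.2 ∧ u.1 < v.1 then f ⟨(v.2, u.2), h.1⟩ ⟨(u.1, v.1), h.2⟩ else 0 := by
  simp only [Matrix.sum_apply, Matrix.smul_apply, ePosNeg, E_apply, smul_eq_mul]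
  split_ifs with h
  · rw [Finset.sum_eq_single ⟨(v.2, u.2), h.1⟩, Finset.sum_eq_single ⟨(u.1, v.1), h.2⟩]
    · simp
    · intro β _ hβ
      rw [if_neg, mul_zero]
      rintro ⟨h1, h2⟩
      refine hβ (Subtype.ext (Prod.ext ?_ ?_))
      exacts [(congrArg Prod.fst h1).symm, (congrArg Prod.fst h2).symm]
    · simp
    · intro α _ hα
      refine Finset.sum_eq_zero fun β _ => ?_
      rw [if_neg, mul_zero]
      rintro ⟨h1, h2⟩
      refine hα (Subtype.ext (Prod.ext ?_ ?_))
      exacts [(congrArg Prod.snd h2).symm, (congrArg Prod.snd h1).symm]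
    · simp
  · refine Finset.sum_eq_zero fun α _ => Finset.sum_eq_zero fun β _ => ?_
    rw [if_neg, mul_zero]
    rintro ⟨rfl, rfl⟩
    exact h ⟨α.2, β.2⟩

theorem sum_eNegPos (f : PosRoot ℓ → PosRoot ℓ → ℂ) (u v : Fin (ℓ + 1) × Fin (ℓ + 1)) :
    (∑ α : PosRoot ℓ, ∑ β : PosRoot ℓ, f α β • eNegPos α β) u v =
      if h : v.1 < u.1 ∧ u.2 < v.2 then f ⟨(v.1, u.1), h.1⟩ ⟨(u.2, v.2), h.2⟩ else 0 := by
  have e : ∀ α β : PosRoot ℓ, eNegPos α β u v = ePosNeg β α u.swap v.swap := by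
    intro α β
    simp only [eNegPos, ePosNeg, E_apply]
    refine if_congr ?_ rfl rfl
    simp [Prod.ext_iff, and_comm]
  have h := sum_ePosNeg f u.swap v.swap
  simp only [Matrix.sum_apply, Matrix.smul_apply, ← e] at h ⊢
  rw [h]
  rfl

/-- The standard `R`-matrix, block by block. -/
theorem Rst_eq (q : ℂ) : Rst ℓ q = asm fun c => Bt0 q (mirror c) := by
  have e1 : ∑ i : Fin (ℓ + 1), ∑ j : Fin (ℓ + 1), (if i ≠ j then E i i j j else 0) =
      Matrix.diagonal fun p : Fin (ℓ + 1) × Fin (ℓ + 1) => if p.1 ≠ p.2 then 1 else 0 := by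
    rw [← sum_E_diag fun i j => if i ≠ j then 1 else 0]
    refine Finset.sum_congr rfl fun i _ => Finset.sum_congr rfl fun j _ => ?_
    split_ifs <;> simp
  rw [Rst, sum_E_diag_same, e1]
  ext u v
  have e2 : (∑ i : Fin (ℓ + 1), ∑ j : Fin (ℓ + 1), (if j < i then E i j j i else 0)) u v =
      if u.2 < v.2 ∧ u.swap = v then 1 else 0 := by
    simp only [Matrix.sum_apply]
    rw [Finset.sum_eq_single u.1, Finset.sum_eq_single u.2]
    · by_cases h : u.2 < u.1
      · rw [if_pos h, E_apply]
        refine if_congr ⟨?_, ?_⟩ rfl rfl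
        · rintro ⟨-, rfl⟩; exact ⟨h, rfl⟩
        · rintro ⟨-, rfl⟩; exact ⟨rfl, rfl⟩
      · rw [if_neg h, if_neg]
        · rfl
        · rintro ⟨h', rfl⟩; exact h h'
    · intro b _ hb
      split_ifs
      · rw [E_apply, if_neg]
        rintro ⟨h, -⟩; exact hb (congrArg Prod.snd h).symm
      · rfl
    · simp
    · intro b _ hb
      refine Finset.sum_eq_zero fun j _ => ?_
      split_ifs
      · rw [E_apply, if_neg]
        rintro ⟨h, -⟩; exact hb (congrArg Prod.fst h).symm
      · rfl
    · simp
  rw [Matrix.add_apply, Matrix.add_apply, Matrix.smul_apply, Matrix.smul_apply, e2, asm]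
  simp only [smul_eq_mul, Matrix.diagonal_apply]
  by_cases huv : u = v
  · subst huv
    simp only [if_true, lt_irrefl, false_and, if_false, Bt0, Qm, Matrix.add_apply,
      Matrix.diagonal_apply_eq, upperMat, g, add_zero, mul_zero]
    have : mirror (tot u) = mirror (2 * pt u.2) ↔ u.1 = u.2 := by
      rw [← pt_inj]
      constructor
      · intro h; have := mirror_inj h; simp only [tot] at this; omega
      · intro h; congr 1; simp only [tot]; omega
    simp only [this]
    split_ifs <;> simp_all
  · rw [if_neg huv, if_neg huv, mul_zero, zero_add, zero_add]
    by_cases ht : tot u = tot v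
    · have h2 : u.2 ≠ v.2 := fun h => huv (tot_ext ht h)
      have hs : u.swap = v ↔ tot u = pt u.2 + pt v.2 := by
        constructor
        · rintro rfl; simp only [tot, Prod.snd_swap]; omega
        · intro h
          simp only [tot] at h ht
          exact Prod.ext (pt_inj.1 (show pt u.2 = pt v.1 by omega))
            (pt_inj.1 (show pt u.1 = pt v.2 by omega))
      rw [if_pos ht, Bt0, Matrix.add_apply, Qm, Matrix.diagonal_apply_ne _ h2, zero_add, upperMat]
      by_cases h3 : u.2 < v.2
      · rw [if_pos h3, low0, if_neg (id_ne_mirror _).symm]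
        have : mirror (tot u) = mirror (pt u.2 + pt v.2) ↔ tot u = pt u.2 + pt v.2 :=
          ⟨fun h => mirror_inj h, fun h => by rw [h]⟩
        simp only [this, hs, h3, true_and]
      · simp [h3]
    · rw [if_neg ht, if_neg, mul_zero]
      rintro ⟨-, rfl⟩
      exact ht (tot_swap u).symm

theorem cartan_eq (s : Matrix (Fin (ℓ + 1)) (Fin (ℓ + 1)) ℂ) :
    cartan s = Matrix.diagonal fun p => s p.1 p.2 := sum_E_diag _

theorem qpow_add (h a b : ℂ) : qpow h (a + b) = qpow h a * qpow h b := by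
  rw [qpow, add_mul, Complex.exp_add]; rfl

theorem qpow_zero (h : ℂ) : qpow h 0 = 1 := by simp [qpow]

theorem qpow_int (h : ℂ) (n : ℤ) : qpow h n = Complex.exp h ^ n := Complex.exp_int_mul h n

/-- The diagonal matrix which accounts for the weight one half of the last passage. -/
noncomputable def Gm (h : ℂ) (c : ℤ) (t : ℂ) : Matrix (Fin (ℓ + 1)) (Fin (ℓ + 1)) ℂ :=
  Matrix.diagonal fun x => qpow h (t * (atPt (mirror c) (pt x) : ℂ))

theorem Gm_mul (h : ℂ) (c : ℤ) (s t : ℂ) :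
    (Gm h c s * Gm h c t : Matrix (Fin (ℓ + 1)) (Fin (ℓ + 1)) ℂ) = Gm h c (s + t) := by
  rw [Gm, Gm, Gm, Matrix.diagonal_mul_diagonal]
  congr 1; ext x
  rw [← qpow_add, add_mul]

theorem Gm_zero (h : ℂ) (c : ℤ) : (Gm h c 0 : Matrix (Fin (ℓ + 1)) (Fin (ℓ + 1)) ℂ) = 1 := by
  simp [Gm, qpow_zero]

theorem blk_Gm {N : Set (Fin (ℓ + 1))} (h : ℂ) (c : ℤ) (t : ℂ) : Blk N (Gm h c t) :=
  Blk.diagonal _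

theorem atPt_mirror {c a b : ℤ} (h : a + b = c) : atPt (mirror c) a = atPt (mirror c) b := by
  classical
  simp only [atPt]
  refine if_congr ⟨fun h => ?_, fun h => ?_⟩ rfl rfl <;>
    (have := mirror_inj h; congr 1; omega)

namespace BDTriple

variable (D : BDTriple ℓ)

/-! ### The twist and the matrix `R_J`, block by block -/

theorem blk_fac (q : ℂ) (k : ℕ) (c : ℤ) : Blk (box c) (D.motion.fac q (mirror c) (k + 1)) := by
  refine Blk.one_add_lowerMat fun x y hxy hne => ?_
  have hxy' := pt_lt.2 hxy
  have h1 := range_of_low_ne_zero hne (e := pt x) le_rfl hxy'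
  have h2 := range_of_low_ne_zero hne (e := pt y - 1) (by omega) (by omega)
  rw [edge_mirror] at h1 h2
  simp only [box, Set.mem_ofPred_eq]; omega

theorem blk_fac' (q : ℂ) (k : ℕ) (c : ℤ) : Blk (box c) (D.motion.fac' q (mirror c) (k + 1)) := by
  refine Blk.one_add_upperMat fun x y hxy hne => ?_
  have hxy' := pt_lt.2 hxy
  have h1 := range_of_up_ne_zero hne (e := pt x) le_rfl hxy'
  have h2 := range_of_up_ne_zero hne (e := pt y - 1) (by omega) (by omega)
  rw [edge_mirror] at h1 h2
  simp only [box, Set.mem_ofPred_eq]; omega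

theorem blk_Bt0 (q : ℂ) (c : ℤ) : Blk (box c) (Bt0 q (mirror c) :
    Matrix (Fin (ℓ + 1)) (Fin (ℓ + 1)) ℂ) := by
  refine Blk.add (Blk.diagonal _) fun x y h => ?_
  rw [upperMat] at h
  split_ifs at h with hxy
  · by_cases hs : Special (pt x) (pt y) (mirror c)
    · have h1 := mirror_inj (hs.resolve_left (id_ne_mirror _).symm)
      have := x.2; have := y.2
      simp only [box, Set.mem_ofPred_eq, pt] at *; omega
    · exact absurd (low0_of_not_special hs) h
  · exact absurd rfl h

open Classical in
/-- The coefficients of the twist in terms of the motions. -/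
theorem twist_coeff (h : ℂ) (k : ℕ) {c : ℤ} {α β : PosRoot ℓ} (hc : Mirrors c α β) :
    (if D.Iter (k + 1) α β then
      ((-Complex.exp h) ^ (-((D.C α β * (α.height - 1) : ℕ) : ℤ)) * qpow h (D.Pa α β) *
        (Complex.exp h - (Complex.exp h)⁻¹)) else 0) =
      qpow h (1 / 2 * (atPt (mirror c) (pt α.1.2) : ℂ)) *
        D.motion.low (Complex.exp h) (pt α.1.1) (pt α.1.2) (k + 1) (mirror c) *
        qpow h (-(1 / 2) * (atPt (mirror c) (pt α.1.1) : ℂ)) := by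
  have hq := Complex.exp_ne_zero h
  have h0 := α.pt_lt_pt
  by_cases hI : D.Iter (k + 1) α β
  · rw [if_pos hI]
    obtain ⟨χ, hχ, hp⟩ := (D.iter_mirror_iff hc).1 hI
    have hh := coe_height α
    rw [D.C_mul hc (Nat.succ_pos k) hχ hp, Pa, D.passing_eq (adjAt_right _) hc (Nat.succ_pos k) hχ hp,
      D.passing_eq (adjAt_left _) hc (Nat.succ_pos k) hχ hp, low_eq hq h0 hp, ← qpow_int]
    have e2 : (-Complex.exp h) ^ (-(((if χ = id then α.height - 1 else 0 : ℕ) : ℕ) : ℤ)) *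
        (Complex.exp h - (Complex.exp h)⁻¹) =
          low0 (Complex.exp h) (pt α.1.1) (pt α.1.2) χ := by
      rw [low0, mul_comm]
      congr 1
      split_ifs with h5 h6
      · congr 1
        omega
      · simp
      · exact absurd hχ (by simp [Special, h5, h6])
    rw [← e2, show ∀ a b c d e : ℂ, a * (b * c * d) * e = b * c * (a * d * e) by intros; ring,
      ← qpow_add, ← qpow_add, mul_right_comm]
    congr 2
    push_cast; ring
  · rw [if_neg hI]
    have : D.motion.low (Complex.exp h) (pt α.1.1) (pt α.1.2) (k + 1) (mirror c) = 0 := by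
      by_contra hne
      obtain ⟨χ, h5, h6⟩ := exists_pth_of_low_ne_zero h0 hne
      exact hI ((D.iter_mirror_iff hc).2 ⟨χ, h5, h6⟩)
    rw [this, mul_zero, zero_mul]

/-- The factors of the twist, block by block. -/
theorem Jk_eq (h : ℂ) (k : ℕ) : D.Jk h (k + 1) = asm fun c =>
    Gm h c (1 / 2) * D.motion.fac (Complex.exp h) (mirror c) (k + 1) * Gm h c (-(1 / 2)) := by
  classical
  have e1 : ∀ α β : PosRoot ℓ, (if D.Iter (k + 1) α β then
      ((-Complex.exp h) ^ (-((D.C α β * (α.height - 1) : ℕ) : ℤ)) * qpow h (D.Pa α β) *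
        (Complex.exp h - (Complex.exp h)⁻¹)) • ePosNeg β α else 0) =
      (if D.Iter (k + 1) α β then
      ((-Complex.exp h) ^ (-((D.C α β * (α.height - 1) : ℕ) : ℤ)) * qpow h (D.Pa α β) *
        (Complex.exp h - (Complex.exp h)⁻¹)) else 0) • ePosNeg β α := by
    intro α β; split_ifs <;> simp
  ext u v
  rw [Jk]
  simp only [e1]
  rw [Matrix.add_apply, sum_ePosNeg, asm]
  rw [Gm, Gm, Matrix.mul_diagonal, Matrix.diagonal_mul, fac, Matrix.add_apply, lowerMat]
  by_cases huv : u = v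
  · subst huv
    simp [← qpow_add, qpow_zero]
  rw [Matrix.one_apply_ne huv, zero_add]
  by_cases ht : tot u = tot v
  swap
  · rw [if_neg ht]
    split_ifs with h1 h2
    · have := Iter.sum_eq D h2
      simp only [tot] at ht
      simp only at this
      exact absurd (by omega) ht
    · rfl
    · rfl
  have h2 : u.2 ≠ v.2 := fun h => huv (tot_ext ht h)
  rw [if_pos ht, Matrix.one_apply_ne h2, zero_add]
  by_cases h3 : v.2 < u.2
  swap
  · rw [dif_neg (fun h => h3 h.1), if_neg h3, mul_zero, zero_mul]
  have h30 := pt_lt.2 h3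
  have h4 : u.1 < v.1 := pt_lt.1 (by simp only [tot] at ht; omega)
  rw [dif_pos ⟨h3, h4⟩, if_pos h3]
  have hc : Mirrors (tot u) (⟨(v.2, u.2), h3⟩ : PosRoot ℓ) ⟨(u.1, v.1), h4⟩ := by
    simp only [Mirrors, tot] at *; omega
  exact D.twist_coeff h k hc

theorem flip_Jk_eq (h : ℂ) (k : ℕ) : flip (D.Jk h (k + 1)) = asm fun c =>
    Gm h c (1 / 2) * D.motion.fac' (Complex.exp h) (mirror c) (k + 1) * Gm h c (-(1 / 2)) := by
  have hq := Complex.exp_ne_zero h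
  rw [Jk_eq]
  refine flip_asm fun u v ht => ?_
  simp only [Gm, Matrix.mul_diagonal, Matrix.diagonal_mul, fac, fac', Matrix.add_apply, lowerMat,
    upperMat]
  have e1 : u.1 = v.1 ↔ u.2 = v.2 := by
    rw [← pt_inj, ← pt_inj]; simp only [tot] at ht; omega
  have e2 : v.1 < u.1 ↔ u.2 < v.2 := by
    rw [← pt_lt, ← pt_lt]; simp only [tot] at ht; omega
  rw [atPt_mirror (a := pt u.1) (b := pt u.2) rfl, atPt_mirror (a := pt v.1) (b := pt v.2) ht.symm]
  simp only [Matrix.one_apply, e1, e2]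
  congr 3
  split_ifs with h1
  · rw [← up_mirror hq (pt_lt.2 (e2.2 h1))]
    congr 1 <;> simp only [tot] at * <;> omega
  · rfl

theorem Jk_eq_one {h : ℂ} {k : ℕ} (hk : D.maxOrd < k) : D.Jk h k = 1 := by
  rw [Jk, add_eq_left]
  refine Finset.sum_eq_zero fun α _ => Finset.sum_eq_zero fun β _ => if_neg fun hI => ?_
  refine absurd hk (not_lt.2 (le_csSup ⟨D.motion.depth, ?_⟩ ⟨by omega, α, β, hI⟩))
  rintro n ⟨-, α, β, hn⟩
  obtain ⟨θ, h1, -⟩ := D.iter_iff.1 hn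
  exact (h1.lt_depth α.pt_lt_pt).le

theorem J_eq_prod (h : ℂ) : D.J h =
    ((List.range (max D.maxOrd D.motion.depth)).map fun k => D.Jk h (k + 1)).prod :=
  (prod_range_eq _ (fun _ hk => D.Jk_eq_one (by omega)) (le_max_left _ _)).symm

theorem conj_list_prod {n : ℕ} {P Q : Matrix (Fin n) (Fin n) ℂ} (hPQ : P * Q = 1)
    (hQP : Q * P = 1) (f : ℕ → Matrix (Fin n) (Fin n) ℂ) (l : List ℕ) :
    (l.map fun k => P * f k * Q).prod = P * (l.map f).prod * Q := by
  induction l with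
  | nil => simp [hPQ]
  | cons a l ih =>
    rw [List.map_cons, List.map_cons, List.prod_cons, List.prod_cons, ih]
    calc P * f a * Q * (P * (l.map f).prod * Q) = P * f a * (Q * P) * (l.map f).prod * Q := by
          simp only [mul_assoc]
      _ = _ := by rw [hQP, mul_one]; simp only [mul_assoc]

theorem Gm_half (h : ℂ) (c : ℤ) :
    (Gm h c (1 / 2) * Gm h c (-(1 / 2)) : Matrix (Fin (ℓ + 1)) (Fin (ℓ + 1)) ℂ) = 1 := by
  rw [Gm_mul, add_neg_cancel, Gm_zero]

theorem Gm_half' (h : ℂ) (c : ℤ) :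
    (Gm h c (-(1 / 2)) * Gm h c (1 / 2) : Matrix (Fin (ℓ + 1)) (Fin (ℓ + 1)) ℂ) = 1 := by
  rw [Gm_mul, neg_add_cancel, Gm_zero]

theorem J_eq (h : ℂ) : D.J h = asm fun c =>
    Gm h c (1 / 2) * D.motion.tw (Complex.exp h) (mirror c) * Gm h c (-(1 / 2)) := by
  rw [J_eq_prod]
  simp only [Jk_eq]
  rw [asm_list_prod (fun k c => ((blk_Gm _ _ _).mul (D.blk_fac _ k c)).mul (blk_Gm _ _ _))]
  congr 1; ext1 c
  rw [conj_list_prod (Gm_half h c) (Gm_half' h c), ← tw_eq (le_max_right _ _)]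

theorem flip_J_eq (h : ℂ) : flip (D.J h) = asm fun c =>
    Gm h c (1 / 2) * D.motion.tw' (Complex.exp h) (mirror c) * Gm h c (-(1 / 2)) := by
  rw [J_eq_prod, flip_list_prod, List.map_map]
  simp only [Function.comp_def, flip_Jk_eq]
  rw [asm_list_prod (fun k c => ((blk_Gm _ _ _).mul (D.blk_fac' _ k c)).mul (blk_Gm _ _ _))]
  congr 1; ext1 c
  rw [conj_list_prod (Gm_half h c) (Gm_half' h c), ← tw'_eq (le_max_right _ _)]

theorem blk_tw_box (q : ℂ) (c : ℤ) : Blk (box c) (D.motion.tw q (mirror c)) :=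
  Blk.list_prod fun k => D.blk_fac q k c

theorem isUnit_J (h : ℂ) (c : ℤ) : IsUnit (Gm h c (1 / 2) *
    D.motion.tw (Complex.exp h) (mirror c) * Gm h c (-(1 / 2))).det := by
  rw [Matrix.det_mul, Matrix.det_mul, mul_right_comm, ← Matrix.det_mul, Gm_half, Matrix.det_one,
    one_mul]
  exact lowerUni_tw.isUnit

theorem Bt0_conj (h q : ℂ) (c : ℤ) : (Gm h c (-(1 / 2)) * Bt0 q (mirror c) * Gm h c (1 / 2) :
    Matrix (Fin (ℓ + 1)) (Fin (ℓ + 1)) ℂ) = Bt0 q (mirror c) := by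
  ext x y
  rw [Gm, Gm, Matrix.mul_diagonal, Matrix.diagonal_mul]
  rcases eq_or_ne x y with rfl | hxy
  · rw [mul_right_comm, ← qpow_add, neg_mul, neg_add_cancel, qpow_zero, one_mul]
  · rw [Bt0, Qm, Matrix.add_apply, Matrix.diagonal_apply_ne _ hxy, zero_add, upperMat]
    split_ifs with hlt
    · by_cases hs : Special (pt x) (pt y) (mirror c)
      · have h1 : atPt (mirror c) (pt x) = 0 := if_neg (hs.ne_mirror (pt_lt.2 hlt) (Or.inl rfl))
        have h2 : atPt (mirror c) (pt y) = 0 := if_neg (hs.ne_mirror (pt_lt.2 hlt) (Or.inr rfl))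
        simp [h1, h2, qpow_zero]
      · rw [low0_of_not_special hs, mul_zero, zero_mul]
    · rw [mul_zero, zero_mul]

/-- The conjugation by `Gm` commutes with the block of `R_st` (`Bt0_conj`) and so only surrounds `Rb`. -/
theorem core_eq (h : ℂ) : (D.J h)⁻¹ * Rst ℓ (Complex.exp h) * flip (D.J h) = asm fun c =>
    Gm h c (1 / 2) * D.motion.Rb (Complex.exp h) (mirror c) * Gm h c (-(1 / 2)) := by
  have hb := fun c => ((blk_Gm (N := box c) h c (1 / 2)).mul
    (D.blk_tw_box (Complex.exp h) c)).mul (blk_Gm h c (-(1 / 2)))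
  have hi := fun c => (hb c).inv (D.isUnit_J h c)
  rw [D.J_eq, asm_inv hb (D.isUnit_J h), ← D.J_eq, flip_J_eq, Rst_eq, asm_mul hi,
    asm_mul (fun c => (hi c).mul (blk_Bt0 _ c))]
  congr 1; ext1 c
  have e : (Gm h c (1 / 2) * D.motion.tw (Complex.exp h) (mirror c) * Gm h c (-(1 / 2)))⁻¹ =
      Gm h c (1 / 2) * (D.motion.tw (Complex.exp h) (mirror c))⁻¹ * Gm h c (-(1 / 2)) := by
    refine Matrix.inv_eq_right_inv ?_
    calc _ = Gm h c (1 / 2) * (D.motion.tw (Complex.exp h) (mirror c) *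
          (Gm h c (-(1 / 2)) * Gm h c (1 / 2)) * (D.motion.tw (Complex.exp h) (mirror c))⁻¹) *
          Gm h c (-(1 / 2)) := by simp only [mul_assoc]
      _ = 1 := by
        rw [Gm_half', mul_one, Matrix.mul_nonsing_inv _ lowerUni_tw.isUnit, mul_one, Gm_half]
  rw [e, Rb]
  nth_rewrite 2 [← Bt0_conj h (Complex.exp h) c]
  simp only [mul_assoc]

end BDTriple

end GGS

namespace GGS

open Motion

variable {ℓ : ℕ}

/-! ### The Hecke relation -/

theorem asm_B0 (q : ℂ) : asm (fun c => B0 q (mirror c)) = flip (Rst ℓ q) := by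
  classical
  rw [Rst_eq]
  refine (flip_asm fun u v ht => ?_).symm
  have e1 : u.1 = v.1 ↔ u.2 = v.2 := by
    rw [← pt_inj, ← pt_inj]; simp only [tot] at ht; omega
  have e2 : u.1 < v.1 ↔ v.2 < u.2 := by
    rw [← pt_lt, ← pt_lt]; simp only [tot] at ht; omega
  have e3 : mirror (tot u) = mirror (pt u.1 + pt v.1) ↔
      mirror (tot u) = mirror (pt v.2 + pt u.2) :=
    ⟨fun h => by have := mirror_inj h; congr 1; simp only [tot] at *; omega,
      fun h => by have := mirror_inj h; congr 1; simp only [tot] at *; omega⟩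
  have e4 : atPt (mirror (tot u)) (pt u.1) = atPt (mirror (tot u)) (pt u.2) := atPt_mirror rfl
  simp only [B0, Bt0, Qm, Matrix.add_apply, lowerMat, upperMat, Matrix.diagonal_apply, e1, e2, low0,
    g_eq_zpow, (id_ne_mirror _).symm, if_false, e4]
  congr 1
  refine if_congr Iff.rfl ?_ rfl
  congr 1
  exact if_congr e3 rfl rfl

theorem asm_C0 (q : ℂ) :
    asm (fun c => C0 q (mirror c)) = Rst ℓ q - (q - q⁻¹) • flipMat ℓ := by
  rw [Rst_eq]
  ext u v
  have e : ∀ c, (C0 q (mirror c) : Matrix (Fin (ℓ + 1)) (Fin (ℓ + 1)) ℂ) =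
      Bt0 q (mirror c) - (q - q⁻¹) • perm c := by
    intro c
    rw [← D0_mirror, D0, sub_sub_cancel]
  have e2 : u.swap = v ↔ tot u = tot v ∧ pt u.2 + pt v.2 = tot u := by
    constructor
    · rintro rfl; simp only [tot, Prod.snd_swap, Prod.fst_swap]; omega
    · rintro ⟨h, h'⟩
      simp only [tot] at h h'
      exact Prod.ext (pt_inj.1 (show pt u.2 = pt v.1 by omega))
        (pt_inj.1 (show pt u.1 = pt v.2 by omega))
  simp only [asm, e, Matrix.sub_apply, Matrix.smul_apply, perm, flipMat, e2]
  by_cases h : tot u = tot v <;> simp [h]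

theorem blk_B0 {q : ℂ} (c : ℤ) : Blk (box c) (B0 q (mirror c) :
    Matrix (Fin (ℓ + 1)) (Fin (ℓ + 1)) ℂ) := by
  refine Blk.add (Blk.diagonal _) fun x y h => ?_
  rw [lowerMat] at h
  split_ifs at h with hxy
  · by_cases hs : Special (pt y) (pt x) (mirror c)
    · have h1 := mirror_inj (hs.resolve_left (id_ne_mirror _).symm)
      have := x.2; have := y.2
      simp only [box, Set.mem_ofPred_eq, pt] at *; omega
    · exact absurd (low0_of_not_special hs) h
  · exact absurd rfl h

/-- The Hecke relation for the standard `R`-matrix. -/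
theorem flip_Rst_mul {q : ℂ} (hq : q ≠ 0) :
    flip (Rst ℓ q) * Rst ℓ q = (q - q⁻¹) • (flipMat ℓ * Rst ℓ q) + 1 := by
  have h : flip (Rst ℓ q) * (Rst ℓ q - (q - q⁻¹) • flipMat ℓ) = 1 := by
    rw [← asm_B0, ← asm_C0, asm_mul blk_B0, ← asm_one]
    congr 1; ext1 c
    exact B0_mul_C0 hq
  rw [mul_sub, Matrix.mul_smul, flip_mul_flipMat, sub_eq_iff_eq_add] at h
  rw [h]; exact add_comm _ _

theorem qpowCartan_mul (h : ℂ) (s t : Matrix (Fin (ℓ + 1)) (Fin (ℓ + 1)) ℂ) :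
    qpowCartan h s * qpowCartan h t = qpowCartan h (s + t) := by
  rw [qpowCartan, qpowCartan, qpowCartan, Matrix.diagonal_mul_diagonal]
  congr 1; ext p
  rw [← qpow_add]; rfl

theorem flip_qpowCartan (h : ℂ) (s : Matrix (Fin (ℓ + 1)) (Fin (ℓ + 1)) ℂ) :
    flip (qpowCartan h s) = qpowCartan h s.transpose := by
  ext u v
  simp only [flip_apply, qpowCartan, Matrix.diagonal_apply, Prod.swap_inj]
  rfl

theorem flip_qpowCartan_mul {s : Matrix (Fin (ℓ + 1)) (Fin (ℓ + 1)) ℂ} (hs : s.transpose = -s)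
    (h : ℂ) : flip (qpowCartan h s) * qpowCartan h s = 1 := by
  rw [flip_qpowCartan, hs, qpowCartan_mul, neg_add_cancel]
  simp [qpowCartan, qpow_zero]

namespace BDTriple

variable (D : BDTriple ℓ) {s : Matrix (Fin (ℓ + 1)) (Fin (ℓ + 1)) ℂ}

theorem J_mul_inv (h : ℂ) : D.J h * (D.J h)⁻¹ = 1 := by
  have hb := fun c => ((blk_Gm (N := box c) h c (1 / 2)).mul
    (D.blk_tw_box (Complex.exp h) c)).mul (blk_Gm h c (-(1 / 2)))
  rw [J_eq, asm_inv hb (D.isUnit_J h), asm_mul hb, ← asm_one]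
  congr 1; ext1 c
  exact Matrix.mul_nonsing_inv _ (D.isUnit_J h c)

/-- The Hecke relation for `R_J`, which is conjugate to `R_st` after composition with the flip. -/
theorem flip_RJ_mul (hs : s.transpose = -s) (h : ℂ) : flip (D.RJ s h) * D.RJ s h =
    (Complex.exp h - (Complex.exp h)⁻¹) • (flipMat ℓ * D.RJ s h) + 1 := by
  set S := qpowCartan h s with hS
  have h1 : flip S * S = 1 := flip_qpowCartan_mul hs h
  have h2 := D.J_mul_inv h
  have h3 : flip (D.J h)⁻¹ * flip (D.J h) = 1 := by
    rw [← flip_mul, mul_eq_one_comm.1 h2, flip_one]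
  have hff : ∀ X : Mat2 ℓ, flip (flip X) = X := fun X => by
    ext u v; simp only [flip_apply, Prod.swap_swap]
  rw [RJ, ← hS]
  simp only [flip_mul, hff]
  calc _ = flip S * flip (D.J h)⁻¹ * flip (Rst ℓ (Complex.exp h)) * (D.J h *
        (flip S * S) * (D.J h)⁻¹) * Rst ℓ (Complex.exp h) * flip (D.J h) * S := by
          simp only [mul_assoc]
    _ = flip S * flip (D.J h)⁻¹ * (flip (Rst ℓ (Complex.exp h)) * Rst ℓ (Complex.exp h)) *
          flip (D.J h) * S := by rw [h1, mul_one, h2]; simp only [mul_assoc, one_mul]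
    _ = (Complex.exp h - (Complex.exp h)⁻¹) • (flip S * (flip (D.J h)⁻¹ * (flipMat ℓ *
          Rst ℓ (Complex.exp h) * flip (D.J h) * S))) +
            flip S * (flip (D.J h)⁻¹ * flip (D.J h)) * S := by
        rw [flip_Rst_mul (Complex.exp_ne_zero h)]
        simp only [mul_add, add_mul, Matrix.mul_smul, Matrix.smul_mul, mul_assoc, mul_one]
    _ = _ := by
        rw [h3, mul_one, h1]
        simp only [← mul_assoc]
        rw [← flip_mul_flipMat S, mul_assoc (flip S) (flipMat ℓ), ← flip_mul_flipMat]
        simp only [mul_assoc]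

/-! ### The entries of `R_J` -/

theorem RJ_apply (h : ℂ) (u v : Fin (ℓ + 1) × Fin (ℓ + 1)) : D.RJ s h u v =
    if tot u = tot v then qpow h (s u.1 u.2 + s v.1 v.2 +
      1 / 2 * (atPt (mirror (tot u)) (pt u.2) - atPt (mirror (tot u)) (pt v.2))) *
      D.motion.Rb (Complex.exp h) (mirror (tot u)) u.2 v.2 else 0 := by
  rw [RJ, core_eq, qpowCartan, Matrix.mul_diagonal, Matrix.diagonal_mul, asm]
  split_ifs
  · rw [Gm, Gm, Matrix.mul_diagonal, Matrix.diagonal_mul, mul_sub, sub_eq_add_neg, qpow_add,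
      qpow_add, qpow_add, neg_mul]
    ring
  · ring

theorem RJ_diag (h : ℂ) (u : Fin (ℓ + 1) × Fin (ℓ + 1)) : D.RJ s h u u =
    qpow h (2 * s u.1 u.2 + if u.1 = u.2 then 1 else 0) := by
  rw [RJ_apply, if_pos rfl, sub_self, mul_zero, add_zero, ← two_mul,
    Rb_diag (Complex.exp_ne_zero h) (rigid_mirror _), qpow_add]
  congr 1
  have : mirror (tot u) = mirror (2 * pt u.2) ↔ u.1 = u.2 := by
    rw [← pt_inj]
    constructor
    · intro h; have := mirror_inj h; simp only [tot] at this; omega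
    · intro h; congr 1; simp only [tot]; omega
  simp only [g, this]
  split_ifs <;> simp [qpow]

theorem qpow_neg_left (h a : ℂ) : qpow (-h) a = qpow h (-a) := by simp [qpow]

theorem RJ_flip_upper (hs : s.transpose = -s) (h : ℂ) {u v : Fin (ℓ + 1) × Fin (ℓ + 1)}
    (huv : u.2 < v.2) (ht : tot u = tot v) : D.RJ s h u.swap v.swap =
      D.RJ s (-h) u v + (Complex.exp h - (Complex.exp h)⁻¹) * flipMat ℓ u v := by
  have hs' : ∀ i j, s j i = -s i j := fun i j => congrFun (congrFun hs i) j
  have hq := Complex.exp_ne_zero h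
  have e1 := D.motion.Rb_flip hq (c := tot u) huv (x' := u.1) (y' := v.1)
    (by simp only [tot]; omega) (by simp only [tot] at *; omega)
  rw [RJ_apply, RJ_apply, tot_swap, tot_swap, if_pos ht, if_pos ht]
  simp only [Prod.fst_swap, Prod.snd_swap]
  rw [hs' u.1 u.2, hs' v.1 v.2, atPt_mirror (a := pt u.1) (b := pt u.2) rfl,
    atPt_mirror (a := pt v.1) (b := pt v.2) ht.symm, Complex.exp_neg, qpow_neg_left]
  have e2 : flipMat ℓ u v = if pt u.2 + pt v.2 = tot u then 1 else 0 := by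
    refine if_congr ⟨?_, ?_⟩ rfl rfl
    · rintro rfl; simp only [tot, Prod.snd_swap]; omega
    · intro h'
      simp only [tot] at ht h'
      exact Prod.ext (pt_inj.1 (show pt u.2 = pt v.1 by omega))
        (pt_inj.1 (show pt u.1 = pt v.2 by omega))
  rw [e2]
  rw [g_eq_zpow, g_eq_zpow, ← qpow_int, ← qpow_int] at e1
  set a : ℂ := (atPt (mirror (tot u)) (pt u.2) : ℂ)
  set b : ℂ := (atPt (mirror (tot u)) (pt v.2) : ℂ)
  have e3 : D.motion.Rb (Complex.exp h) (mirror (tot u)) u.1 v.1 = qpow h (-a) *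
      (qpow h b * D.motion.Rb (Complex.exp h)⁻¹ (mirror (tot u)) u.2 v.2 +
        (Complex.exp h - (Complex.exp h)⁻¹) * if pt u.2 + pt v.2 = tot u then 1 else 0) := by
    rw [← e1, ← mul_assoc, ← qpow_add, neg_add_cancel, qpow_zero, one_mul]
  rw [e3, ← mul_assoc, ← qpow_add, mul_add, ← mul_assoc, ← qpow_add]
  congr 1
  · congr 2; ring
  · split_ifs with h4
    · have h5 : v = u.swap := by
        simp only [tot] at ht h4
        exact Prod.ext (pt_inj.1 (show pt v.1 = pt u.2 by omega))
          (pt_inj.1 (show pt v.2 = pt u.1 by omega))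
      have h6 : b = a := by
        simp only [a, b, h5, Prod.snd_swap]
        rw [atPt_mirror (a := pt u.1) (b := pt u.2) rfl]
      have h7 : a = 0 := by
        simp only [a, Int.cast_eq_zero]
        refine if_neg fun h => ?_
        have := mirror_inj h
        have := pt_lt.2 huv
        omega
      rw [h6, h7, h5, Prod.fst_swap, Prod.snd_swap, hs' u.1 u.2]
      simp [qpow_zero]
    · ring

/-- Flipping `R_J` has the same effect as inverting `q`, up to a multiple of the flip. -/
theorem flip_RJ (hs : s.transpose = -s) (h : ℂ) : flip (D.RJ s h) =
    D.RJ s (-h) + (Complex.exp h - (Complex.exp h)⁻¹) • flipMat ℓ := by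
  ext u v
  rw [flip_apply, Matrix.add_apply, Matrix.smul_apply, smul_eq_mul]
  by_cases ht : tot u = tot v
  · rcases lt_trichotomy u.2 v.2 with h1 | h1 | h1
    · exact D.RJ_flip_upper hs h h1 ht
    · obtain rfl := tot_ext ht h1
      have hs' : s u.2 u.1 = -s u.1 u.2 := congrFun (congrFun hs u.1) u.2
      rw [RJ_diag, RJ_diag, qpow_neg_left, Prod.fst_swap, Prod.snd_swap, hs', flipMat]
      by_cases h2 : u.1 = u.2
      · have h3 : u.swap = u := Prod.ext h2.symm h2
        have h4 : s u.1 u.2 = 0 := by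
          rw [h2] at hs' ⊢; linear_combination (1 / 2) * hs'
        rw [if_pos h2.symm, if_pos h2, if_pos h3, h4]
        simp [qpow, Complex.exp_neg]
      · have h3 : u.swap ≠ u := fun h => h2 (congrArg Prod.snd h)
        rw [if_neg (Ne.symm h2), if_neg h2, if_neg h3]
        simp
    · have h2 : u.swap.2 < v.swap.2 := by
        rw [Prod.snd_swap, Prod.snd_swap, ← pt_lt]
        have := pt_lt.2 h1
        simp only [tot] at ht; omega
      have h3 := D.RJ_flip_upper hs (-h) h2 (by rwa [tot_swap, tot_swap])
      rw [Prod.swap_swap, Prod.swap_swap, neg_neg, Complex.exp_neg, inv_inv] at h3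
      have h4 : flipMat ℓ u.swap v.swap = flipMat ℓ u v := by
        simp only [flipMat]
        refine if_congr ?_ rfl rfl
        rw [Prod.swap_swap]
        exact ⟨fun h => by rw [h, Prod.swap_swap], fun h => by rw [← h, Prod.swap_swap]⟩
      rw [h3, h4]; ring
  · rw [RJ_apply, RJ_apply, tot_swap, tot_swap, if_neg ht, if_neg ht, flipMat, if_neg]
    · simp
    · rintro rfl; exact ht (tot_swap u).symm

/-- Inverting `q` inverts `R_J`. -/
theorem RJ_neg_mul (hs : s.transpose = -s) (h : ℂ) : D.RJ s (-h) * D.RJ s h = 1 := by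
  have h1 := D.flip_RJ_mul hs h
  rw [D.flip_RJ hs, add_mul, Matrix.smul_mul] at h1
  exact add_left_cancel ((add_comm _ _).trans h1)

end BDTriple

end GGS

namespace GGS

open Motion

variable {ℓ : ℕ}

namespace BDTriple

variable (D : BDTriple ℓ) {s : Matrix (Fin (ℓ + 1)) (Fin (ℓ + 1)) ℂ}

/-! ### The classical `r`-matrix -/

open Classical in
/-- The coefficient of the pair `(α, β)` in `a`. -/
noncomputable def aCoef (α β : PosRoot ℓ) : ℂ :=
  if D.Prec α β then (-1 : ℂ) ^ (D.C α β * (α.height - 1)) else 0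

theorem a_apply (u v : Fin (ℓ + 1) × Fin (ℓ + 1)) : D.a u v =
    (if h : v.1 < u.1 ∧ u.2 < v.2 then D.aCoef ⟨(v.1, u.1), h.1⟩ ⟨(u.2, v.2), h.2⟩ else 0) -
      if h : v.2 < u.2 ∧ u.1 < v.1 then D.aCoef ⟨(v.2, u.2), h.1⟩ ⟨(u.1, v.1), h.2⟩ else 0 := by
  have e : D.a = ∑ α : PosRoot ℓ, ∑ β : PosRoot ℓ, D.aCoef α β • eNegPos α β -
      ∑ α : PosRoot ℓ, ∑ β : PosRoot ℓ, D.aCoef α β • ePosNeg β α := by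
    rw [a, ← Finset.sum_sub_distrib]
    refine Finset.sum_congr rfl fun α _ => ?_
    rw [← Finset.sum_sub_distrib]
    refine Finset.sum_congr rfl fun β _ => ?_
    rw [aCoef, ← smul_sub]
    split_ifs <;> simp
  rw [e, Matrix.sub_apply, sum_eNegPos, sum_ePosNeg]

open Classical in
theorem rst_apply (u v : Fin (ℓ + 1) × Fin (ℓ + 1)) : rst ℓ u v =
    (if u = v then (if u.1 = u.2 then 1 / 2 else 0) else 0) +
      if h : v.1 < u.1 ∧ u.2 < v.2 then
        if (⟨(v.1, u.1), h.1⟩ : PosRoot ℓ) = ⟨(u.2, v.2), h.2⟩ then 1 else 0 else 0 := by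
  have e : ∑ α : PosRoot ℓ, eNegPos α α =
      ∑ α : PosRoot ℓ, ∑ β : PosRoot ℓ, (if α = β then (1 : ℂ) else 0) • eNegPos α β := by
    refine Finset.sum_congr rfl fun α _ => ?_
    rw [Finset.sum_eq_single α]
    · simp
    · intro β _ hβ; simp [Ne.symm hβ]
    · simp
  rw [rst, e, Matrix.add_apply, sum_eNegPos, sum_E_diag_same, Matrix.smul_apply,
    Matrix.diagonal_apply]
  congr 1
  split_ifs <;> simp

theorem not_prec_self (α : PosRoot ℓ) : ¬ D.Prec α α := by
  rintro ⟨k, hk, h⟩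
  have h0 : D.Iter 0 α α := rfl
  exact hk.ne (Iter.det D h0 h)

theorem r_diag (u : Fin (ℓ + 1) × Fin (ℓ + 1)) :
    D.r s u u = s u.1 u.2 + if u.1 = u.2 then 1 / 2 else 0 := by
  rw [r, Matrix.add_apply, Matrix.add_apply, cartan_eq, Matrix.diagonal_apply_eq, a_apply,
    rst_apply]
  simp

open Classical in
theorem r_upper {u v : Fin (ℓ + 1) × Fin (ℓ + 1)} (h1 : v.1 < u.1) (h2 : u.2 < v.2) :
    D.r s u v = D.aCoef ⟨(v.1, u.1), h1⟩ ⟨(u.2, v.2), h2⟩ +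
      if (⟨(v.1, u.1), h1⟩ : PosRoot ℓ) = ⟨(u.2, v.2), h2⟩ then 1 else 0 := by
  have huv : u ≠ v := by rintro rfl; exact lt_irrefl _ h1
  rw [r, Matrix.add_apply, Matrix.add_apply, cartan_eq, Matrix.diagonal_apply_ne _ huv, a_apply,
    rst_apply, dif_pos (show v.1 < u.1 ∧ u.2 < v.2 from ⟨h1, h2⟩),
    dif_neg (show ¬ (v.2 < u.2 ∧ u.1 < v.1) from fun h => lt_asymm h.1 h2), if_neg huv,
    dif_pos (show v.1 < u.1 ∧ u.2 < v.2 from ⟨h1, h2⟩)]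
  ring

theorem r_lower {u v : Fin (ℓ + 1) × Fin (ℓ + 1)} (h1 : v.2 < u.2) (h2 : u.1 < v.1) :
    D.r s u v = -D.aCoef ⟨(v.2, u.2), h1⟩ ⟨(u.1, v.1), h2⟩ := by
  have huv : u ≠ v := by rintro rfl; exact lt_irrefl _ h1
  rw [r, Matrix.add_apply, Matrix.add_apply, cartan_eq, Matrix.diagonal_apply_ne _ huv, a_apply,
    rst_apply, dif_pos (show v.2 < u.2 ∧ u.1 < v.1 from ⟨h1, h2⟩), if_neg huv,
    dif_neg (show ¬ (v.1 < u.1 ∧ u.2 < v.2) from fun h => lt_asymm h.1 h2),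
    dif_neg (show ¬ (v.1 < u.1 ∧ u.2 < v.2) from fun h => lt_asymm h.1 h2)]
  ring

theorem aCoef_eq_zero {α β : PosRoot ℓ} (h : pt α.1.2 + pt β.1.1 ≠ pt α.1.1 + pt β.1.2) :
    D.aCoef α β = 0 :=
  if_neg fun ⟨_, _, hI⟩ => h (Iter.sum_eq D hI)

/-- `r` preserves the sum of the indices. -/
theorem r_of_tot_ne {u v : Fin (ℓ + 1) × Fin (ℓ + 1)} (ht : tot u ≠ tot v) : D.r s u v = 0 := by
  have huv : u ≠ v := by rintro rfl; exact ht rfl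
  rw [r, Matrix.add_apply, Matrix.add_apply, cartan_eq, Matrix.diagonal_apply_ne _ huv, a_apply,
    rst_apply, if_neg huv]
  simp only [tot] at ht
  have e1 : (if h : v.1 < u.1 ∧ u.2 < v.2 then D.aCoef ⟨(v.1, u.1), h.1⟩ ⟨(u.2, v.2), h.2⟩
      else 0) = 0 := by
    split_ifs
    · exact D.aCoef_eq_zero fun h => ht h
    · rfl
  have e2 : (if h : v.2 < u.2 ∧ u.1 < v.1 then D.aCoef ⟨(v.2, u.2), h.1⟩ ⟨(u.1, v.1), h.2⟩
      else 0) = 0 := by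
    split_ifs
    · refine D.aCoef_eq_zero fun h => ht ?_
      simp only at h; omega
    · rfl
  rw [e1, e2, dite_eq_right_iff.2]
  · ring
  · intro h
    refine if_neg fun h' => ht ?_
    have h3 : v.1 = u.2 := congrArg (fun α : PosRoot ℓ => α.1.1) h'
    have h4 : u.1 = v.2 := congrArg (fun α : PosRoot ℓ => α.1.2) h'
    rw [h3, h4]; omega

/-! ### The entries of `R_J` as monomials -/

/-- An upper entry of `R_J` is a monomial with coefficient `r`. -/
theorem RJ_upper {u v : Fin (ℓ + 1) × Fin (ℓ + 1)} (huv : u.2 < v.2) (ht : tot u = tot v) :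
    ∃ y : ℂ, ∀ h, D.RJ s h u v =
      D.r s u v * qpow h y * (Complex.exp h - (Complex.exp h)⁻¹) := by
  classical
  have huv0 := pt_lt.2 huv
  have huv1 : v.1 < u.1 := pt_lt.1 (by simp only [tot] at ht; omega)
  have huv10 := pt_lt.2 huv1
  set α : PosRoot ℓ := ⟨(v.1, u.1), huv1⟩ with hα
  set β : PosRoot ℓ := ⟨(u.2, v.2), huv⟩ with hβ
  have hm : Mirrors (tot u) α β := ⟨rfl, ht.symm⟩
  rw [D.r_upper huv1 huv]
  by_cases hex : ∃ k χ, Special (pt α.1.1) (pt α.1.2) χ ∧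
      D.motion.Pth (pt α.1.1) (pt α.1.2) k χ (mirror (tot u))
  · obtain ⟨k, χ, hχ, hp⟩ := hex
    have h1 := hp.reflect huv10 hχ
    have e1 : tot u - pt α.1.2 = pt u.2 := by simp only [hα, tot]; omega
    have e2 : tot u - pt α.1.1 = pt v.2 := by simp only [hα, tot] at *; omega
    have hI := (D.iter_mirror_iff hm).2 ⟨χ, hχ, hp⟩
    -- the coefficient and a power of `q` are split off from the coefficient of the special motion
    obtain ⟨n, hn⟩ : ∃ n : ℤ, ∀ q : ℂ, q ≠ 0 → low0 q (pt α.1.1) (pt α.1.2) χ =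
        (q - q⁻¹) * ((D.aCoef α β + if α = β then 1 else 0) * q ^ n) := by
      rcases Nat.eq_zero_or_pos k with rfl | hk
      · have hαβ : α = β := hI
        refine ⟨0, fun q _ => ?_⟩
        rw [aCoef, if_neg (hαβ ▸ D.not_prec_self α), if_pos hαβ, hp.2, low0,
          if_neg (id_ne_mirror _).symm, if_pos, zpow_zero, zero_add, one_mul]
        rw [← hm.2, ← hαβ]
      · have hαβ : α ≠ β := fun h => D.not_prec_self α ⟨k, hk, by rw [← h] at hI; exact hI⟩
        have hh := coe_height α
        rw [aCoef, if_pos ⟨k, hk, hI⟩, if_neg hαβ, add_zero, D.C_mul hm hk hχ hp]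
        rcases hχ with rfl | rfl
        · refine ⟨-((α.height - 1 : ℕ) : ℤ), fun q hq => ?_⟩
          have e3 : pt α.1.2 - pt α.1.1 - 1 = ((α.height - 1 : ℕ) : ℤ) := by omega
          rw [low0, if_pos rfl, if_pos rfl, e3, neg_eq_neg_one_mul q, mul_zpow, zpow_neg (-1 : ℂ),
            zpow_natCast, ← inv_pow, inv_neg, inv_one]
        · refine ⟨0, fun q hq => ?_⟩
          rw [low0, if_neg (id_ne_mirror _).symm, if_neg (id_ne_mirror _).symm, if_pos rfl]
          simp
    refine ⟨s u.1 u.2 + s v.1 v.2 +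
      1 / 2 * (atPt (mirror (tot u)) (pt u.2) - atPt (mirror (tot u)) (pt v.2)) + n +
      ((-(atPt (mirror (tot u)) (pt u.2) + D.motion.passAfter (pt u.2) (pt v.2) (pt u.2) k
        (mirror (tot u)) + D.motion.passAfter (pt u.2) (pt v.2) (pt v.2) k (mirror (tot u))) : ℤ)
          : ℂ), fun h => ?_⟩
    have hq := Complex.exp_ne_zero h
    have h2 := hχ.reflect (q := Complex.exp h) (c := tot u)
    rw [e1, e2] at h1 h2
    rw [RJ_apply, if_pos ht, Rb_upper hq huv h2.1 h1, h2.2.1, hn _ hq, ← qpow_int, ← qpow_int,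
      qpow_add h (_ + _) (Int.cast (-_)), qpow_add h _ (n : ℂ)]
    ring
  · refine ⟨0, fun h => ?_⟩
    have hq := Complex.exp_ne_zero h
    rw [aCoef, if_neg, if_neg, RJ_apply, if_pos ht, Rb_upper_zero hq huv (rigid_mirror _)]
    · simp
    · intro k χ hχ hp
      have e1 : pt u.2 = tot u - pt α.1.2 := by simp only [hα, tot]; omega
      have e2 : pt v.2 = tot u - pt α.1.1 := by simp only [hα, tot] at *; omega
      rw [e1, e2] at hχ hp
      obtain ⟨χ', h3, h4⟩ := hp.reflect' huv10 hχ
      exact hex ⟨k, χ', h3, h4⟩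
    · intro hαβ
      have hβα : β = α := hαβ.symm
      refine hex ⟨0, mirror (tot u), Or.inr ?_, rigid_mirror _, rfl⟩
      rw [← hm.2, hβα]
    · rintro ⟨k, -, hI⟩
      exact hex ⟨k, (D.iter_mirror_iff hm).1 hI⟩

/-- The lower entries follow from the upper ones by the flip, except on the antidiagonal, where both
`r` and `R_J` vanish. -/
theorem RJ_offdiag (hs : s.transpose = -s) {u v : Fin (ℓ + 1) × Fin (ℓ + 1)} (huv : u ≠ v) :
    ∃ y : ℂ, ∀ h, D.RJ s h u v =
      D.r s u v * qpow h y * (Complex.exp h - (Complex.exp h)⁻¹) := by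
  by_cases ht : tot u = tot v
  swap
  · exact ⟨0, fun h => by rw [RJ_apply, if_neg ht, D.r_of_tot_ne ht]; ring⟩
  rcases lt_trichotomy u.2 v.2 with h1 | h1 | h1
  · exact D.RJ_upper h1 ht
  · exact absurd (tot_ext ht h1) huv
  have h2 : u.1 < v.1 := by
    have := pt_lt.2 h1
    exact pt_lt.1 (by simp only [tot] at ht; omega)
  by_cases hsw : u.swap = v
  · subst hsw
    refine ⟨0, fun h => ?_⟩
    have hm : Special (pt u.swap.2) (pt u.2) (mirror (tot u)) := Or.inr rfl
    have h0 : D.aCoef ⟨(u.swap.2, u.2), h1⟩ ⟨(u.1, u.swap.1), h2⟩ = 0 :=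
      if_neg (D.not_prec_self ⟨(u.1, u.2), h1⟩)
    rw [D.r_lower h1 h2, h0, RJ_apply, if_pos ht,
      Rb_lower_zero (Complex.exp_ne_zero h) h1 (rigid_mirror _) fun k χ hχ h =>
        Nat.succ_ne_zero k (hχ.eq_zero (pt_lt.2 h1) hm h)]
    simp
  · obtain ⟨y, hy⟩ := D.RJ_upper (s := s) (u := u.swap) (v := v.swap) h2
      (by rwa [tot_swap, tot_swap])
    refine ⟨-y, fun h => ?_⟩
    have h3 := D.RJ_flip_upper hs h (u := u.swap) (v := v.swap) h2 (by rwa [tot_swap, tot_swap])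
    rw [Prod.swap_swap, Prod.swap_swap, flipMat, if_neg, mul_zero, add_zero, hy, qpow_neg_left,
      Complex.exp_neg, inv_inv] at h3
    · have h4 : D.r s u.swap v.swap = -D.r s u v := by
        rw [D.r_lower h1 h2, D.r_upper (u := u.swap) (v := v.swap) h1 h2, neg_neg, if_neg, add_zero]
        · rfl
        · intro h
          have h5 : v.2 = u.1 := congrArg (fun α : PosRoot ℓ => α.1.1) h
          have h6 : u.2 = v.1 := congrArg (fun α : PosRoot ℓ => α.1.2) h
          exact hsw (Prod.ext h6 h5.symm)
      rw [h3, h4]; ring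
    · intro h; rw [Prod.swap_swap] at h; exact hsw (by rw [h, Prod.swap_swap])

end BDTriple

end GGS

namespace GGS

open Asymptotics Filter Topology

/-! ### Second order jets at `ħ = 0` -/

/-- `f ≡ a + b ħ + c ħ²` modulo `ħ³`. -/
def HasJet (f : ℂ → ℂ) (a b c : ℂ) : Prop :=
  (fun h => f h - (a + b * h + c * h ^ 2)) =O[𝓝 0] fun h : ℂ => h ^ 3

variable {f g : ℂ → ℂ} {a b c a' b' c' : ℂ}

theorem HasJet.congr_coeff (hf : HasJet f a b c) (ha : a = a') (hb : b = b') (hc : c = c') :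
    HasJet f a' b' c' := by rwa [← ha, ← hb, ← hc]

theorem hasJet_const (a : ℂ) : HasJet (fun _ => a) a 0 0 := by
  simp only [HasJet, zero_mul, add_zero, sub_self]
  exact isBigO_zero _ _

theorem HasJet.const_mul (hf : HasJet f a b c) (x : ℂ) :
    HasJet (fun h => x * f h) (x * a) (x * b) (x * c) := by
  refine (IsBigO.const_mul_left hf x).congr_left fun h => ?_
  ring

theorem HasJet.sub (hf : HasJet f a b c) (hg : HasJet g a' b' c') :
    HasJet (fun h => f h - g h) (a - a') (b - b') (c - c') := by
  refine (IsBigO.sub hf hg).congr_left fun h => ?_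
  ring

theorem hasJet_sum {ι : Type*} (s : Finset ι) {f : ι → ℂ → ℂ} {a b c : ι → ℂ}
    (hf : ∀ i, HasJet (f i) (a i) (b i) (c i)) :
    HasJet (fun h => ∑ i ∈ s, f i h) (∑ i ∈ s, a i) (∑ i ∈ s, b i) (∑ i ∈ s, c i) := by
  refine (IsBigO.sum (s := s) fun i _ => hf i).congr_left fun h => ?_
  rw [Finset.sum_apply, Finset.sum_sub_distrib, Finset.sum_add_distrib, Finset.sum_add_distrib, Finset.sum_mul,
    Finset.sum_mul]

theorem HasJet.comp_neg (hf : HasJet f a b c) : HasJet (fun h => f (-h)) a (-b) c := by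
  have h1 : Tendsto (fun h : ℂ => -h) (𝓝 0) (𝓝 0) := by
    simpa using (continuous_neg.tendsto (0 : ℂ))
  refine ((hf.comp_tendsto h1).congr_left fun h => ?_).trans ?_
  · simp only [Function.comp]; ring
  · refine (isBigO_refl (fun h : ℂ => h ^ 3) (𝓝 0)).neg_left.congr_left fun h => ?_
    simp only [Function.comp]; ring

theorem isBigO_one_of_continuous {f : ℂ → ℂ} (hf : Continuous f) :
    f =O[𝓝 0] fun _ => (1 : ℂ) := hf.continuousAt.isBigO_one ℂ

theorem HasJet.isBigO_one (hf : HasJet f a b c) : f =O[𝓝 0] fun _ => (1 : ℂ) := by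
  have h1 : (fun h => f h - (a + b * h + c * h ^ 2)) =O[𝓝 0] fun _ => (1 : ℂ) :=
    IsBigO.trans hf (isBigO_one_of_continuous (by fun_prop))
  refine (h1.add (isBigO_one_of_continuous (f := fun h => a + b * h + c * h ^ 2)
    (by fun_prop))).congr_left fun h => ?_
  ring

theorem HasJet.mul (hf : HasJet f a b c) (hg : HasJet g a' b' c') :
    HasJet (fun h => f h * g h) (a * a') (a * b' + b * a') (a * c' + b * b' + c * a') := by
  have h1 : (fun h => (f h - (a + b * h + c * h ^ 2)) * g h) =O[𝓝 0] fun h : ℂ => h ^ 3 * 1 :=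
    IsBigO.mul hf hg.isBigO_one
  have h2 : (fun h => (a + b * h + c * h ^ 2) * (g h - (a' + b' * h + c' * h ^ 2)))
      =O[𝓝 0] fun h : ℂ => 1 * h ^ 3 :=
    IsBigO.mul (isBigO_one_of_continuous (by fun_prop)) hg
  have h3 : (fun h : ℂ => h ^ 3 * (b * c' + c * b' + c * c' * h)) =O[𝓝 0]
      fun h : ℂ => h ^ 3 * 1 :=
    IsBigO.mul (isBigO_refl _ _) (isBigO_one_of_continuous (by fun_prop))
  simp only [mul_one, one_mul] at h1 h2 h3
  refine ((h1.add h2).add h3).congr_left fun h => ?_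
  ring

/-- The lowest coefficient of a function which is small of order `n + 1` vanishes. -/
theorem eq_zero_of_isBigO {n : ℕ} (hf : Continuous f)
    (h : (fun h : ℂ => a + h * f h) =O[𝓝[≠] 0] fun h => h ^ (n + 1)) :
    a = 0 ∧ f =O[𝓝[≠] 0] fun h => h ^ n := by
  have h1 : Tendsto (fun h : ℂ => h ^ (n + 1)) (𝓝[≠] 0) (𝓝 0) := by
    have : Continuous fun h : ℂ => h ^ (n + 1) := by fun_prop
    simpa using (this.tendsto 0).mono_left nhdsWithin_le_nhds
  have h2 : Tendsto (fun h : ℂ => a + h * f h) (𝓝[≠] 0) (𝓝 a) := by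
    have : Continuous fun h : ℂ => a + h * f h := by fun_prop
    simpa using (this.tendsto 0).mono_left nhdsWithin_le_nhds
  have ha : a = 0 := tendsto_nhds_unique h2 (h.trans_tendsto h1)
  refine ⟨ha, ?_⟩
  subst ha
  have h3 := (isBigO_refl (fun h : ℂ => h⁻¹) (𝓝[≠] 0)).mul h
  refine h3.congr' ?_ ?_
  · filter_upwards [self_mem_nhdsWithin] with x hx
    rw [zero_add, inv_mul_cancel_left₀ hx]
  · filter_upwards [self_mem_nhdsWithin] with x hx
    rw [pow_succ', inv_mul_cancel_left₀ hx]

theorem HasJet.unique (hf : HasJet f a b c) (hf' : HasJet f a' b' c') :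
    a = a' ∧ b = b' ∧ c = c' := by
  have h1 : (fun h : ℂ => (a - a') + h * ((b - b') + h * ((c - c') + h * 0))) =O[𝓝[≠] 0]
      fun h => h ^ (2 + 1) := by
    refine (((IsBigO.sub hf' hf).congr_left fun h => ?_).mono nhdsWithin_le_nhds)
    ring
  obtain ⟨h2, h3⟩ := eq_zero_of_isBigO (by fun_prop) h1
  obtain ⟨h4, h5⟩ := eq_zero_of_isBigO (n := 1) (by fun_prop) h3
  obtain ⟨h6, -⟩ := eq_zero_of_isBigO (n := 0) (f := fun _ => 0) (by fun_prop) h5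
  exact ⟨sub_eq_zero.1 h2, sub_eq_zero.1 h4, sub_eq_zero.1 h6⟩

theorem hasJet_qpow (y : ℂ) : HasJet (fun h => qpow h y) 1 y (y ^ 2 / 2) := by
  have h1 : Tendsto (fun h : ℂ => y * h) (𝓝 0) (𝓝 0) := by
    have : Continuous fun h : ℂ => y * h := by fun_prop
    simpa using this.tendsto 0
  refine (((Complex.exp_sub_sum_range_isBigO_pow 3).comp_tendsto h1).congr_left
    fun h => ?_).trans ?_
  · simp only [Function.comp, qpow, Finset.sum_range_succ, Finset.sum_range_zero, Nat.factorial]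
    push_cast; ring
  · refine (IsBigO.const_mul_left (isBigO_refl (fun h : ℂ => h ^ 3) (𝓝 0)) (y ^ 3)).congr_left
      fun h => ?_
    simp only [Function.comp]; ring

theorem hasJet_sub_inv : HasJet (fun h => Complex.exp h - (Complex.exp h)⁻¹) 0 2 0 := by
  have h1 := (hasJet_qpow 1).sub (hasJet_qpow (-1))
  simp only [qpow, one_mul, neg_mul, Complex.exp_neg] at h1
  exact h1.congr_coeff (by ring) (by ring) (by ring)

theorem hasJet_monomial_zero (x y : ℂ) :
    HasJet (fun h => x * qpow h y * (Complex.exp h - (Complex.exp h)⁻¹) ^ 0) x (x * y)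
      (x * (y ^ 2 / 2)) := by
  simp only [pow_zero, mul_one]
  exact ((hasJet_qpow y).const_mul x).congr_coeff (by ring) rfl rfl

theorem hasJet_monomial_one (x y : ℂ) :
    HasJet (fun h => x * qpow h y * (Complex.exp h - (Complex.exp h)⁻¹) ^ 1) 0 (2 * x)
      (2 * x * y) := by
  simp only [pow_one]
  exact (((hasJet_qpow y).const_mul x).mul hasJet_sub_inv).congr_coeff (by ring) (by ring)
    (by ring)

/-- `f` has the form `x q^y (q - q⁻¹)^z` with `z ∈ {0, 1}`. -/
def IsMonomial (f : ℂ → ℂ) : Prop :=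
  ∃ (x y : ℂ) (z : ℕ), (z = 0 ∨ z = 1) ∧
    ∀ h : ℂ, f h = x * qpow h y * (Complex.exp h - (Complex.exp h)⁻¹) ^ z

/-- A monomial is determined by its second order jet. -/
theorem IsMonomial.eq (hf : IsMonomial f) (hg : IsMonomial g) (hf' : HasJet f a b c)
    (hg' : HasJet g a b c) : f = g := by
  obtain ⟨x, y, z, hz, h1⟩ := hf
  obtain ⟨x', y', z', hz', h2⟩ := hg
  rw [funext h1] at hf' ⊢
  rw [funext h2] at hg' ⊢
  rcases hz with rfl | rfl <;> rcases hz' with rfl | rfl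
  · obtain ⟨ha, hb, -⟩ := hf'.unique (hasJet_monomial_zero x y)
    obtain ⟨ha', hb', -⟩ := hg'.unique (hasJet_monomial_zero x' y')
    obtain rfl : x = x' := ha.symm.trans ha'
    by_cases hx : x = 0
    · simp [hx]
    · rw [mul_left_cancel₀ hx (hb.symm.trans hb')]
  · obtain ⟨ha, hb, -⟩ := hf'.unique (hasJet_monomial_zero x y)
    obtain ⟨ha', hb', -⟩ := hg'.unique (hasJet_monomial_one x' y')
    have hx : x = 0 := ha.symm.trans ha'
    have hx' : x' = 0 := by rw [hx, zero_mul] at hb; simpa [hb] using hb'.symm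
    simp [hx, hx']
  · obtain ⟨ha, hb, -⟩ := hf'.unique (hasJet_monomial_one x y)
    obtain ⟨ha', hb', -⟩ := hg'.unique (hasJet_monomial_zero x' y')
    have hx' : x' = 0 := ha'.symm.trans ha
    have hx : x = 0 := by rw [hx', zero_mul] at hb'; simpa [hb'] using hb.symm
    simp [hx, hx']
  · obtain ⟨-, hb, hc⟩ := hf'.unique (hasJet_monomial_one x y)
    obtain ⟨-, hb', hc'⟩ := hg'.unique (hasJet_monomial_one x' y')
    have h3 : 2 * x = 2 * x' := hb.symm.trans hb'
    obtain rfl : x = x' := mul_left_cancel₀ two_ne_zero h3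
    by_cases hx : x = 0
    · simp [hx]
    · rw [mul_left_cancel₀ (mul_ne_zero two_ne_zero hx) (hc.symm.trans hc')]

/-! ### Existence and uniqueness of the GGS matrix -/

namespace BDTriple

variable {ℓ : ℕ} (D : BDTriple ℓ) {s : Matrix (Fin (ℓ + 1)) (Fin (ℓ + 1)) ℂ}

theorem isGGSMatrix_iff (R : ℂ → Mat2 ℓ) : D.IsGGSMatrix s R ↔
    ∀ u v, IsMonomial (fun h => R h u v) ∧
      HasJet (fun h => R h u v) ((1 : Mat2 ℓ) u v) (2 * D.r s u v) (2 * (D.r s * D.r s) u v) := by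
  rw [IsGGSMatrix, ← forall_and]
  refine forall_congr' fun u => ?_
  rw [← forall_and]
  refine forall_congr' fun v => and_congr Iff.rfl ?_
  refine isBigO_congr (Eventually.of_forall fun h => ?_) (EventuallyEq.refl _ _)
  simp only [Matrix.add_apply, Matrix.smul_apply, smul_eq_mul]
  ring

theorem isMonomial_RJ (hs : s.transpose = -s) (u v : Fin (ℓ + 1) × Fin (ℓ + 1)) :
    IsMonomial (fun h => D.RJ s h u v) ∧
      ∃ c, HasJet (fun h => D.RJ s h u v) ((1 : Mat2 ℓ) u v) (2 * D.r s u v) c := by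
  by_cases huv : u = v
  · subst huv
    have h1 : ∀ h, D.RJ s h u u = 1 * qpow h (2 * D.r s u u) *
        (Complex.exp h - (Complex.exp h)⁻¹) ^ 0 := by
      intro h
      rw [RJ_diag, r_diag, pow_zero, mul_one, one_mul]
      congr 1
      split_ifs <;> ring
    refine ⟨⟨1, _, 0, Or.inl rfl, h1⟩, 1 * ((2 * D.r s u u) ^ 2 / 2), ?_⟩
    rw [funext h1]
    exact (hasJet_monomial_zero _ _).congr_coeff (Matrix.one_apply_eq _).symm (one_mul _) rfl
  · obtain ⟨y, hy⟩ := D.RJ_offdiag hs huv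
    have h1 : ∀ h, D.RJ s h u v = D.r s u v * qpow h y *
        (Complex.exp h - (Complex.exp h)⁻¹) ^ 1 := fun h => by rw [hy, pow_one]
    refine ⟨⟨_, _, 1, Or.inr rfl, h1⟩, 2 * D.r s u v * y, ?_⟩
    rw [funext h1]
    exact (hasJet_monomial_one _ _).congr_coeff (Matrix.one_apply_ne huv).symm rfl rfl

/-- As `R_J(-ħ) R_J(ħ) = 1`, the second order term of `R_J` is half of the square of the first order
term. -/
theorem isGGSMatrix_RJ (hs : s.transpose = -s) : D.IsGGSMatrix s (D.RJ s) := by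
  rw [isGGSMatrix_iff]
  intro u v
  refine ⟨(D.isMonomial_RJ hs u v).1, ?_⟩
  -- `t` is the second order term
  choose t ht using fun u v => (D.isMonomial_RJ hs u v).2
  have h1 := hasJet_sum Finset.univ fun w => (ht u w).comp_neg.mul (ht w v)
  have h2 : (fun h => ∑ w, D.RJ s (-h) u w * D.RJ s h w v) = fun _ => (1 : Mat2 ℓ) u v := by
    ext h
    rw [← Matrix.mul_apply, D.RJ_neg_mul hs]
  rw [h2] at h1
  obtain ⟨-, -, h3⟩ := h1.unique (hasJet_const _)
  have e1 : ∑ w, (1 : Mat2 ℓ) u w * t w v = t u v := by simp [Matrix.one_apply]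
  have e2 : ∑ w, t u w * (1 : Mat2 ℓ) w v = t u v := by simp [Matrix.one_apply]
  have e3 : ∑ w, -(2 * D.r s u w) * (2 * D.r s w v) = -4 * (D.r s * D.r s) u v := by
    rw [Matrix.mul_apply, Finset.mul_sum]
    exact Finset.sum_congr rfl fun w _ => by ring
  rw [Finset.sum_add_distrib, Finset.sum_add_distrib, e1, e2, e3] at h3
  exact (ht u v).congr_coeff rfl rfl (by linear_combination (1 / 2) * h3)

theorem IsGGSMatrix.eq {R R' : ℂ → Mat2 ℓ} (h : D.IsGGSMatrix s R) (h' : D.IsGGSMatrix s R') :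
    R = R' := by
  rw [isGGSMatrix_iff] at h h'
  ext x u v
  exact congrFun ((h u v).1.eq (h' u v).1 (h u v).2 (h' u v).2) x

end BDTriple

end GGS

/-- The GGS matrix attached to a Belavin–Drinfeld triple and a solution `s` is well defined, and the
ESS matrix `R_J` is equal to it. -/
theorem theorem2 (ℓ : ℕ) (D : GGS.BDTriple ℓ)
    (s : Matrix (Fin (ℓ + 1)) (Fin (ℓ + 1)) ℂ) (hs : D.IsSolution s) :
    (∃! R : ℂ → GGS.Mat2 ℓ, D.IsGGSMatrix s R) ∧
      ∀ R : ℂ → GGS.Mat2 ℓ, D.IsGGSMatrix s R → D.RJ s = R := by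
  have h := D.isGGSMatrix_RJ hs.1
  exact ⟨⟨D.RJ s, h, fun R hR => hR.eq D h⟩, fun R hR => h.eq D hR⟩
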